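/- Let $\tau\in\mathbb{C}$ with $\operatorname{Im}\tau>0$, put $q^{\lambda}=e^{2\pi i\lambda\tau}$ for $\lambda\in\mathbb{Q}$ and $q=q^1$, so that $0<|q|<1$ (every such $q$ arises). Let $K=\mathbb{C}(\{z\})$ be the field of convergent Laurent series with the automorphism $\phi$, $\phi(z)=qz$, and for $n\ge 1$ let $K_n=\mathbb{C}(\{z^{1/n}\})\supset K$ with the extension of $\phi$ given by $\phi(z^{1/n})=q^{1/n}z^{1/n}$. A $q$-difference module over $K$ is a finite dimensional $K$-vector space $M$ with an additive bijection $\Phi:M\to M$ such that $\Phi(fm)=\phi(f)\Phi(m)$ for $f\in K$, $m\in M$; submodules are the $K$-subspaces stable under $\Phi$ and $\Phi^{-1}$, isomorphisms are the $K$-linear bijections commuting with $\Phi$, and $\Phi(m_1\otimes m_2)=\Phi(m_1)\otimes\Phi(m_2)$ on tensor products. $M$ is indecomposable if $M\neq 0$ and $M$ is not the direct sum of two proper submodules. Every $M$ is isomorphic to $K[\Phi,\Phi^{-1}]/K[\Phi,\Phi^{-1}]L$ for some $L=\Phi^d+a_{d-1}\Phi^{d-1}+\cdots+a_0$ with $a_i\in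 K$ and $a_0\neq 0$; $M$ is pure if the Newton polygon of $L$ (the lower convex hull of the points $(i,v(a_i))$ with $0\le i\le d$, $a_d=1$ and $a_i\ne 0$, where $v$ is the order at $z=0$), which depends only on $M$, has exactly one slope. For $n\ge 1$, $t\in\mathbb{Z}$ with $\gcd(t,n)=1$ and $c\in\mathbb{C}^*$ with $|q|^{1/n}<|c|\le 1$, let $E(cz^{t/n})$ be the one-dimensional difference module $K_ne$, $\Phi e=cz^{t/n}e$, over $K_n$, regarded as an $n$-dimensional difference module over $K$. For $m\ge 1$ let $U_m=K^m$ with $\Phi(Y)=A\,\phi(Y)$, where $A$ is the $m\times m$ matrix with entries $1$ on the diagonal and on the first superdiagonal and $0$ elsewhere. Theorem. For all such $t,n,c,m$ the difference module $E(cz^{t/n})\otimes_K U_m$ is indecomposable and pure, and every indecomposable pure $q$-difference module over $K$ is isomorphic to one of these modules. Moreover, if $E(cz^{t/n})\otimes_K U_m\cong E(c'z^{t'/n'})\otimes_K U_{m'}$, with both sets of data as above, then $t/n=t'/n'$, $c^n=c'^{\,n'}$ and $m=m'$. -/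

import Mathlib

open scoped TensorProduct

noncomputable section

namespace QDiff

/-! ### Convergent Laurent series -/

/-- A formal Laurent series (which has a finite principal part) is convergent if its regular part
converges absolutely at some positive radius. -/
def IsConvergent (f : LaurentSeries ℂ) : Prop :=
  ∃ ρ : ℝ, 0 < ρ ∧ Summable fun k : ℕ => ‖f.coeff (k : ℤ)‖ * ρ ^ k

/-- Convergence expressed by a geometric bound on all coefficients. -/
theorem isConvergent_iff (f : LaurentSeries ℂ) :
    IsConvergent f ↔ ∃ C r : ℝ, 0 ≤ C ∧ 0 < r ∧ ∀ k : ℤ, ‖f.coeff k‖ ≤ C * r ^ k := by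
  constructor
  · rintro ⟨ρ, hρ, hs⟩
    set S := ∑' k : ℕ, ‖f.coeff (k : ℤ)‖ * ρ ^ k with hS
    have hS0 : 0 ≤ S := tsum_nonneg fun k => by positivity
    have hb : ∀ k : ℕ, ‖f.coeff (k : ℤ)‖ * ρ ^ k ≤ S := fun k =>
      hs.le_tsum k fun j _ => by positivity
    set T := ∑ k ∈ Finset.Icc f.order 0, ‖f.coeff k‖ * ρ ^ k with hT
    have hT0 : 0 ≤ T := Finset.sum_nonneg fun k _ => by positivity
    have key : ∀ k : ℤ, ‖f.coeff k‖ * ρ ^ k ≤ S + T := by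
      intro k
      rcases le_or_gt 0 k with hk | hk
      · lift k to ℕ using hk
        have := hb k
        rw [zpow_natCast]
        linarith
      · by_cases hk' : k < f.order
        · rw [HahnSeries.coeff_eq_zero_of_lt_order hk']
          simp only [norm_zero, zero_mul]
          positivity
        · have hm : k ∈ Finset.Icc f.order 0 := Finset.mem_Icc.2 ⟨not_lt.1 hk', hk.le⟩
          have := Finset.single_le_sum (f := fun k : ℤ => ‖f.coeff k‖ * ρ ^ k)
            (fun j _ => by positivity) hm
          linarith
    refine ⟨S + T, ρ⁻¹, by positivity, by positivity, fun k => ?_⟩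
    rw [inv_zpow, ← div_eq_mul_inv, le_div_iff₀ (by positivity)]
    exact key k
  · rintro ⟨C, r, hC, hr, h⟩
    refine ⟨(2 * r)⁻¹, by positivity, ?_⟩
    refine Summable.of_nonneg_of_le (fun k => by positivity) (fun k => ?_)
      ((summable_geometric_two).mul_left C)
    have := h k
    rw [zpow_natCast] at this
    calc ‖f.coeff (k : ℤ)‖ * (2 * r)⁻¹ ^ k ≤ C * r ^ k * (2 * r)⁻¹ ^ k := by gcongr
      _ = C * (1 / 2) ^ k := by
        rw [mul_assoc, ← mul_pow]
        congr 2
        field_simp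

theorem isConvergent_single (k : ℤ) (c : ℂ) : IsConvergent (HahnSeries.single k c) := by
  rw [isConvergent_iff]
  refine ⟨‖c‖, 1, norm_nonneg _, one_pos, fun j => ?_⟩
  rw [HahnSeries.coeff_single]
  split_ifs <;> simp

theorem IsConvergent.add {f g : LaurentSeries ℂ} (hf : IsConvergent f) (hg : IsConvergent g) :
    IsConvergent (f + g) := by
  obtain ⟨ρ, hρ, hf⟩ := hf
  obtain ⟨σ, hσ, hg⟩ := hg
  refine ⟨min ρ σ, lt_min hρ hσ, ?_⟩
  refine Summable.of_nonneg_of_le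
    (fun k => mul_nonneg (norm_nonneg _) (pow_nonneg (lt_min hρ hσ).le _)) (fun k => ?_)
    (hf.add hg)
  have h1 : min ρ σ ^ k ≤ ρ ^ k := pow_le_pow_left₀ (lt_min hρ hσ).le (min_le_left _ _) k
  have h2 : min ρ σ ^ k ≤ σ ^ k := pow_le_pow_left₀ (lt_min hρ hσ).le (min_le_right _ _) k
  have h0 : 0 ≤ min ρ σ ^ k := pow_nonneg (lt_min hρ hσ).le _
  calc ‖(f + g).coeff (k : ℤ)‖ * min ρ σ ^ k
      ≤ (‖f.coeff (k : ℤ)‖ + ‖g.coeff (k : ℤ)‖) * min ρ σ ^ k := by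
        gcongr
        exact norm_add_le _ _
    _ ≤ _ := by
        rw [add_mul]
        gcongr

theorem IsConvergent.neg {f : LaurentSeries ℂ} (hf : IsConvergent f) : IsConvergent (-f) := by
  obtain ⟨ρ, hρ, hf⟩ := hf
  exact ⟨ρ, hρ, by simpa using hf⟩

theorem IsConvergent.single_mul {f : LaurentSeries ℂ} (hf : IsConvergent f) (k : ℤ) :
    IsConvergent (HahnSeries.single k 1 * f) := by
  rw [isConvergent_iff] at hf ⊢
  obtain ⟨C, r, hC, hr, h⟩ := hf
  refine ⟨C * r ^ (-k), r, by positivity, hr, fun j => ?_⟩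
  rw [HahnSeries.coeff_single_mul, one_mul, mul_assoc, ← zpow_add₀ hr.ne']
  have := h (j - k)
  rwa [sub_eq_neg_add] at this ⊢

theorem isConvergent_ofPowerSeries_iff (P : PowerSeries ℂ) :
    IsConvergent (HahnSeries.ofPowerSeries ℤ ℂ P) ↔
      ∃ C r : ℝ, 0 ≤ C ∧ 0 < r ∧ ∀ n : ℕ, ‖PowerSeries.coeff n P‖ ≤ C * r ^ n := by
  rw [isConvergent_iff]
  constructor
  · rintro ⟨C, r, hC, hr, h⟩
    refine ⟨C, r, hC, hr, fun n => ?_⟩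
    have := h n
    rwa [LaurentSeries.coeff_coe_powerSeries, zpow_natCast] at this
  · rintro ⟨C, r, hC, hr, h⟩
    refine ⟨C, r, hC, hr, fun k => ?_⟩
    rw [PowerSeries.coeff_coe]
    split_ifs with hk
    · rw [norm_zero]
      positivity
    · have := h k.natAbs
      rwa [← zpow_natCast, Int.natAbs_of_nonneg (not_lt.1 hk)] at this

theorem IsConvergent.powerSeriesPart {f : LaurentSeries ℂ} (hf : IsConvergent f) :
    IsConvergent (HahnSeries.ofPowerSeries ℤ ℂ f.powerSeriesPart) := by
  rw [LaurentSeries.ofPowerSeries_powerSeriesPart]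
  exact hf.single_mul _

theorem IsConvergent.mul {f g : LaurentSeries ℂ} (hf : IsConvergent f) (hg : IsConvergent g) :
    IsConvergent (f * g) := by
  have hP := (isConvergent_ofPowerSeries_iff _).1 hf.powerSeriesPart
  have hQ := (isConvergent_ofPowerSeries_iff _).1 hg.powerSeriesPart
  obtain ⟨C, r, hC, hr, hP⟩ := hP
  obtain ⟨D, s, hD, hs, hQ⟩ := hQ
  have key : IsConvergent
      (HahnSeries.ofPowerSeries ℤ ℂ (f.powerSeriesPart * g.powerSeriesPart)) := by
    rw [isConvergent_ofPowerSeries_iff]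
    refine ⟨C * D, 2 * max r s, by positivity, by positivity, fun n => ?_⟩
    rw [PowerSeries.coeff_mul]
    have hm : 0 < max r s := lt_max_of_lt_left hr
    calc ‖∑ p ∈ Finset.HasAntidiagonal.antidiagonal n,
            PowerSeries.coeff p.1 f.powerSeriesPart * PowerSeries.coeff p.2 g.powerSeriesPart‖
        ≤ ∑ p ∈ Finset.HasAntidiagonal.antidiagonal n, C * D * max r s ^ n := by
          refine norm_sum_le_of_le _ fun p hp => ?_
          rw [norm_mul]
          have h1 : ‖PowerSeries.coeff p.1 f.powerSeriesPart‖ ≤ C * max r s ^ p.1 :=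
            (hP _).trans (by gcongr; exact le_max_left _ _)
          have h2 : ‖PowerSeries.coeff p.2 g.powerSeriesPart‖ ≤ D * max r s ^ p.2 :=
            (hQ _).trans (by gcongr; exact le_max_right _ _)
          calc _ ≤ (C * max r s ^ p.1) * (D * max r s ^ p.2) := by gcongr
            _ = C * D * max r s ^ (p.1 + p.2) := by ring
            _ = _ := by rw [Finset.HasAntidiagonal.mem_antidiagonal.1 hp]
      _ = (n + 1) * (C * D * max r s ^ n) := by
          rw [Finset.sum_const, Finset.Nat.card_antidiagonal, nsmul_eq_mul]
          push_cast
          ring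
      _ ≤ 2 ^ n * (C * D * max r s ^ n) := by
          gcongr
          exact_mod_cast Nat.lt_two_pow_self (n := n)
      _ = C * D * (2 * max r s) ^ n := by ring
  have e : f * g = HahnSeries.single f.order 1 * (HahnSeries.single g.order 1 *
      HahnSeries.ofPowerSeries ℤ ℂ (f.powerSeriesPart * g.powerSeriesPart)) := by
    conv_lhs => rw [← LaurentSeries.single_order_mul_powerSeriesPart f,
      ← LaurentSeries.single_order_mul_powerSeriesPart g]
    rw [map_mul]
    ring
  rw [e]
  exact (key.single_mul _).single_mul _

theorem IsConvergent.inv {f : LaurentSeries ℂ} (hf : IsConvergent f) : IsConvergent f⁻¹ := by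
  rcases eq_or_ne f 0 with rfl | h0
  · simpa using hf
  obtain ⟨C, r, hC, hr, hP⟩ := (isConvergent_ofPowerSeries_iff _).1 hf.powerSeriesPart
  set P := f.powerSeriesPart with hPdef
  have hP0 : PowerSeries.constantCoeff P ≠ 0 := by
    rw [← PowerSeries.coeff_zero_eq_constantCoeff_apply, LaurentSeries.powerSeriesPart_coeff]
    simpa using HahnSeries.coeff_order_eq_zero.not.2 h0
  set d := ‖(PowerSeries.constantCoeff P)⁻¹‖ with hd
  have hd0 : 0 ≤ d := norm_nonneg _
  set s := r * (1 + d * C) with hs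
  have hs0 : 0 < s := by positivity
  have key : ∀ n : ℕ, ‖PowerSeries.coeff n P⁻¹‖ ≤ d * s ^ n := by
    intro n
    induction n using Nat.strong_induction_on with
    | _ n ih =>
      rw [PowerSeries.coeff_inv]
      split_ifs with hn
      · rw [hn, pow_zero, mul_one]
      · rw [norm_mul, norm_neg]
        refine mul_le_mul_of_nonneg_left ?_ hd0
        have hsum : ‖∑ x ∈ Finset.HasAntidiagonal.antidiagonal n, if x.2 < n then
            PowerSeries.coeff x.1 P * PowerSeries.coeff x.2 P⁻¹ else 0‖ ≤
            ∑ x ∈ Finset.HasAntidiagonal.antidiagonal n, if x.2 < n then C * r ^ x.1 * (d * s ^ x.2) else 0 := by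
          refine norm_sum_le_of_le _ fun x _ => ?_
          split_ifs with hx
          · rw [norm_mul]
            gcongr
            · exact hP _
            · exact ih _ hx
          · simp
        refine hsum.trans ?_
        rw [Finset.Nat.sum_antidiagonal_eq_sum_range_succ_mk, ← Finset.sum_range_reflect,
          Finset.sum_range_succ]
        have e1 : ∀ j ∈ Finset.range n,
            (if n - (n + 1 - 1 - j) < n then
              C * r ^ (n + 1 - 1 - j) * (d * s ^ (n - (n + 1 - 1 - j))) else 0) =
            C * d * r * (s ^ j * r ^ (n - 1 - j)) := by
          intro j hj
          have hj' := Finset.mem_range.1 hj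
          have a1 : n - (n + 1 - 1 - j) = j := by omega
          have a2 : n + 1 - 1 - j = n - 1 - j + 1 := by omega
          rw [a1, if_pos hj', a2, pow_succ]
          ring
        have e2 : ¬ (n - (n + 1 - 1 - n) < n) := by omega
        simp only [Nat.succ_eq_add_one]
        rw [Finset.sum_congr rfl e1, if_neg e2, add_zero, ← Finset.mul_sum]
        have g := Commute.geom_sum₂_mul (Commute.all s r) n
        have : C * d * r = s - r := by rw [hs]; ring
        rw [this, mul_comm, g]
        have : 0 < r ^ n := by positivity
        linarith
  have hc : IsConvergent (HahnSeries.ofPowerSeries ℤ ℂ P⁻¹) :=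
    (isConvergent_ofPowerSeries_iff _).2 ⟨d, s, hd0, hs0, key⟩
  have e : f⁻¹ = HahnSeries.single (-f.order) 1 * HahnSeries.ofPowerSeries ℤ ℂ P⁻¹ := by
    refine inv_eq_of_mul_eq_one_right ?_
    have hfP : f = HahnSeries.single f.order 1 * HahnSeries.ofPowerSeries ℤ ℂ P :=
      (LaurentSeries.single_order_mul_powerSeriesPart f).symm
    generalize f.order = k at hfP
    rw [hfP]
    calc _ = (HahnSeries.single k (1 : ℂ) * HahnSeries.single (-k) 1) *
          HahnSeries.ofPowerSeries ℤ ℂ (P * P⁻¹) := by rw [map_mul]; ring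
      _ = 1 := by
        rw [PowerSeries.mul_inv_cancel _ hP0, HahnSeries.single_mul_single]
        simp
  rw [e]
  exact hc.single_mul _

/-- The field `ℂ({z})` of convergent Laurent series, as a subfield of `ℂ((z))`. -/
def convergentLaurent : Subfield (LaurentSeries ℂ) where
  carrier := {f | IsConvergent f}
  mul_mem' := fun hf hg => hf.mul hg
  one_mem' := isConvergent_single 0 1
  add_mem' := fun hf hg => hf.add hg
  zero_mem' := by simpa using isConvergent_single 0 0
  neg_mem' := fun hf => hf.neg
  inv_mem' := fun _ hf => hf.inv

/-- The field `K = ℂ({z})`. -/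
abbrev K : Type := convergentLaurent

/-- The monomial `c z^k` in `K`. -/
def monomial (k : ℤ) (c : ℂ) : K := ⟨HahnSeries.single k c, isConvergent_single k c⟩

/-- The order at `z = 0`; the junk value at `0` is never used. -/
def ord (f : K) : ℤ := (f : LaurentSeries ℂ).order

/-! ### The dilations `z ↦ a z` -/

/-- `f(z) ↦ f(a z)` on formal Laurent series. -/
def dilateFun (a : ℂˣ) (f : LaurentSeries ℂ) : LaurentSeries ℂ where
  coeff k := (a : ℂ) ^ k * f.coeff k
  isPWO_support' := f.isPWO_support.mono fun k hk => by
    simp only [Function.mem_support] at hk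
    exact right_ne_zero_of_mul hk

theorem coeff_dilateFun (a : ℂˣ) (f : LaurentSeries ℂ) (k : ℤ) :
    (dilateFun a f).coeff k = (a : ℂ) ^ k * f.coeff k := rfl

theorem support_dilateFun_subset (a : ℂˣ) (f : LaurentSeries ℂ) :
    (dilateFun a f).support ⊆ f.support := fun k hk => by
  rw [HahnSeries.mem_support, coeff_dilateFun] at hk
  exact right_ne_zero_of_mul hk

theorem support_dilateFun (a : ℂˣ) (f : LaurentSeries ℂ) :
    (dilateFun a f).support = f.support := by
  ext k
  simp [HahnSeries.mem_support, coeff_dilateFun, zpow_ne_zero]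

theorem dilateFun_mul (a : ℂˣ) (f g : LaurentSeries ℂ) :
    dilateFun a (f * g) = dilateFun a f * dilateFun a g := by
  ext k
  rw [coeff_dilateFun, HahnSeries.coeff_mul, HahnSeries.coeff_mul, Finset.mul_sum]
  refine Finset.sum_congr ?_ fun p hp => ?_
  · ext p
    simp [support_dilateFun]
  · have := hp
    simp only [Finset.mem_antidiagonal] at this
    rw [coeff_dilateFun, coeff_dilateFun, ← this.2.2, zpow_add₀ a.ne_zero]
    ring

theorem IsConvergent.dilate {f : LaurentSeries ℂ} (hf : IsConvergent f) (a : ℂˣ) :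
    IsConvergent (dilateFun a f) := by
  rw [isConvergent_iff] at hf ⊢
  obtain ⟨C, r, hC, hr, h⟩ := hf
  refine ⟨C, ‖(a : ℂ)‖ * r, hC, mul_pos (norm_pos_iff.2 a.ne_zero) hr, fun k => ?_⟩
  rw [coeff_dilateFun, norm_mul, norm_zpow, mul_zpow]
  have := h k
  calc _ ≤ ‖(a : ℂ)‖ ^ k * (C * r ^ k) := by gcongr
    _ = _ := by ring

/-- The automorphism `f(z) ↦ f(a z)` of `K`, as a ring homomorphism. -/
def dilate (a : ℂˣ) : K →+* K where
  toFun f := ⟨dilateFun a f, f.2.dilate a⟩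
  map_one' := by
    ext k
    simp only [coeff_dilateFun, OneMemClass.coe_one, HahnSeries.coeff_one]
    split_ifs with h <;> simp [h]
  map_mul' f g := Subtype.ext (dilateFun_mul a f g)
  map_zero' := by
    ext k
    simp [coeff_dilateFun]
  map_add' f g := by
    ext k
    simp [coeff_dilateFun, mul_add]

/-- `q^x = exp (2 π i x τ)`, a nonzero complex number. -/
def qpow (τ : ℂ) (x : ℂ) : ℂˣ :=
  Units.mk0 (Complex.exp (2 * Real.pi * Complex.I * x * τ)) (Complex.exp_ne_zero _)

/-- `φ : K → K`, `φ(z) = q z` with `q = exp (2 π i τ)`. -/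
def φ (τ : ℂ) : K →+* K := dilate (qpow τ 1)

/-! ### The extension `K_n = ℂ({z^{1/n}})` -/

/-- Substitution `z ↦ w ^ n` on formal Laurent series. -/
def substPow (n : ℕ+) : LaurentSeries ℂ →+* LaurentSeries ℂ :=
  HahnSeries.embDomainRingHom (AddMonoidHom.mulLeft (n : ℤ))
    (fun a b h => mul_left_cancel₀ (by exact_mod_cast n.ne_zero) h)
    (fun a b => mul_le_mul_iff_of_pos_left (by exact_mod_cast n.pos))

theorem coeff_substPow_mul (n : ℕ+) (f : LaurentSeries ℂ) (k : ℤ) :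
    (substPow n f).coeff (n * k) = f.coeff k :=
  HahnSeries.embDomain_coeff

theorem coeff_substPow_of_not_dvd (n : ℕ+) (f : LaurentSeries ℂ) (k : ℤ) (h : ¬ (n : ℤ) ∣ k) :
    (substPow n f).coeff k = 0 := by
  refine HahnSeries.embDomain_of_notMem_range ?_
  rintro ⟨j, hj⟩
  exact h ⟨j, hj.symm⟩

theorem IsConvergent.substPow {f : LaurentSeries ℂ} (hf : IsConvergent f) (n : ℕ+) :
    IsConvergent (substPow n f) := by
  rw [isConvergent_iff] at hf ⊢
  obtain ⟨C, r, hC, hr, h⟩ := hf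
  refine ⟨C, r ^ ((n : ℝ)⁻¹), hC, by positivity, fun k => ?_⟩
  by_cases hk : (n : ℤ) ∣ k
  · obtain ⟨j, rfl⟩ := hk
    rw [coeff_substPow_mul, zpow_mul, zpow_natCast, Real.rpow_inv_natCast_pow hr.le n.ne_zero]
    exact h j
  · rw [coeff_substPow_of_not_dvd n f k hk, norm_zero]
    positivity

/-- `K_n = ℂ({w})` with `w = z^{1/n}`; it is regarded as an extension of `K = ℂ({z})`
by `z ↦ w ^ n`. -/
def Kn (_n : ℕ+) : Type := K

instance (n : ℕ+) : Field (Kn n) := inferInstanceAs (Field K)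

/-- The embedding `K → K_n`, `f(z) ↦ f(w ^ n)`. -/
def toKn (n : ℕ+) : K →+* Kn n :=
  RingHom.codRestrict ((substPow n).comp convergentLaurent.subtype) convergentLaurent
    fun f => f.2.substPow n

instance (n : ℕ+) : Algebra K (Kn n) := (toKn n).toAlgebra

/-- The monomial `c z^{k/n} = c w^k` in `K_n`. -/
def monomialKn (n : ℕ+) (k : ℤ) (c : ℂ) : Kn n := monomial k c

/-- The extension of `φ` to `K_n`: `φ(z^{1/n}) = q^{1/n} z^{1/n}`. -/
def φn (τ : ℂ) (n : ℕ+) : Kn n →+* Kn n := dilate (qpow τ ((n : ℂ)⁻¹))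

theorem φn_toKn (τ : ℂ) (n : ℕ+) (f : K) : φn τ n (toKn n f) = toKn n (φ τ f) := by
  refine Subtype.ext (HahnSeries.ext (funext fun k => ?_))
  change (dilateFun (qpow τ ((n : ℂ)⁻¹)) (substPow n f)).coeff k =
    (substPow n (dilateFun (qpow τ 1) f)).coeff k
  rw [coeff_dilateFun]
  by_cases hk : (n : ℤ) ∣ k
  · obtain ⟨j, rfl⟩ := hk
    rw [coeff_substPow_mul, coeff_substPow_mul, coeff_dilateFun, zpow_mul]
    congr 2
    have hn : (n : ℂ) ≠ 0 := by exact_mod_cast n.ne_zero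
    simp only [qpow, Units.val_mk0, zpow_natCast]
    rw [← Complex.exp_nat_mul]
    congr 1
    field_simp
  · rw [coeff_substPow_of_not_dvd n _ k hk, coeff_substPow_of_not_dvd n _ k hk, mul_zero]

/-! ### Difference modules over `K` -/

section Modules

variable {τ : ℂ} {M N : Type*} [AddCommGroup M] [Module K M] [AddCommGroup N] [Module K N]

/-- `(M, Φ)` is a `q`-difference module over `K`: `M` is a finite dimensional vector space and the
`φ`-semilinear map `Φ` is bijective. -/
structure IsDifferenceModule (Φ : M →ₛₗ[φ τ] M) : Prop where
  finite : Module.Finite K M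
  bijective : Function.Bijective Φ

/-- `(M, Φ)` and `(N, Ψ)` are isomorphic. -/
def Iso (Φ : M →ₛₗ[φ τ] M) (Ψ : N →ₛₗ[φ τ] N) : Prop :=
  ∃ e : M ≃ₗ[K] N, ∀ x, e (Φ x) = Ψ (e x)

/-- `V` is a difference submodule: stable under `Φ` and `Φ⁻¹`. -/
def IsDifferenceSubmodule (Φ : M →ₛₗ[φ τ] M) (V : Submodule K M) : Prop :=
  ∀ x, Φ x ∈ V ↔ x ∈ V

/-- `M` is nonzero and not the direct sum of two proper difference submodules. -/
def IsIndecomposable (Φ : M →ₛₗ[φ τ] M) : Prop :=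
  Nontrivial M ∧ ∀ V W : Submodule K M, IsDifferenceSubmodule Φ V → IsDifferenceSubmodule Φ W →
    IsCompl V W → V = ⊤ ∨ W = ⊤

/-- `M ≅ K[Φ, Φ⁻¹] / K[Φ, Φ⁻¹] L` for the operator `L = Φ^d + a_{d-1} Φ^{d-1} + ⋯ + a_0`,
`a_0 ≠ 0`, whose coefficients are those of the given polynomial: there is `e` (the image of `1`)
such that `e, Φ e, …, Φ^{d-1} e` is a basis of `M` and `L e = 0`. -/
def IsPresentedBy (Φ : M →ₛₗ[φ τ] M) (L : Polynomial K) : Prop :=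
  L.Monic ∧ L.coeff 0 ≠ 0 ∧ ∃ e : M,
    LinearIndependent K (fun i : Fin L.natDegree => Φ^[i] e) ∧
    Submodule.span K (Set.range fun i : Fin L.natDegree => Φ^[i] e) = ⊤ ∧
    ∑ i ∈ Finset.range (L.natDegree + 1), L.coeff i • Φ^[i] e = 0

/-- `s` is a slope of the Newton polygon of `L = ∑ a_i Φ^i`, i.e. of the lower convex hull of the
points `(i, v(a_i))`: some line supporting these points from below contains two of them. The sign is
normalized such that `Φ - c z ^ t` has slope `t`, so the line has slope `-s`. -/
def IsSlope (L : Polynomial K) (s : ℚ) : Prop :=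
  ∃ i ∈ L.support, ∃ j ∈ L.support, i < j ∧
    ord (L.coeff i) + s * i = ord (L.coeff j) + s * j ∧
    ∀ k ∈ L.support, ord (L.coeff i) + s * i ≤ ord (L.coeff k) + s * k

/-- `M` is pure: the Newton polygon of an operator `L` with `M ≅ K[Φ, Φ⁻¹] / K[Φ, Φ⁻¹] L` has
exactly one slope. (The Newton polygon does not depend on the choice of `L`.) -/
def IsPure (Φ : M →ₛₗ[φ τ] M) : Prop :=
  ∃ L : Polynomial K, IsPresentedBy Φ L ∧ ∃! s : ℚ, IsSlope L s

end Modules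

/-- The operator of `E(c z^{t/n})`: the space `K_n e` with `Φ e = c z^{t/n} e`, regarded as a vector
space over `K`. -/
def ΦE (τ : ℂ) (t : ℤ) (n : ℕ+) (c : ℂ) : Kn n →ₛₗ[φ τ] Kn n where
  toFun f := φn τ n f * monomialKn n t c
  map_add' f g := by rw [map_add, add_mul]
  map_smul' a f := by
    rw [Algebra.smul_def, Algebra.smul_def, map_mul, mul_assoc]
    congr 1
    exact φn_toKn τ n a

/-- The matrix with ones on the diagonal and on the first superdiagonal. -/
def unipotentMatrix (m : ℕ) : Matrix (Fin m) (Fin m) K :=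
  Matrix.of fun i j => if i = j ∨ (i : ℕ) + 1 = j then 1 else 0

/-- The operator `Y ↦ A φ(Y)` of the unipotent module `U_m = K^m` of length `m`. -/
def ΦU (τ : ℂ) (m : ℕ) : (Fin m → K) →ₛₗ[φ τ] (Fin m → K) where
  toFun Y := (unipotentMatrix m).mulVec fun i => φ τ (Y i)
  map_add' Y Z := by
    rw [← Matrix.mulVec_add]
    congr 1
    funext i
    exact map_add _ _ _
  map_smul' a Y := by
    rw [← Matrix.mulVec_smul]
    congr 1
    funext i
    exact map_mul _ _ _

/-- The operator `Φ ⊗ Φ` of `E(c z^{t/n}) ⊗ U_m`. -/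
def ΦEU (τ : ℂ) (t : ℤ) (n : ℕ+) (c : ℂ) (m : ℕ) :
    (Kn n ⊗[K] (Fin m → K)) →ₛₗ[φ τ] (Kn n ⊗[K] (Fin m → K)) :=
  TensorProduct.map (ΦE τ t n c) (ΦU τ m)

/-- The conditions `(t, n) = 1`, `|q|^{1/n} < |c| ≤ 1` on the data of `E(c z^{t/n})`, where
`q = exp (2 π i τ)`. They imply `c ≠ 0`. -/
def Admissible (τ : ℂ) (t : ℤ) (n : ℕ+) (c : ℂ) : Prop :=
  IsCoprime t (n : ℤ) ∧ ‖(qpow τ 1 : ℂ)‖ ^ ((n : ℝ)⁻¹) < ‖c‖ ∧ ‖c‖ ≤ 1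

end QDiff

end

set_option linter.unusedSectionVars false

noncomputable section

namespace QDiff

/-! ### Coefficients and constants -/

/-! Everything is read off from the `ℂ`-linear operator `T = z^(-t) Φ^n` attached to a slope `t/n`
in lowest terms. It satisfies `T(f x) = f(q^n z) T x`, so multiplication by `z` sends the
generalized eigenspace of `μ` onto that of `q^n μ`. Since `T Φ = q^t Φ T`, the operator `Φ` sends it
onto that of `q^t μ`. As `t` and `n` are coprime, every integer is `t i + n l` for a unique `0 ≤ i <
n` and `l`. Hence the eigenspaces for the whole class `q^ℤ λ` are the translates `z^l Φ^i` of a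
single one.

Two facts drive the classification.

(1) Enough eigenvectors (`eq_top_of_isPresentedBy`). If the only slope is `t/n`, weights on the
cyclic basis `Φ^i e` give a lattice on which `T` is bijective. `T` induces an invertible matrix on
the lattice modulo `z`. A generalized eigenvector of this matrix with eigenvalue `λ ≠ 0` is lifted
to `T`: finitely many orders in `z` are corrected formally, at the cost of a larger exponent of `T -
λ` at resonances. Beyond order `N` the operator `T - λ` is surjective on `z^N` times the lattice,
with convergent solutions, because `|λ/q^(nN)|` is large. The lifts span `M` over `K`.

(2) Independence (`linearIndependent_of_mem_genSum`). Vectors in a sum of generalized eigenspaces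
whose eigenvalues are pairwise inequivalent modulo `(q^n)^ℤ` are independent over `K` as soon as
they are over `ℂ`.

Now fix an eigenvalue `λ` and put `N = T - λ` on its generalized eigenspace. By (2) the nilpotency
index `m` of `N` is bounded through `dim M`. A Jordan chain of maximal length `m` has an `N`-stable
complement. The `K`-span of the translates of the chain and the `K`-span of all the rest are
difference submodules, complementary by (1) and (2). If `M` is indecomposable, the chain therefore
gives the basis `Φ^i N^j v` of `M` (`exists_isJordanGenerator`). In this basis `Φ` depends only on
`(t, n, λ, m)`. The module `E(c z^{t/n}) ⊗ U_m` has such a generator, `1 ⊗ e` with `e` the last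
basis vector, where `λ` is `c^n` times a constant depending only on `τ, t, n`; and `c` can be chosen
to reach every class `q^ℤ λ`.

Conversely, for a module with such a generator the generalized eigenspace of `λ` is `ℂ[N]v ≅
ℂ[N]/(N^m)`, which is local, so the module is indecomposable. Expanding `(T - λ)^m v = 0` in powers
of `Φ^n` gives an operator whose Newton points lie on one line, so it is pure. Finally the slope,
the dimension `n m` and the class of `λ` modulo `q^ℤ` are invariants, and the annulus condition
picks one `c^n` in its class. -/

/-- The coefficient of `z ^ k`. -/
def coef (f : K) (k : ℤ) : ℂ := (f : LaurentSeries ℂ).coeff k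

theorem coef_ext {f g : K} (h : ∀ k, coef f k = coef g k) : f = g :=
  Subtype.ext (HahnSeries.ext (funext h))

@[simp] theorem coef_zero (k : ℤ) : coef 0 k = 0 := rfl

@[simp] theorem coef_add (f g : K) (k : ℤ) : coef (f + g) k = coef f k + coef g k := rfl

@[simp] theorem coef_neg (f : K) (k : ℤ) : coef (-f) k = -coef f k := rfl

@[simp] theorem coef_sub (f g : K) (k : ℤ) : coef (f - g) k = coef f k - coef g k := rfl

/-- The coefficient of `z ^ k`, as an additive map. -/
def coefHom (k : ℤ) : K →+ ℂ where
  toFun f := coef f k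
  map_zero' := rfl
  map_add' _ _ := rfl

theorem coef_sum {ι : Type*} (s : Finset ι) (f : ι → K) (k : ℤ) :
    coef (∑ i ∈ s, f i) k = ∑ i ∈ s, coef (f i) k :=
  map_sum (coefHom k) f s

theorem coef_monomial (j : ℤ) (c : ℂ) (k : ℤ) : coef (monomial j c) k = if k = j then c else 0 := by
  change (HahnSeries.single j c).coeff k = _
  rw [HahnSeries.coeff_single]
  congr

theorem coef_monomial_mul (j : ℤ) (c : ℂ) (f : K) (k : ℤ) :
    coef (monomial j c * f) k = c * coef f (k - j) := by
  change (HahnSeries.single j c * (f : LaurentSeries ℂ)).coeff k = _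
  rw [HahnSeries.coeff_single_mul]
  rfl

@[simp] theorem coef_dilate (a : ℂˣ) (f : K) (k : ℤ) : coef (dilate a f) k = (a : ℂ) ^ k * coef f k :=
  rfl

theorem monomial_mul_monomial (j k : ℤ) (a b : ℂ) :
    monomial j a * monomial k b = monomial (j + k) (a * b) :=
  Subtype.ext HahnSeries.single_mul_single

theorem monomial_zero_one : monomial 0 1 = 1 := rfl

theorem dilate_monomial (a : ℂˣ) (k : ℤ) (c : ℂ) :
    dilate a (monomial k c) = monomial k ((a : ℂ) ^ k * c) := by
  refine coef_ext fun j => ?_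
  rw [coef_dilate, coef_monomial, coef_monomial]
  split_ifs with h <;> simp [h]

theorem monomial_ne_zero (k : ℤ) {c : ℂ} (hc : c ≠ 0) : monomial k c ≠ 0 := by
  intro h
  have := congrArg (coef · k) h
  simp [coef_monomial, hc] at this

/-- The inclusion of the constants. -/
def constHom : ℂ →+* K where
  toFun c := monomial 0 c
  map_one' := rfl
  map_mul' a b := by rw [monomial_mul_monomial, add_zero]
  map_zero' := coef_ext fun k => by rw [coef_monomial]; simp
  map_add' a b := coef_ext fun k => by
    rw [coef_add, coef_monomial, coef_monomial, coef_monomial]; split_ifs <;> simp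

instance : Algebra ℂ K := constHom.toAlgebra

theorem algebraMap_eq (c : ℂ) : algebraMap ℂ K c = monomial 0 c := rfl

@[simp] theorem coef_smul (c : ℂ) (f : K) (k : ℤ) : coef (c • f) k = c * coef f k := by
  rw [Algebra.smul_def, algebraMap_eq, coef_monomial_mul, sub_zero]

theorem smul_monomial (a : ℂ) (k : ℤ) (b : ℂ) : a • monomial k b = monomial k (a * b) := by
  rw [Algebra.smul_def, algebraMap_eq, monomial_mul_monomial, zero_add]

theorem dilate_smul (a : ℂˣ) (c : ℂ) (f : K) : dilate a (c • f) = c • dilate a f := by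
  refine coef_ext fun k => ?_
  simp only [coef_dilate, coef_smul]
  ring

theorem dilate_algebraMap (a : ℂˣ) (c : ℂ) : dilate a (algebraMap ℂ K c) = algebraMap ℂ K c := by
  rw [algebraMap_eq, dilate_monomial, zpow_zero, one_mul]

theorem dilate_dilate (a b : ℂˣ) (f : K) : dilate a (dilate b f) = dilate (a * b) f := by
  refine coef_ext fun k => ?_
  simp only [coef_dilate, Units.val_mul, mul_zpow]
  ring

theorem dilate_one (f : K) : dilate 1 f = f := by
  refine coef_ext fun k => ?_
  simp

theorem dilate_inv_dilate (a : ℂˣ) (f : K) : dilate a (dilate a⁻¹ f) = f := by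
  rw [dilate_dilate, mul_inv_cancel, dilate_one]

theorem algebraMap_of_coef {f : K} (h : ∀ k ≠ 0, coef f k = 0) : f = algebraMap ℂ K (coef f 0) := by
  refine coef_ext fun k => ?_
  rw [algebraMap_eq, coef_monomial]
  split_ifs with hk
  · rw [hk]
  · exact h k hk

/-! ### Linear algebra -/

/-- Applying `N^(m-1-j)` to a relation kills the terms beyond `j`, and the terms before `j` vanish
by induction; what remains is the `j`-th coefficient times `N^(m-1) v`. -/
theorem linearIndependent_nilpotent_chain {k V : Type*} [Field k] [AddCommGroup V] [Module k V]
    (N : Module.End k V) (v : V) (m : ℕ) (h0 : (N ^ m) v = 0) (h1 : (N ^ (m - 1)) v ≠ 0) :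
    LinearIndependent k fun j : Fin m => (N ^ (j : ℕ)) v := by
  have hz : ∀ j, m ≤ j → (N ^ j) v = 0 := fun j hj => by
    obtain ⟨i, rfl⟩ := Nat.exists_eq_add_of_le hj
    rw [add_comm, pow_add, Module.End.mul_apply, h0, map_zero]
  rw [Fintype.linearIndependent_iff]
  intro g hg
  have key : ∀ j : ℕ, ∀ hj : j < m, g ⟨j, hj⟩ = 0 := by
    intro j
    induction j using Nat.strong_induction_on with
    | _ j ih =>
      intro hj
      have h := congrArg (N ^ (m - 1 - j)) hg
      rw [map_sum, map_zero, Finset.sum_eq_single ⟨j, hj⟩] at h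
      · rw [map_smul, ← Module.End.mul_apply, ← pow_add, show m - 1 - j + j = m - 1 by omega] at h
        exact (smul_eq_zero.1 h).resolve_right h1
      · intro i _ hi
        rw [map_smul, ← Module.End.mul_apply, ← pow_add]
        rcases lt_trichotomy (i : ℕ) j with h | h | h
        · rw [show g i = 0 from ih i h i.2, zero_smul]
        · exact absurd (Fin.ext h) hi
        · rw [hz _ (by omega), smul_zero]
      · intro h; exact absurd (Finset.mem_univ _) h
  exact fun i => key i i.2

/-- A stable subspace of a finite dimensional space is also stable under the inverse of a
surjective semilinear map. -/
theorem comap_eq_of_stable {k V : Type*} [Field k] [AddCommGroup V] [Module k V]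
    [Module.Finite k V] {σ : k →+* k} (Φ : V →ₛₗ[σ] V) (hΦ : Function.Surjective Φ)
    (W : Submodule k V) (hW : ∀ x ∈ W, Φ x ∈ W) (x : V) : Φ x ∈ W ↔ x ∈ W := by
  refine ⟨fun hx => ?_, hW x⟩
  -- The preimages of `W` under the iterates of `Φ` increase, hence stabilize at some `n`. With `x =
  -- Φ^n y`, the condition `Φ x ∈ W` reads `y ∈ F (n + 1) = F n`, that is `x ∈ W`.
  let F : ℕ → Submodule k V := fun i => (Submodule.comap Φ)^[i] W
  have hF : ∀ i y, y ∈ F i ↔ Φ^[i] y ∈ W := by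
    intro i
    induction i with
    | zero => intro y; rfl
    | succ i ih =>
      intro y
      change y ∈ (Submodule.comap Φ)^[i + 1] W ↔ _
      rw [Function.iterate_succ_apply', Submodule.mem_comap, Function.iterate_succ_apply]
      exact ih (Φ y)
  have hmono : Monotone F := monotone_nat_of_le_succ fun i y hy => by
    rw [hF] at hy ⊢
    rw [Function.iterate_succ_apply']
    exact hW _ hy
  obtain ⟨n, hn⟩ := monotone_stabilizes_iff_noetherian.2 (inferInstance : IsNoetherian k V)
    ⟨F, hmono⟩
  obtain ⟨y, rfl⟩ := hΦ.iterate n x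
  have h : y ∈ F (n + 1) := by
    rw [hF, Function.iterate_succ_apply']
    exact hx
  rw [← hF]
  have := hn (n + 1) (by omega)
  change F n = F (n + 1) at this
  rwa [this]

theorem disjoint_iSup_of_iSupIndep {k V ι : Type*} [Field k] [AddCommGroup V] [Module k V]
    {G A B : ι → Submodule k V} (hG : iSupIndep G) (hA : ∀ i, A i ≤ G i) (hB : ∀ i, B i ≤ G i)
    (hAB : ∀ i, Disjoint (A i) (B i)) : Disjoint (⨆ i, A i) (⨆ i, B i) := by
  classical
  rw [Submodule.disjoint_def]
  intro x hxA hxB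
  obtain ⟨f, hf, rfl⟩ := (Submodule.mem_iSup_iff_exists_finsupp _ _).1 hxA
  obtain ⟨g, hg, hfg⟩ := (Submodule.mem_iSup_iff_exists_finsupp _ _).1 hxB
  have h0 : f = g := by
    have h1 : (f - g).sum (fun _ x => x) = 0 := by
      rw [Finsupp.sum_sub_index (fun _ _ _ => rfl), hfg, sub_self]
    ext i
    by_contra hi
    have hi' : i ∈ (f - g).support := by
      rw [Finsupp.mem_support_iff]
      exact sub_ne_zero.2 hi
    exact sub_ne_zero.2 hi ((iSupIndep_iff_finsetSum_eq_zero_imp_eq_zero _).1 hG (f - g).support (f - g)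
      (fun j _ => (G j).sub_mem (hA j (hf j)) (hB j (hg j))) h1 i hi')
  refine Finset.sum_eq_zero fun i _ => ?_
  exact Submodule.disjoint_def.1 (hAB i) _ (hf i) (by rw [h0]; exact hg i)

/-! ### Linear independence over the constants and over `K` -/

section GenSum

variable {M : Type*} [AddCommGroup M] [Module ℂ M] {T : Module.End ℂ M}

/-- The sum of the generalized eigenspaces of `T` for the eigenvalues in `S`. -/
def genSum (T : Module.End ℂ M) (S : Set ℂ) : Submodule ℂ M := ⨆ μ : S, T.maxGenEigenspace μ

theorem maxGenEigenspace_le_genSum (T : Module.End ℂ M) {S : Set ℂ} {μ : ℂ} (hμ : μ ∈ S) :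
    T.maxGenEigenspace μ ≤ genSum T S :=
  le_iSup (fun μ : S => T.maxGenEigenspace μ) ⟨μ, hμ⟩

/-- `T` is locally finite on `genSum T S`: a generalized eigenvector spans a stable space together
with its images under powers of `T - μ`. This reduces independence questions to finite dimensional
`U`. -/
theorem exists_finite_stable (T : Module.End ℂ M) (S : Set ℂ) {x : M} (hx : x ∈ genSum T S) :
    ∃ U ≤ genSum T S, Module.Finite ℂ U ∧ (∀ y ∈ U, T y ∈ U) ∧ x ∈ U := by
  unfold genSum at hx
  induction hx using Submodule.iSup_induction' with
  | mem μ x hx =>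
    obtain ⟨k, hk⟩ := (Module.End.mem_maxGenEigenspace _ _ _).1 hx
    set N : Module.End ℂ M := T - (μ : ℂ) • 1 with hN
    have hTN : ∀ y, T y = N y + (μ : ℂ) • y := fun y => by
      rw [hN, LinearMap.sub_apply, LinearMap.smul_apply, Module.End.one_apply, sub_add_cancel]
    refine ⟨Submodule.span ℂ (Set.range fun j : Fin (k + 1) => (N ^ (j : ℕ)) x), ?_,
      Module.Finite.span_of_finite ℂ (Set.finite_range _), ?_, Submodule.subset_span ⟨0, rfl⟩⟩
    · rw [Submodule.span_le]
      rintro _ ⟨j, rfl⟩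
      refine maxGenEigenspace_le_genSum T μ.2 ((Module.End.mem_maxGenEigenspace _ _ _).2 ⟨k, ?_⟩)
      rw [← hN, ← Module.End.mul_apply, ← pow_add, add_comm, pow_add, Module.End.mul_apply, hk,
        map_zero]
    · intro y hy
      rw [hTN]
      refine Submodule.add_mem _ ?_ (Submodule.smul_mem _ _ hy)
      refine Submodule.span_induction (p := fun y _ => N y ∈ _) ?_ ?_ ?_ ?_ hy
      · rintro _ ⟨j, rfl⟩
        change N ((N ^ (j : ℕ)) x) ∈ _
        rw [← Module.End.mul_apply, ← pow_succ']
        rcases lt_or_ge ((j : ℕ) + 1) (k + 1) with h | h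
        · exact Submodule.subset_span ⟨⟨j + 1, h⟩, rfl⟩
        · rw [show (j : ℕ) + 1 = k + 1 by omega, pow_succ', Module.End.mul_apply, hk, map_zero]
          exact Submodule.zero_mem _
      · rw [map_zero]; exact Submodule.zero_mem _
      · intro a b _ _ ha hb
        rw [map_add]
        exact Submodule.add_mem _ ha hb
      · intro c a _ ha
        rw [map_smul]
        exact Submodule.smul_mem _ _ ha
  | zero =>
    exact ⟨⊥, bot_le, inferInstance, fun y hy => by
      rw [(Submodule.mem_bot ℂ).1 hy, map_zero]
      exact Submodule.zero_mem _, Submodule.zero_mem _⟩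
  | add x y _ _ hx hy =>
    obtain ⟨U, hU, hUf, hTU, hxU⟩ := hx
    obtain ⟨W, hW, hWf, hTW, hyW⟩ := hy
    refine ⟨U ⊔ W, sup_le hU hW, inferInstance, ?_, Submodule.add_mem_sup hxU hyW⟩
    intro y hy
    obtain ⟨a, ha, b, hb, rfl⟩ := Submodule.mem_sup.1 hy
    rw [map_add]
    exact Submodule.add_mem_sup (hTU a ha) (hTW b hb)

theorem mem_of_eigenvector_mem_genSum {S : Set ℂ} {μ : ℂ} {u : M} (hu : u ∈ genSum T S) (h0 : u ≠ 0)
    (h : T u = μ • u) : μ ∈ S := by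
  by_contra hμ
  refine h0 (Submodule.disjoint_def.1 (T.independent_maxGenEigenspace μ) u ?_ ?_)
  · refine (Module.End.mem_maxGenEigenspace _ _ _).2 ⟨1, ?_⟩
    simp [h]
  · refine (iSup_le fun ν => ?_ : genSum T S ≤ _) hu
    exact le_iSup₂ (f := fun ν (_ : ν ≠ μ) => T.maxGenEigenspace ν) (ν : ℂ)
      fun h => hμ (h ▸ ν.2)

end GenSum

section Independence

variable {M : Type*} [AddCommGroup M] [Module K M] [Module ℂ M] [IsScalarTower ℂ K M]
  {p : ℂˣ} {T : Module.End ℂ M}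

/-- The key step: a constant basis of a stable space `U` which is independent over `K` stays
independent after adding a vector which is an eigenvector modulo `U`. -/
theorem notMem_span_of_eigenvector_modulo (hT : ∀ (f : K) x, T (f • x) = dilate p f • T x)
    {r : ℕ} {b : Fin r → M} (hb : LinearIndependent K b) {v : M} {μ : ℂ}
    (hTb : ∀ i, T (b i) ∈ Submodule.span ℂ (Set.range b))
    (hv : T v - μ • v ∈ Submodule.span ℂ (Set.range b))
    (hvb : v ∉ Submodule.span ℂ (Set.range b))
    (H : ∀ (k : ℤ), ∀ u ∈ Submodule.span ℂ (Set.range b), u ≠ 0 →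
      T u = ((p : ℂ) ^ k * μ) • u → k = 0) :
    v ∉ Submodule.span K (Set.range b) := by
  intro hvK
  obtain ⟨f, rfl⟩ := (Submodule.mem_span_range_iff_exists_fun K).1 hvK
  choose A hA using fun i => (Submodule.mem_span_range_iff_exists_fun ℂ).1 (hTb i)
  obtain ⟨a, ha⟩ := (Submodule.mem_span_range_iff_exists_fun ℂ).1 hv
  -- In the basis `b`, on which `T` has a constant matrix, the hypothesis on `T v - μ v` becomes a
  -- difference equation for the coordinates `f` of `v` with constant right-hand side.
  have e1 : ∑ i, ((∑ j, A j i • dilate p (f j)) - μ • f i - algebraMap ℂ K (a i)) • b i = 0 := by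
    simp only [sub_smul, Finset.sum_sub_distrib, algebraMap_smul]
    rw [ha, map_sum]
    have : ∑ i, (∑ j, A j i • dilate p (f j)) • b i = ∑ i, T (f i • b i) := by
      simp only [hT, ← hA, Finset.sum_smul, Finset.smul_sum]
      rw [Finset.sum_comm]
      refine Finset.sum_congr rfl fun i _ => Finset.sum_congr rfl fun j _ => ?_
      rw [smul_assoc, smul_comm]
    rw [this]
    simp only [smul_assoc, Finset.smul_sum]
    abel
  have e2 := Fintype.linearIndependent_iff.1 hb _ e1
  -- The coefficients of `z^k`, `k ≠ 0`, form an eigenvector in the constant span with eigenvalue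
  -- `p^(-k) μ`, so `H` forces them to vanish. Then `f` is constant and `v` lies in the `ℂ`-span, a
  -- contradiction.
  have e3 : ∀ k : ℤ, k ≠ 0 → ∀ i, coef (f i) k = 0 := by
    intro k hk
    have hu : (∑ j, coef (f j) k • b j) = 0 := by
      by_contra hne
      refine hk (neg_eq_zero.1 (H (-k) (∑ j, coef (f j) k • b j) ?_ hne ?_))
      · exact Submodule.sum_mem _ fun j _ => Submodule.smul_mem _ _ (Submodule.subset_span ⟨j, rfl⟩)
      · rw [map_sum]
        simp only [map_smul, ← hA, Finset.smul_sum]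
        rw [Finset.sum_comm]
        refine Finset.sum_congr rfl fun i _ => ?_
        simp only [smul_smul]
        rw [← Finset.sum_smul]
        congr 1
        have h := congrArg (coef · k) (e2 i)
        simp only [coef_sub, coef_sum, coef_smul, coef_dilate, algebraMap_eq, coef_monomial,
          if_neg hk, coef_zero, sub_zero] at h
        have h' : ∑ j, A j i * ((p : ℂ) ^ k * coef (f j) k) = μ * coef (f i) k := sub_eq_zero.1 h
        have hpk : (p : ℂ) ^ k ≠ 0 := zpow_ne_zero _ p.ne_zero
        rw [mul_assoc, ← h', Finset.mul_sum, zpow_neg]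
        refine Finset.sum_congr rfl fun j _ => ?_
        field_simp
    have hbC : LinearIndependent ℂ b := hb.restrict_scalars' ℂ
    exact Fintype.linearIndependent_iff.1 hbC _ hu
  refine hvb (Submodule.sum_mem _ fun i _ => ?_)
  rw [algebraMap_of_coef fun k hk => e3 k hk i, algebraMap_smul]
  exact Submodule.smul_mem _ _ (Submodule.subset_span ⟨i, rfl⟩)

/-- Induction on the dimension of `U`: a hyperplane is split off so that the remaining vector is an
eigenvector modulo it, and `notMem_span_of_eigenvector_modulo` applies. -/
theorem exists_linearIndependent_of_stable (hT : ∀ (f : K) x, T (f • x) = dilate p f • T x)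
    (r : ℕ) : ∀ (U : Submodule ℂ M) [Module.Finite ℂ U], Module.finrank ℂ U = r →
    (∀ x ∈ U, T x ∈ U) →
    (∀ (μ : ℂ) (k : ℤ), ∀ u ∈ U, ∀ u' ∈ U, u ≠ 0 → u' ≠ 0 → T u = μ • u →
      T u' = ((p : ℂ) ^ k * μ) • u' → k = 0) →
    ∃ b : Fin r → M, Submodule.span ℂ (Set.range b) = U ∧ LinearIndependent K b := by
  induction r with
  | zero =>
    intro U _ hr _ _
    refine ⟨Fin.elim0, ?_, linearIndependent_empty_type⟩
    rw [Set.range_eq_empty, Submodule.span_empty, Submodule.finrank_eq_zero.1 hr]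
  | succ r ih =>
    intro U _ hr hTU H
    have hnt : Nontrivial U := Module.nontrivial_of_finrank_pos (R := ℂ) (by omega)
    let TU : Module.End ℂ U := T.restrict hTU
    obtain ⟨μ, hμ⟩ := Module.End.exists_eigenvalue TU
    obtain ⟨u₀, hu₀⟩ := hμ.exists_hasEigenvector
    -- A hyperplane containing the range of `T - μ` is `T`-stable, and `T` acts as `μ` on the
    -- quotient line.
    have hlt : LinearMap.range (TU - algebraMap ℂ _ μ) < ⊤ := by
      rw [lt_top_iff_ne_top, Ne, LinearMap.range_eq_top, ← LinearMap.injective_iff_surjective]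
      intro hinj
      refine hu₀.2 (hinj ?_)
      rw [map_zero, LinearMap.sub_apply, hu₀.apply_eq_smul, Module.algebraMap_end_apply, sub_self]
    obtain ⟨U', hU', hle⟩ := (eq_top_or_exists_le_coatom _).resolve_left hlt.ne
    have hfr : Module.finrank ℂ U' = r := by
      have := Submodule.finrank_quotient_add_finrank U'
      have h1 : Module.finrank ℂ (U ⧸ U') = 1 := by
        have hs : IsSimpleModule ℂ (U ⧸ U') := isSimpleModule_iff_isCoatom.2 hU'
        exact isSimpleModule_iff_finrank_eq_one.1 hs
      omega
    let U₁ : Submodule ℂ M := U'.map U.subtype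
    have hU₁ : ∀ x ∈ U₁, x ∈ U := by
      rintro _ ⟨x, _, rfl⟩
      exact x.2
    have hmod : ∀ x ∈ U, T x - μ • x ∈ U₁ := fun x hx =>
      ⟨(TU - algebraMap ℂ _ μ) ⟨x, hx⟩, hle ⟨_, rfl⟩, rfl⟩
    have hfr₁ : Module.finrank ℂ U₁ = r := by
      rw [← hfr]
      exact LinearEquiv.finrank_eq (Submodule.equivMapOfInjective _ U.injective_subtype U').symm
    have hTU₁ : ∀ x ∈ U₁, T x ∈ U₁ := fun x hx => by
      have := U₁.add_mem (hmod x (hU₁ x hx)) (U₁.smul_mem μ hx)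
      rwa [sub_add_cancel] at this
    obtain ⟨b, hbU, hb⟩ := ih U₁ hfr₁ hTU₁
      fun μ k u hu u' hu' => H μ k u (hU₁ u hu) u' (hU₁ u' hu')
    obtain ⟨v, -, hv⟩ := SetLike.exists_of_lt hU'.lt_top
    have hvU₁ : (v : M) ∉ U₁ := by
      rintro ⟨w, hw, hwv⟩
      exact hv (by rwa [← Subtype.ext hwv])
    have hvK : (v : M) ∉ Submodule.span K (Set.range b) := by
      refine notMem_span_of_eigenvector_modulo (μ := μ) hT hb ?_ ?_ ?_ ?_
      · intro i
        rw [hbU]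
        exact hTU₁ _ (hbU ▸ Submodule.subset_span ⟨i, rfl⟩)
      · rw [hbU]
        exact hmod _ v.2
      · rwa [hbU]
      · rw [hbU]
        intro k u hu hu0 hTu
        refine H μ k u₀ u₀.2 u (hU₁ u hu) (by simpa using hu₀.2) hu0 ?_ hTu
        exact congrArg Subtype.val hu₀.apply_eq_smul
    have hli : LinearIndependent K (Fin.cons (v : M) b : Fin (r + 1) → M) :=
      linearIndependent_finCons.2 ⟨hb, hvK⟩
    refine ⟨Fin.cons (v : M) b, ?_, hli⟩
    have hli' : LinearIndependent ℂ (Fin.cons (v : M) b : Fin (r + 1) → M) :=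
      hli.restrict_scalars' ℂ
    refine Submodule.eq_of_le_of_finrank_eq ?_ ?_
    · rw [Submodule.span_le]
      rintro _ ⟨i, rfl⟩
      refine Fin.cases ?_ (fun i => ?_) i
      · exact v.2
      · exact hU₁ _ (hbU ▸ Submodule.subset_span ⟨i, rfl⟩)
    · rw [finrank_span_eq_card hli', hr, Fintype.card_fin]

/-- One `K`-independent basis of `U` suffices: `w` extends to a `ℂ`-basis of `U`, whose `K`-span
contains that basis and so has rank at least `dim U`. -/
theorem linearIndependent_of_stable (hT : ∀ (f : K) x, T (f • x) = dilate p f • T x)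
    (U : Submodule ℂ M) [Module.Finite ℂ U] (hTU : ∀ x ∈ U, T x ∈ U)
    (H : ∀ (μ : ℂ) (k : ℤ), ∀ u ∈ U, ∀ u' ∈ U, u ≠ 0 → u' ≠ 0 → T u = μ • u →
      T u' = ((p : ℂ) ^ k * μ) • u' → k = 0)
    {ι : Type*} {w : ι → M} (hw : LinearIndependent ℂ w) (hwU : ∀ i, w i ∈ U) :
    LinearIndependent K w := by
  obtain ⟨b, hbU, hb⟩ := exists_linearIndependent_of_stable hT _ U rfl hTU H
  let w' : ι → U := fun i => ⟨w i, hwU i⟩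
  have hw' : LinearIndependent ℂ w' := LinearIndependent.of_comp U.subtype hw
  let B := Module.Basis.extend hw'.linearIndepOn_id
  have hBfin : Finite (hw'.linearIndepOn_id.extend (Set.subset_univ (Set.range w'))) :=
    Module.Finite.finite_basis B
  have := Fintype.ofFinite (hw'.linearIndepOn_id.extend (Set.subset_univ (Set.range w')))
  have hspan : Submodule.span K (Set.range b) ≤ Submodule.span K (Set.range fun i => (B i : M)) := by
    rw [Submodule.span_le]
    rintro _ ⟨i, rfl⟩
    have hbi : b i ∈ U := hbU ▸ Submodule.subset_span ⟨i, rfl⟩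
    have h := congrArg Subtype.val (B.sum_repr ⟨b i, hbi⟩)
    simp only [AddSubmonoidClass.coe_finsetSum, Submodule.coe_smul] at h
    rw [← h]
    refine Submodule.sum_mem _ fun j _ => ?_
    rw [← algebraMap_smul K]
    exact Submodule.smul_mem _ _ (Submodule.subset_span ⟨j, rfl⟩)
  have hBli : LinearIndependent K fun i => (B i : M) := by
    refine linearIndependent_iff_card_le_finrank_span.2 ?_
    rw [← Module.finrank_eq_card_basis B]
    have h1 := finrank_span_eq_card hb
    rw [Fintype.card_fin] at h1
    rw [← h1]
    have : Module.Finite K (Submodule.span K (Set.range fun i => (B i : M))) :=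
      Module.Finite.span_of_finite K (Set.finite_range _)
    exact Submodule.finrank_mono hspan
  have hmem : ∀ i, w' i ∈ hw'.linearIndepOn_id.extend (Set.subset_univ (Set.range w')) := fun i =>
    hw'.linearIndepOn_id.subset_extend _ ⟨i, rfl⟩
  have := hBli.comp (fun i => ⟨w' i, hmem i⟩) fun i j hij =>
    hw'.injective (congrArg Subtype.val hij)
  convert this using 1
  funext i
  simp [B, w']

theorem linearIndependent_of_mem_genSum (hT : ∀ (f : K) x, T (f • x) = dilate p f • T x)
    {S : Set ℂ} (hS : ∀ (μ : ℂ) (k : ℤ), μ ∈ S → (p : ℂ) ^ k * μ ∈ S → k = 0)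
    {ι : Type*} {w : ι → M} (hw : LinearIndependent ℂ w) (hwS : ∀ i, w i ∈ genSum T S) :
    LinearIndependent K w := by
  rw [linearIndependent_iff_finset_linearIndependent]
  intro s
  choose U hU hUf hTU hwU using fun i => exists_finite_stable T S (hwS i)
  have hfin : Module.Finite ℂ (⨆ i : s, U i : Submodule ℂ M) := inferInstance
  have hle : (⨆ i : s, U i : Submodule ℂ M) ≤ genSum T S := iSup_le fun i => hU i
  refine linearIndependent_of_stable hT (⨆ i : s, U i) ?_ ?_ (hw.comp _ Subtype.val_injective) ?_
  · intro x hx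
    have : (⨆ i : s, U i : Submodule ℂ M) ≤ (⨆ i : s, U i).comap T :=
      iSup_le fun i y hy => (le_iSup (fun i : s => U i) i) (hTU i y hy)
    exact this hx
  · intro μ k u hu u' hu' h0 h0' h h'
    exact hS μ k (mem_of_eigenvector_mem_genSum (hle hu) h0 h)
      (mem_of_eigenvector_mem_genSum (hle hu') h0' h')
  · intro i
    exact le_iSup (fun i : s => U i) i (hwU i)

/-- The union of `ℂ`-bases of the two spaces is independent over `ℂ`, hence over `K`. -/
theorem disjoint_span_of_disjoint (hT : ∀ (f : K) x, T (f • x) = dilate p f • T x)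
    {S : Set ℂ} (hS : ∀ (μ : ℂ) (k : ℤ), μ ∈ S → (p : ℂ) ^ k * μ ∈ S → k = 0)
    {U₁ U₂ : Submodule ℂ M} (h₁ : U₁ ≤ genSum T S) (h₂ : U₂ ≤ genSum T S) (h : Disjoint U₁ U₂) :
    Disjoint (Submodule.span K (U₁ : Set M)) (Submodule.span K (U₂ : Set M)) := by
  obtain ⟨s₁, -, hs₁, hli₁⟩ := exists_linearIndependent ℂ (U₁ : Set M)
  obtain ⟨s₂, -, hs₂, hli₂⟩ := exists_linearIndependent ℂ (U₂ : Set M)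
  rw [Submodule.span_eq] at hs₁ hs₂
  have hli : LinearIndependent ℂ (Sum.elim ((↑) : s₁ → M) ((↑) : s₂ → M)) := by
    refine hli₁.sum_type hli₂ ?_
    rwa [Subtype.range_coe, Subtype.range_coe, hs₁, hs₂]
  have hliK : LinearIndependent K (Sum.elim ((↑) : s₁ → M) ((↑) : s₂ → M)) := by
    refine linearIndependent_of_mem_genSum hT hS hli ?_
    rintro (i | i)
    · exact h₁ (hs₁ ▸ Submodule.subset_span i.2)
    · exact h₂ (hs₂ ▸ Submodule.subset_span i.2)
  have hd := (linearIndependent_sum.1 hliK).2.2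
  rw [Sum.elim_comp_inl, Sum.elim_comp_inr, Subtype.range_coe, Subtype.range_coe] at hd
  have hle : ∀ (U : Submodule ℂ M) (s : Set M), Submodule.span ℂ s = U →
      Submodule.span K (U : Set M) ≤ Submodule.span K s := by
    rintro U s rfl
    rw [Submodule.span_le]
    exact Submodule.span_subset_span ℂ K _
  exact hd.mono (hle _ _ hs₁) (hle _ _ hs₂)

end Independence

/-! ### Products of series -/

theorem exists_powerSeries {f : K} {a : ℤ} (hf : ∀ k < a, coef f k = 0) :
    ∃ P : PowerSeries ℂ, (∀ l : ℕ, PowerSeries.coeff l P = coef f (a + l)) ∧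
      (f : LaurentSeries ℂ) = HahnSeries.single a 1 * HahnSeries.ofPowerSeries ℤ ℂ P := by
  refine ⟨PowerSeries.mk fun l => coef f (a + l), fun l => PowerSeries.coeff_mk _ _, ?_⟩
  ext k
  rw [HahnSeries.coeff_single_mul, one_mul, PowerSeries.coeff_coe]
  split_ifs with h
  · exact hf k (by omega)
  · rw [PowerSeries.coeff_mk]
    change coef f k = _
    congr 1
    omega

theorem coef_mul_of_lt {f g : K} {a b : ℤ} (hf : ∀ k < a, coef f k = 0)
    (hg : ∀ k < b, coef g k = 0) (k : ℤ) (hk : k < a + b) : coef (f * g) k = 0 := by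
  obtain ⟨P, -, hP⟩ := exists_powerSeries hf
  obtain ⟨Q, -, hQ⟩ := exists_powerSeries hg
  have e : ((f * g : K) : LaurentSeries ℂ) = HahnSeries.single (a + b) 1 *
      HahnSeries.ofPowerSeries ℤ ℂ (P * Q) := by
    rw [Subfield.coe_mul, hP, hQ, map_mul, ← one_mul (1 : ℂ), ← HahnSeries.single_mul_single,
      one_mul]
    ring
  change ((f * g : K) : LaurentSeries ℂ).coeff k = 0
  rw [e, HahnSeries.coeff_single_mul, PowerSeries.coeff_coe, if_pos (by omega), mul_zero]

theorem coef_mul {f g : K} {a b : ℤ} (hf : ∀ k < a, coef f k = 0)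
    (hg : ∀ k < b, coef g k = 0) (k : ℕ) :
    coef (f * g) (a + b + k) =
      ∑ l ∈ Finset.range (k + 1), coef f (a + ((k - l : ℕ) : ℤ)) * coef g (b + l) := by
  obtain ⟨P, hPf, hP⟩ := exists_powerSeries hf
  obtain ⟨Q, hQg, hQ⟩ := exists_powerSeries hg
  have e : ((f * g : K) : LaurentSeries ℂ) = HahnSeries.single (a + b) 1 *
      HahnSeries.ofPowerSeries ℤ ℂ (P * Q) := by
    rw [Subfield.coe_mul, hP, hQ, map_mul, ← one_mul (1 : ℂ), ← HahnSeries.single_mul_single,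
      one_mul]
    ring
  change ((f * g : K) : LaurentSeries ℂ).coeff (a + b + k) = _
  rw [e, HahnSeries.coeff_single_mul, one_mul, add_sub_cancel_left,
    LaurentSeries.coeff_coe_powerSeries, mul_comm P Q, PowerSeries.coeff_mul,
    Finset.Nat.sum_antidiagonal_eq_sum_range_succ_mk]
  refine Finset.sum_congr rfl fun l _ => ?_
  rw [hPf, hQg, mul_comm]

/-- A common geometric bound for finitely many series, such as all entries of a matrix. -/
theorem exists_bound {ι : Type*} [Finite ι] (F : ι → K) :
    ∃ C r : ℝ, 0 ≤ C ∧ 0 < r ∧ ∀ i, ∀ k : ℕ, ‖coef (F i) k‖ ≤ C * r ^ k := by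
  have := Fintype.ofFinite ι
  choose C r hC hr h using fun i => (isConvergent_iff (F i : LaurentSeries ℂ)).1 (F i).2
  refine ⟨∑ i, C i, 1 + ∑ i, r i, Finset.sum_nonneg fun i _ => hC i, ?_, fun i k => ?_⟩
  · have : 0 ≤ ∑ i, r i := Finset.sum_nonneg fun i _ => (hr i).le
    linarith
  · refine (h i k).trans ?_
    rw [zpow_natCast]
    have h1 := Finset.single_le_sum (f := C) (fun i _ => hC i) (Finset.mem_univ i)
    have h2 := Finset.single_le_sum (f := r) (fun i _ => (hr i).le) (Finset.mem_univ i)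
    have := (hr i).le
    have := hC i
    gcongr
    · linarith
    · linarith

theorem exists_of_bound {y : ℕ → ℂ} {C r : ℝ} (hr : 0 < r) (h : ∀ k, ‖y k‖ ≤ C * r ^ k) :
    ∃ f : K, (∀ k < 0, coef f k = 0) ∧ ∀ k : ℕ, coef f k = y k := by
  have hC : 0 ≤ C := by simpa using (norm_nonneg _).trans (h 0)
  refine ⟨⟨HahnSeries.ofPowerSeries ℤ ℂ (PowerSeries.mk y),
    (isConvergent_ofPowerSeries_iff _).2 ⟨C, r, hC, hr, fun n => ?_⟩⟩, fun k hk => ?_, fun k => ?_⟩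
  · rw [PowerSeries.coeff_mk]
    exact h n
  · change (HahnSeries.ofPowerSeries ℤ ℂ (PowerSeries.mk y)).coeff k = 0
    rw [PowerSeries.coeff_coe, if_pos hk]
  · change (HahnSeries.ofPowerSeries ℤ ℂ (PowerSeries.mk y)).coeff k = _
    rw [LaurentSeries.coeff_coe_powerSeries, PowerSeries.coeff_mk]

/-! ### Regular systems -/

theorem norm_mulVec_le {ι : Type*} [Fintype ι] {A : Matrix ι ι ℂ} {c : ℝ} (hc : 0 ≤ c)
    (hA : ∀ i j, ‖A i j‖ ≤ c) (y : ι → ℂ) : ‖A.mulVec y‖ ≤ Fintype.card ι * c * ‖y‖ := by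
  rw [pi_norm_le_iff_of_nonneg (by positivity)]
  intro i
  calc ‖∑ j, A i j * y j‖ ≤ ∑ _j : ι, c * ‖y‖ := by
        refine norm_sum_le_of_le _ fun j _ => ?_
        rw [norm_mul]
        gcongr
        · exact hA i j
        · exact norm_le_pi_norm y j
    _ = _ := by rw [Finset.sum_const, Finset.card_univ, nsmul_eq_mul, mul_assoc]

theorem exists_strong_recursion {V : Type*} (F : ∀ k : ℕ, (∀ j < k, V) → V) :
    ∃ y : ℕ → V, ∀ k, y k = F k fun j _ => y j :=
  ⟨(wellFounded_lt (α := ℕ)).fix F, fun k => WellFounded.fix_eq _ F k⟩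

/-- Power series solutions of `∑ A_l z^l φ(y) - μ y = g` for large `μ`, with convergence. -/
theorem exists_coefficients {ι : Type*} [Fintype ι] {A : ℕ → Matrix ι ι ℂ} {C r G : ℝ}
    (hC : 0 ≤ C) (hr : 0 < r) (hA : ∀ l i j, ‖A l i j‖ ≤ C * r ^ l) {p μ : ℂ} (hp : ‖p‖ ≤ 1)
    (hμ : 2 * (Fintype.card ι * C) + 1 ≤ ‖μ‖) {g : ℕ → ι → ℂ} (hG : 0 ≤ G)
    (hg : ∀ k, ‖g k‖ ≤ G * r ^ k) :
    ∃ y : ℕ → ι → ℂ, (∀ k, (∑ j ∈ Finset.range (k + 1), p ^ j • (A (k - j)).mulVec (y j)) -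
      μ • y k = g k) ∧ ∀ k, ‖y k‖ ≤ G * (2 * r) ^ k := by
  classical
  set D : ℝ := Fintype.card ι * C with hD
  have hD0 : 0 ≤ D := by positivity
  have hpk : ∀ k : ℕ, ‖p ^ k‖ ≤ 1 := fun k => by
    rw [norm_pow]
    exact pow_le_one₀ (norm_nonneg _) hp
  have hAy : ∀ (l k : ℕ) (y : ι → ℂ), ‖p ^ k • (A l).mulVec y‖ ≤ D * r ^ l * ‖y‖ := by
    intro l k y
    rw [norm_smul]
    have h := norm_mulVec_le (by positivity) (hA l) y
    calc ‖p ^ k‖ * ‖(A l).mulVec y‖ ≤ 1 * (Fintype.card ι * (C * r ^ l) * ‖y‖) := by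
          gcongr
          exact hpk k
      _ = _ := by rw [hD]; ring
  -- Since `‖p‖ ≤ 1`, the matrices `p^k A_0` have norm at most `D` for all `k`, while `‖μ‖ ≥ 2 D +
  -- 1`. So `p^k A_0 - μ` is invertible with a bound uniform in `k`; there are no small divisors.
  have hlow : ∀ (k : ℕ) (y : ι → ℂ), (D + 1) * ‖y‖ ≤ ‖p ^ k • (A 0).mulVec y - μ • y‖ := by
    intro k y
    have h1 := hAy 0 k y
    rw [pow_zero, mul_one] at h1
    have h2 : ‖μ • y‖ - ‖p ^ k • (A 0).mulVec y‖ ≤ ‖p ^ k • (A 0).mulVec y - μ • y‖ := by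
      rw [norm_sub_rev]
      exact norm_sub_norm_le _ _
    rw [norm_smul] at h2
    have h3 : (2 * D + 1) * ‖y‖ ≤ ‖μ‖ * ‖y‖ := by gcongr
    linarith
  have hsurj : ∀ k : ℕ, ∃ S : (ι → ℂ) → ι → ℂ,
      ∀ h, p ^ k • (A 0).mulVec (S h) - μ • S h = h := by
    intro k
    let F : (ι → ℂ) →ₗ[ℂ] ι → ℂ := p ^ k • (A 0).mulVecLin - μ • LinearMap.id
    have hF : ∀ y, F y = p ^ k • (A 0).mulVec y - μ • y := fun y => rfl
    have hinj : Function.Injective F := by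
      rw [injective_iff_map_eq_zero]
      intro y hy
      have := hlow k y
      rw [← hF, hy, norm_zero] at this
      have h0 := norm_nonneg y
      exact norm_eq_zero.1 (by nlinarith)
    have hs := LinearMap.injective_iff_surjective.1 hinj
    choose S hS using hs
    exact ⟨S, hS⟩
  choose S hS using hsurj
  obtain ⟨y, hy⟩ := exists_strong_recursion (V := ι → ℂ) fun k y =>
    S k (g k - ∑ j : Fin k, p ^ (j : ℕ) • (A (k - j)).mulVec (y j j.2))
  have hrec : ∀ k, (∑ j ∈ Finset.range (k + 1), p ^ j • (A (k - j)).mulVec (y j)) -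
      μ • y k = g k := by
    intro k
    have h := hS k (g k - ∑ j : Fin k, p ^ (j : ℕ) • (A (k - j)).mulVec (y j))
    rw [← hy k, Fin.sum_univ_eq_sum_range (fun j => p ^ j • (A (k - j)).mulVec (y j))] at h
    rw [Finset.sum_range_succ, Nat.sub_self, add_sub_assoc, h]
    abel
  refine ⟨y, hrec, fun k => ?_⟩
  induction k using Nat.strong_induction_on with
  | _ k ih =>
    have h1 := hlow k (y k)
    have h2 : p ^ k • (A 0).mulVec (y k) - μ • y k =
        g k - ∑ j ∈ Finset.range k, p ^ j • (A (k - j)).mulVec (y j) := by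
      rw [← hrec k, Finset.sum_range_succ, Nat.sub_self]
      abel
    rw [h2] at h1
    -- Doubling the rate `r` turns the convolution into the geometric sum `∑ 2^j < 2^k`. Together
    -- with `‖g k‖` this gives the factor `D + 1`, which cancels against `hlow`.
    have h3 : ‖∑ j ∈ Finset.range k, p ^ j • (A (k - j)).mulVec (y j)‖ ≤ D * (G * (2 * r) ^ k) := by
      calc _ ≤ ∑ j ∈ Finset.range k, D * G * r ^ k * 2 ^ j := by
            refine norm_sum_le_of_le _ fun j hj => ?_
            have hj := Finset.mem_range.1 hj
            refine (hAy _ _ _).trans ?_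
            calc D * r ^ (k - j) * ‖y j‖ ≤ D * r ^ (k - j) * (G * (2 * r) ^ j) := by
                  gcongr
                  exact ih j hj
              _ = D * G * (r ^ (k - j) * r ^ j) * 2 ^ j := by rw [mul_pow]; ring
              _ = _ := by rw [← pow_add, Nat.sub_add_cancel hj.le]
        _ = D * G * r ^ k * (2 ^ k - 1) := by
            rw [← Finset.mul_sum, geom_sum_eq (by norm_num)]
            norm_num
        _ ≤ D * G * r ^ k * 2 ^ k := by
            gcongr
            linarith
        _ = _ := by rw [mul_pow]; ring
    have h4 : ‖g k‖ ≤ G * (2 * r) ^ k := (hg k).trans (by gcongr; linarith)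
    have h5 := norm_sub_le (g k) (∑ j ∈ Finset.range k, p ^ j • (A (k - j)).mulVec (y j))
    have h6 : (D + 1) * ‖y k‖ ≤ (D + 1) * (G * (2 * r) ^ k) := by linarith
    exact le_of_mul_le_mul_left h6 (by linarith)

/-! ### Lattices -/

section Lattice

variable {M : Type*} [AddCommGroup M] [Module K M] [Module ℂ M] [IsScalarTower ℂ K M]
  {ι : Type*} [Fintype ι] (b : Module.Basis ι K M)

/-- The coefficient of `z ^ k` of a vector, with respect to a basis. -/
def vcoef (x : M) (k : ℤ) : ι → ℂ := fun i => coef (b.repr x i) k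

/-- `x` lies in `z ^ j` times the lattice spanned by the basis. -/
def InLattice (j : ℤ) (x : M) : Prop := ∀ k < j, vcoef b x k = 0

@[simp] theorem vcoef_add (x y : M) (k : ℤ) : vcoef b (x + y) k = vcoef b x k + vcoef b y k := by
  funext i
  simp [vcoef]

@[simp] theorem vcoef_sub (x y : M) (k : ℤ) : vcoef b (x - y) k = vcoef b x k - vcoef b y k := by
  funext i
  simp [vcoef]

@[simp] theorem vcoef_zero (k : ℤ) : vcoef b 0 k = 0 := by
  funext i
  simp [vcoef]

theorem vcoef_smul (c : ℂ) (x : M) (k : ℤ) : vcoef b (c • x) k = c • vcoef b x k := by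
  funext i
  rw [← algebraMap_smul K c x]
  simp only [vcoef, map_smul, Finsupp.smul_apply, smul_eq_mul, Pi.smul_apply, algebraMap_eq,
    coef_monomial_mul, sub_zero]

theorem vcoef_monomial_smul (l : ℤ) (c : ℂ) (x : M) (k : ℤ) :
    vcoef b (monomial l c • x) k = c • vcoef b x (k - l) := by
  funext i
  simp only [vcoef, map_smul, Finsupp.smul_apply, smul_eq_mul, Pi.smul_apply, coef_monomial_mul]

theorem vcoef_sum {α : Type*} (s : Finset α) (x : α → M) (k : ℤ) :
    vcoef b (∑ a ∈ s, x a) k = ∑ a ∈ s, vcoef b (x a) k := by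
  classical
  induction s using Finset.induction_on with
  | empty => simp
  | insert a s ha ih => rw [Finset.sum_insert ha, Finset.sum_insert ha, vcoef_add, ih]

variable {b}

theorem eq_of_vcoef {x y : M} (h : ∀ k, vcoef b x k = vcoef b y k) : x = y :=
  b.ext_elem fun i => coef_ext fun k => congrFun (h k) i

theorem InLattice.mono {j k : ℤ} {x : M} (h : InLattice b j x) (hk : k ≤ j) : InLattice b k x :=
  fun l hl => h l (by omega)

theorem InLattice.add {j : ℤ} {x y : M} (hx : InLattice b j x) (hy : InLattice b j y) :
    InLattice b j (x + y) := fun k hk => by rw [vcoef_add, hx k hk, hy k hk, add_zero]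

theorem InLattice.sub {j : ℤ} {x y : M} (hx : InLattice b j x) (hy : InLattice b j y) :
    InLattice b j (x - y) := fun k hk => by rw [vcoef_sub, hx k hk, hy k hk, sub_zero]

theorem InLattice.smul {j : ℤ} {x : M} (hx : InLattice b j x) (c : ℂ) :
    InLattice b j (c • x) := fun k hk => by rw [vcoef_smul, hx k hk, smul_zero]

theorem InLattice.monomial_smul {j : ℤ} {x : M} (hx : InLattice b j x) (l : ℤ) (c : ℂ) :
    InLattice b (j + l) (monomial l c • x) := fun k hk => by
  rw [vcoef_monomial_smul, hx _ (by omega), smul_zero]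

theorem InLattice.succ {j : ℤ} {x : M} (hx : InLattice b j x) (h : vcoef b x j = 0) :
    InLattice b (j + 1) x := fun k hk => by
  rcases lt_or_eq_of_le (Int.lt_add_one_iff.1 hk) with h' | rfl
  · exact hx k h'
  · exact h

theorem vcoef_sum_smul (f : ι → K) (k : ℤ) : vcoef b (∑ i, f i • b i) k = fun i => coef (f i) k := by
  funext i
  rw [vcoef, ← b.equivFun_symm_apply, ← b.equivFun_apply, LinearEquiv.apply_symm_apply]

theorem exists_const (v : ι → ℂ) : ∃ x : M, InLattice b 0 x ∧ vcoef b x 0 = v := by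
  refine ⟨∑ i, monomial 0 (v i) • b i, fun k hk => ?_, ?_⟩
  · rw [vcoef_sum_smul]
    funext i
    rw [coef_monomial, if_neg hk.ne]
    rfl
  · rw [vcoef_sum_smul]
    funext i
    rw [coef_monomial, if_pos rfl]

/-! ### Semilinear operators preserving a lattice. -/

variable {p : ℂˣ} {T : Module.End ℂ M}

theorem repr_apply (hT : ∀ (f : K) x, T (f • x) = dilate p f • T x) (x : M) (i : ι) :
    b.repr (T x) i = ∑ j, b.repr (T (b j)) i * dilate p (b.repr x j) := by
  conv_lhs => rw [← b.sum_repr x, map_sum, map_sum, Finsupp.finsetSum_apply]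
  refine Finset.sum_congr rfl fun j _ => ?_
  rw [hT, map_smul, Finsupp.smul_apply, smul_eq_mul, mul_comm]

/-- The coefficient matrices of `T` in a basis. -/
def coefMatrix (b : Module.Basis ι K M) (T : Module.End ℂ M) (l : ℤ) : Matrix ι ι ℂ :=
  Matrix.of fun i j => coef (b.repr (T (b j)) i) l

theorem inLattice_basis (i : ι) : InLattice b 0 (b i) := fun k hk => by
  classical
  funext j
  rw [vcoef, b.repr_self, Finsupp.single_apply]
  split_ifs
  · change coef (monomial 0 1) k = 0
    rw [coef_monomial, if_neg hk.ne]
  · rfl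

theorem coefMatrix_eq_zero (hL : ∀ x, InLattice b 0 x → InLattice b 0 (T x)) (i j : ι) (k : ℤ)
    (hk : k < 0) : coef (b.repr (T (b j)) i) k = 0 :=
  congrFun (hL _ (inLattice_basis j) k hk) i

theorem vcoef_apply (hT : ∀ (f : K) x, T (f • x) = dilate p f • T x)
    (hL : ∀ x, InLattice b 0 x → InLattice b 0 (T x)) {a : ℤ} {x : M} (hx : InLattice b a x)
    (k : ℕ) : vcoef b (T x) (a + k) = ∑ l ∈ Finset.range (k + 1),
      (p : ℂ) ^ (a + l) • (coefMatrix b T ((k - l : ℕ) : ℤ)).mulVec (vcoef b x (a + l)) := by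
  funext i
  rw [vcoef, repr_apply hT, coef_sum]
  have h : ∀ j, coef (b.repr (T (b j)) i * dilate p (b.repr x j)) (a + k) =
      ∑ l ∈ Finset.range (k + 1), coef (b.repr (T (b j)) i) ((k - l : ℕ) : ℤ) *
        ((p : ℂ) ^ (a + l) * vcoef b x (a + l) j) := by
    intro j
    have := coef_mul (f := b.repr (T (b j)) i) (g := dilate p (b.repr x j)) (a := 0) (b := a)
      (fun k hk => coefMatrix_eq_zero hL i j k hk)
      (fun k hk => by rw [coef_dilate, show coef (b.repr x j) k = 0 from congrFun (hx k hk) j,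
        mul_zero]) k
    simpa only [zero_add, coef_dilate, vcoef] using this
  simp only [h]
  rw [Finset.sum_comm, Finset.sum_apply]
  refine Finset.sum_congr rfl fun l _ => ?_
  rw [Pi.smul_apply, Matrix.mulVec, dotProduct, Finset.smul_sum]
  refine Finset.sum_congr rfl fun j _ => ?_
  rw [coefMatrix, Matrix.of_apply, smul_eq_mul]
  ring

theorem inLattice_apply (hT : ∀ (f : K) x, T (f • x) = dilate p f • T x)
    (hL : ∀ x, InLattice b 0 x → InLattice b 0 (T x)) {a : ℤ} {x : M} (hx : InLattice b a x) :
    InLattice b a (T x) := by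
  intro k hk
  funext i
  rw [vcoef, repr_apply hT, coef_sum]
  refine Finset.sum_eq_zero fun j _ => ?_
  refine coef_mul_of_lt (a := 0) (b := a) (fun k hk => coefMatrix_eq_zero hL i j k hk)
    (fun k hk => ?_) k (by omega)
  rw [coef_dilate, show coef (b.repr x j) k = 0 from congrFun (hx k hk) j, mul_zero]

/-- For large `μ` the operator `T - μ` is surjective on the lattice. -/
theorem exists_solution (hT : ∀ (f : K) x, T (f • x) = dilate p f • T x)
    (hL : ∀ x, InLattice b 0 x → InLattice b 0 (T x)) (hp : ‖(p : ℂ)‖ ≤ 1) :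
    ∃ R : ℝ, ∀ μ : ℂ, R ≤ ‖μ‖ → ∀ g, InLattice b 0 g → ∃ x, InLattice b 0 x ∧ T x - μ • x = g := by
  obtain ⟨C, r, hC, hr, hA⟩ := exists_bound fun ij : ι × ι => b.repr (T (b ij.2)) ij.1
  refine ⟨2 * (Fintype.card ι * C) + 1, fun μ hμ g hg => ?_⟩
  obtain ⟨G, s, hG, hs, hgb⟩ := exists_bound fun i => b.repr g i
  obtain ⟨y, hy, hyb⟩ := exists_coefficients (A := fun l => coefMatrix b T l) (C := C)
    (r := max r s) (G := G) (p := p) (μ := μ) (g := fun k => vcoef b g k) hC (lt_max_of_lt_left hr)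
    (fun l i j => (hA (i, j) l).trans (by gcongr; exact le_max_left _ _)) hp hμ hG
    (fun k => by
      rw [pi_norm_le_iff_of_nonneg (by positivity)]
      exact fun i => (hgb i k).trans (by gcongr; exact le_max_right _ _))
  have hex : ∀ i, ∃ f : K, (∀ k < 0, coef f k = 0) ∧ ∀ k : ℕ, coef f k = y k i := fun i =>
    exists_of_bound (C := G) (r := 2 * max r s) (by positivity)
      fun k => (norm_le_pi_norm (y k) i).trans (hyb k)
  choose f hf0 hf using hex
  have hx0 : InLattice b 0 (∑ i, f i • b i) := fun k hk => by
    rw [vcoef_sum_smul]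
    exact funext fun i => hf0 i k hk
  refine ⟨∑ i, f i • b i, hx0, eq_of_vcoef (b := b) fun k => ?_⟩
  rcases lt_or_ge k 0 with hk | hk
  · rw [hg k hk]
    exact ((hL _ hx0).sub (hx0.smul μ)) k hk
  · lift k to ℕ using hk
    have hvc : ∀ l : ℕ, vcoef b (∑ i, f i • b i) (l : ℤ) = y l := fun l => by
      rw [vcoef_sum_smul]
      exact funext fun i => hf i l
    have h := vcoef_apply hT hL hx0 k
    simp only [zero_add, hvc, zpow_natCast] at h
    rw [vcoef_sub, vcoef_smul, h, hvc, hy]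

/-! ### Lifting generalized eigenvectors of the residue. -/

/-- The operator `T - λ`. -/
abbrev sh (T : Module.End ℂ M) (lam : ℂ) : Module.End ℂ M := T - lam • 1

theorem sh_apply (T : Module.End ℂ M) (lam : ℂ) (x : M) : sh T lam x = T x - lam • x := rfl

variable (b T) in
/-- The action of `T` on the quotient of `z ^ j` times the lattice by `z ^ (j + 1)` times it. -/
def residue (p : ℂˣ) (j : ℤ) : Module.End ℂ (ι → ℂ) :=
  (p : ℂ) ^ j • (coefMatrix b T 0).mulVecLin

theorem sh_pow_residue (hT : ∀ (f : K) x, T (f • x) = dilate p f • T x)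
    (hL : ∀ x, InLattice b 0 x → InLattice b 0 (T x)) (lam : ℂ) {j : ℤ} {x : M}
    (hx : InLattice b j x) (k : ℕ) : InLattice b j ((sh T lam ^ k) x) ∧
      vcoef b ((sh T lam ^ k) x) j = ((residue b T p j - lam • 1) ^ k) (vcoef b x j) := by
  induction k with
  | zero => exact ⟨hx, rfl⟩
  | succ k ih =>
    rw [pow_succ', pow_succ', Module.End.mul_apply, Module.End.mul_apply, ← ih.2]
    refine ⟨(inLattice_apply hT hL ih.1).sub (ih.1.smul lam), ?_⟩
    have h := vcoef_apply hT hL ih.1 0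
    simp only [Nat.cast_zero, add_zero, zero_add, Finset.range_one, Finset.sum_singleton,
      Nat.sub_zero] at h
    rw [sh_apply, vcoef_sub, vcoef_smul, h]
    rfl

/-- Fitting: the ranges of the powers of `F` become constant. It is used where `F` need not be
invertible, to solve an equation after applying a further power of `F`. -/
theorem exists_range_pow_stable {V : Type*} [AddCommGroup V] [Module ℂ V] [Module.Finite ℂ V]
    (F : Module.End ℂ V) : ∃ D : ℕ, ∀ a : ℕ, ∀ w, ∃ u, (F ^ (D + a)) u = (F ^ D) w := by
  obtain ⟨D, hD⟩ := IsArtinian.monotone_stabilizes (LinearMap.iterateRange F)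
  refine ⟨D, fun a w => ?_⟩
  have h : LinearMap.range (F ^ D) = LinearMap.range (F ^ (D + a)) := hD (D + a) (by omega)
  have : (F ^ D) w ∈ LinearMap.range (F ^ (D + a)) := h ▸ ⟨w, rfl⟩
  exact this

/-- Order by order correction. If `λ` is an eigenvalue of the residue in degree `j + 1`, the error
`(T - λ)^a x` need not be removable there; but after applying `(T - λ)^D` its leading term lies in
the stable range, so a correction `z^(j+1) y` exists for the exponent `D + a`. -/
theorem exists_lift (hT : ∀ (f : K) x, T (f • x) = dilate p f • T x)
    (hL : ∀ x, InLattice b 0 x → InLattice b 0 (T x)) {lam : ℂ} {v : ι → ℂ} {k : ℕ}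
    (hv : ((residue b T p 0 - lam • 1) ^ k) v = 0) (j : ℕ) :
    ∃ x a, InLattice b 0 x ∧ vcoef b x 0 = v ∧ InLattice b (j + 1) ((sh T lam ^ a) x) := by
  induction j with
  | zero =>
    obtain ⟨x, hx, hxv⟩ := exists_const (b := b) v
    obtain ⟨h1, h2⟩ := sh_pow_residue hT hL lam hx k
    exact ⟨x, k, hx, hxv, h1.succ (by rw [h2, hxv, hv])⟩
  | succ j ih =>
    obtain ⟨x, a, hx, hxv, hxa⟩ := ih
    push_cast
    obtain ⟨D, hD⟩ := exists_range_pow_stable (residue b T p (j + 1) - lam • 1)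
    obtain ⟨u, hu⟩ := hD a (vcoef b ((sh T lam ^ a) x) (j + 1))
    obtain ⟨y, hy, hyu⟩ := exists_const (b := b) u
    have hz := hy.monomial_smul (j + 1) 1
    rw [zero_add] at hz
    obtain ⟨h1, h2⟩ := sh_pow_residue hT hL lam hz (D + a)
    obtain ⟨h3, h4⟩ := sh_pow_residue hT hL lam hxa D
    rw [vcoef_monomial_smul, one_smul, sub_self, hyu, hu] at h2
    refine ⟨x - monomial (j + 1) 1 • y, D + a, hx.sub (hz.mono (by omega)), ?_, ?_⟩
    · rw [vcoef_sub, hz 0 (by omega), sub_zero, hxv]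
    · have e : (sh T lam ^ (D + a)) (x - monomial (j + 1) 1 • y) =
          (sh T lam ^ D) ((sh T lam ^ a) x) - (sh T lam ^ (D + a)) (monomial (j + 1) 1 • y) := by
        rw [map_sub]
        congr 1
        rw [pow_add, Module.End.mul_apply]
      rw [e]
      exact (h3.sub h1).succ (by rw [vcoef_sub, h4, h2, sub_self])

/-- A formal lift to sufficiently high order leaves an error on which `(T - λ)^a` can be inverted
exactly, with convergent solutions; subtracting the solution of higher order does not change the
leading term. -/
theorem exists_genEigenvector_lift (hT : ∀ (f : K) x, T (f • x) = dilate p f • T x)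
    (hL : ∀ x, InLattice b 0 x → InLattice b 0 (T x)) (hp : ‖(p : ℂ)‖ < 1) {lam : ℂ}
    (hlam : lam ≠ 0) {v : ι → ℂ} {k : ℕ} (hv : ((residue b T p 0 - lam • 1) ^ k) v = 0) :
    ∃ x ∈ T.maxGenEigenspace lam, InLattice b 0 x ∧ vcoef b x 0 = v := by
  obtain ⟨R, hR⟩ := exists_solution hT hL hp.le
  have hp0 : 0 < ‖(p : ℂ)‖ := norm_pos_iff.2 p.ne_zero
  obtain ⟨N, hN⟩ : ∃ N : ℕ, R * ‖(p : ℂ)‖ ^ N < ‖lam‖ := by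
    have : Filter.Tendsto (fun N : ℕ => R * ‖(p : ℂ)‖ ^ N) Filter.atTop (nhds (R * 0)) :=
      (tendsto_pow_atTop_nhds_zero_of_lt_one hp0.le hp).const_mul R
    rw [mul_zero] at this
    exact (this.eventually_lt_const (norm_pos_iff.2 hlam)).exists
  have hN' : R * ‖(p : ℂ)‖ ^ (N + 1) ≤ ‖lam‖ := by
    rcases le_or_gt 0 R with h | h
    · refine le_trans ?_ hN.le
      exact mul_le_mul_of_nonneg_left (pow_le_pow_of_le_one hp0.le hp.le (by omega)) h
    · exact (mul_nonpos_of_nonpos_of_nonneg h.le (by positivity)).trans (norm_nonneg _)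
  obtain ⟨x, a, hx, hxv, hxa⟩ := exists_lift hT hL hv N
  have hpz : (p : ℂ) ^ (N + 1) ≠ 0 := pow_ne_zero _ p.ne_zero
  -- Conjugation by `z^(N+1)` turns `T - λ` into `p^(N+1) (T - λ/p^(N+1))`, and `N` was chosen such
  -- that `‖λ/p^(N+1)‖ ≥ R`. This is where `λ ≠ 0` and `‖p‖ < 1` enter.
  have hsolve : ∀ g, InLattice b (N + 1) g → ∃ y, InLattice b (N + 1) y ∧ sh T lam y = g := by
    intro g hg
    obtain ⟨y, hy, hyg⟩ := hR (lam / (p : ℂ) ^ (N + 1))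
      (by rw [norm_div, norm_pow, le_div_iff₀ (by positivity)]; exact hN')
      (((p : ℂ) ^ (N + 1))⁻¹ • monomial (-(N + 1)) 1 • g) (by
        have := (hg.monomial_smul (-(N + 1)) 1).smul ((p : ℂ) ^ (N + 1))⁻¹
        simpa using this)
    refine ⟨monomial (N + 1) 1 • y, by simpa using hy.monomial_smul (N + 1) 1, ?_⟩
    have hTy : T y = (lam / (p : ℂ) ^ (N + 1)) • y +
        ((p : ℂ) ^ (N + 1))⁻¹ • monomial (-(N + 1)) 1 • g := by rw [← hyg]; abel
    rw [sh_apply, hT, dilate_monomial, mul_one, hTy]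
    have e1 : monomial ((N : ℤ) + 1) ((p : ℂ) ^ ((N : ℤ) + 1)) =
        (p : ℂ) ^ (N + 1) • monomial ((N : ℤ) + 1) 1 := by
      rw [smul_monomial, mul_one]
      norm_cast
    rw [e1, smul_assoc, smul_add, smul_add]
    simp only [smul_comm (monomial ((N : ℤ) + 1) 1) (_ : ℂ) (_ : M), smul_smul]
    rw [mul_div_cancel₀ _ hpz, mul_inv_cancel₀ hpz, monomial_mul_monomial, add_neg_cancel, mul_one,
      monomial_zero_one, one_smul, one_smul]
    abel
  have hsolve' : ∀ (a : ℕ) g, InLattice b (N + 1) g →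
      ∃ y, InLattice b (N + 1) y ∧ (sh T lam ^ a) y = g := by
    intro a
    induction a with
    | zero => exact fun g hg => ⟨g, hg, rfl⟩
    | succ a ih =>
      intro g hg
      obtain ⟨y, hy, rfl⟩ := ih g hg
      obtain ⟨w, hw, rfl⟩ := hsolve y hy
      exact ⟨w, hw, by rw [pow_succ, Module.End.mul_apply]⟩
  obtain ⟨y, hy, hya⟩ := hsolve' a _ hxa
  refine ⟨x - y, (Module.End.mem_maxGenEigenspace _ _ _).2 ⟨a, ?_⟩,
    hx.sub (hy.mono (by omega)), ?_⟩
  · rw [map_sub]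
    exact sub_eq_zero.2 hya.symm
  · rw [vcoef_sub, hy 0 (by omega), sub_zero, hxv]

/-- In a relation over `K`, the coefficients of lowest order among all the `f i` give a nontrivial
relation between the leading vectors. -/
theorem linearIndependent_of_vcoef {y : ι → M} (hy : ∀ i, InLattice b 0 (y i))
    (hy0 : LinearIndependent ℂ fun i => vcoef b (y i) 0) : LinearIndependent K y := by
  classical
  rw [Fintype.linearIndependent_iff]
  intro f hf
  by_contra! hne
  obtain ⟨i₀, hi₀⟩ := hne
  have hord : ∀ g : K, g ≠ 0 → coef g (ord g) ≠ 0 := fun g hg =>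
    HahnSeries.coeff_order_eq_zero.not.2 (by simpa using hg)
  obtain ⟨i, hi, hmin⟩ := Finset.exists_min_image
    (Finset.univ.filter fun i => f i ≠ 0) (fun i => ord (f i)) ⟨i₀, by simpa using hi₀⟩
  have hi : f i ≠ 0 := by simpa using hi
  have hlow : ∀ j, ∀ k < ord (f i), coef (f j) k = 0 := by
    intro j k hk
    by_cases hj : f j = 0
    · rw [hj, coef_zero]
    · exact HahnSeries.coeff_eq_zero_of_lt_order (hk.trans_le (hmin j (by simpa using hj)))
  have h := congrArg (fun x => vcoef b x (ord (f i))) hf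
  simp only [vcoef_sum, vcoef_zero] at h
  have hterm : ∀ j, vcoef b (f j • y j) (ord (f i)) = coef (f j) (ord (f i)) • vcoef b (y j) 0 := by
    intro j
    funext l
    rw [vcoef, map_smul, Finsupp.smul_apply, smul_eq_mul]
    have := coef_mul (hlow j) (b := 0) (g := b.repr (y j) l)
      (fun k hk => congrFun (hy j k hk) l) 0
    simpa [vcoef] using this
  simp only [hterm] at h
  exact hord _ hi (Fintype.linearIndependent_iff.1 hy0 _ h i)

/-- A module with an operator preserving a lattice and bijective on it is spanned by generalized
eigenvectors. -/
theorem eq_top_of_genEigenvectors_mem (hT : ∀ (f : K) x, T (f • x) = dilate p f • T x)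
    (hL : ∀ x, InLattice b 0 x → InLattice b 0 (T x)) (hp : ‖(p : ℂ)‖ < 1)
    (hinj : ∀ x, InLattice b 0 x → InLattice b 1 (T x) → InLattice b 1 x) (P : Submodule K M)
    (hP : ∀ μ : ℂ, μ ≠ 0 → ∀ x ∈ T.maxGenEigenspace μ, x ∈ P) : P = ⊤ := by
  classical
  -- Bijectivity on the lattice excludes the eigenvalue `0` of the residue, the one that cannot be
  -- lifted.
  have hres : Function.Injective (residue b T p 0) := by
    rw [injective_iff_map_eq_zero]
    intro v hv
    obtain ⟨x, hx, hxv⟩ := exists_const (b := b) v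
    obtain ⟨h1, h2⟩ := sh_pow_residue hT hL 0 hx 1
    rw [pow_one, pow_one, zero_smul, sub_zero, hxv, hv, show sh T 0 = T by simp] at h2
    rw [← hxv]
    exact hinj x hx ((hL x hx).succ h2) 0 (by norm_num)
  -- The leading vectors of the elements of `P` in the lattice. The lifts show that they are all of
  -- `ℂ^ι`, and lifts of the standard basis are then `K`-independent, in the right number.
  let Q : Submodule ℂ (ι → ℂ) :=
    { carrier := {v | ∃ x ∈ P, InLattice b 0 x ∧ vcoef b x 0 = v}
      add_mem' := by
        rintro _ _ ⟨x, hxP, hx, rfl⟩ ⟨y, hyP, hy, rfl⟩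
        exact ⟨x + y, P.add_mem hxP hyP, hx.add hy, vcoef_add b x y 0⟩
      zero_mem' := ⟨0, P.zero_mem, fun k _ => vcoef_zero b k, vcoef_zero b 0⟩
      smul_mem' := by
        rintro c _ ⟨x, hxP, hx, rfl⟩
        refine ⟨c • x, ?_, hx.smul c, vcoef_smul b c x 0⟩
        rw [← algebraMap_smul K]
        exact P.smul_mem _ hxP }
  have hQ : Q = ⊤ := by
    rw [eq_top_iff, ← Module.End.iSup_maxGenEigenspace_eq_top (residue b T p 0)]
    refine iSup_le fun μ v hv => ?_
    obtain ⟨k, hk⟩ := (Module.End.mem_maxGenEigenspace _ _ _).1 hv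
    by_cases hμ : μ = 0
    · rw [hμ, zero_smul, sub_zero] at hk
      have : v = 0 := by
        have hinj' : Function.Injective ((residue b T p 0) ^ k) := by
          rw [Module.End.coe_pow]
          exact hres.iterate k
        exact hinj' (by rw [hk, map_zero])
      rw [this]
      exact Q.zero_mem
    · obtain ⟨x, hx, hx0, hxv⟩ := exists_genEigenvector_lift hT hL hp hμ hk
      exact ⟨x, hP μ hμ x hx, hx0, hxv⟩
  have hex : ∀ i, ∃ x ∈ P, InLattice b 0 x ∧ vcoef b x 0 = Pi.single i 1 := fun i => by
    have : (Pi.single i 1 : ι → ℂ) ∈ Q := hQ ▸ Submodule.mem_top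
    exact this
  choose y hyP hy hy0 using hex
  have hli : LinearIndependent K y := by
    refine linearIndependent_of_vcoef hy ?_
    simp only [hy0]
    have := (Pi.basisFun ℂ ι).linearIndependent
    convert this using 1
    funext i
    rw [Pi.basisFun_apply]
  have := Module.Finite.of_basis b
  have hspan := hli.span_eq_top_of_card_eq_finrank' (Module.finrank_eq_card_basis b).symm
  rw [eq_top_iff, ← hspan, Submodule.span_le]
  rintro _ ⟨i, rfl⟩
  exact hyP i

end Lattice

/-! ### The operator `z ^ (-t) Φ ^ n` -/

theorem norm_qpow_lt_one {τ : ℂ} (hτ : 0 < τ.im) : ‖(qpow τ 1 : ℂ)‖ < 1 := by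
  rw [qpow, Units.val_mk0, Complex.norm_exp, Real.exp_lt_one_iff]
  simp
  positivity

theorem qpow_zpow_eq_one {τ : ℂ} (hτ : 0 < τ.im) {a : ℤ} (h : (qpow τ 1 : ℂ) ^ a = 1) : a = 0 := by
  have h1 := congrArg norm h
  rw [norm_zpow, norm_one] at h1
  exact (zpow_eq_one_iff_right₀ (norm_nonneg _) (norm_qpow_lt_one hτ).ne).1 h1

theorem φ_apply (τ : ℂ) (f : K) : φ τ f = dilate (qpow τ 1) f := rfl

section Operator

variable {τ : ℂ} {M : Type*} [AddCommGroup M] [Module K M] [Module ℂ M] [IsScalarTower ℂ K M]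
  (Φ : M →ₛₗ[φ τ] M) (t : ℤ) (n : ℕ)

/-- `Φ` as a `ℂ`-linear map. -/
def cEnd : Module.End ℂ M where
  toFun := Φ
  map_add' := map_add Φ
  map_smul' c x := by
    rw [← algebraMap_smul K c x, map_smulₛₗ, φ_apply, dilate_algebraMap, algebraMap_smul]
    rfl

@[simp] theorem cEnd_apply (x : M) : cEnd Φ x = Φ x := rfl

theorem cEnd_pow_apply (i : ℕ) (x : M) : (cEnd Φ ^ i) x = Φ^[i] x := by
  rw [Module.End.coe_pow]
  rfl

theorem cEnd_pow_smul (i : ℕ) (f : K) (x : M) :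
    (cEnd Φ ^ i) (f • x) = dilate (qpow τ 1 ^ i) f • (cEnd Φ ^ i) x := by
  induction i with
  | zero => rw [pow_zero, pow_zero, dilate_one]; rfl
  | succ i ih =>
    rw [pow_succ', Module.End.mul_apply, Module.End.mul_apply, ih, cEnd_apply, map_smulₛₗ, φ_apply,
      dilate_dilate, ← pow_succ', cEnd_apply]

/-- The operator `z ^ (-t) Φ ^ n`. -/
def opT : Module.End ℂ M := Algebra.lsmul ℂ ℂ M (monomial (-t) 1) * cEnd Φ ^ n

theorem opT_apply (x : M) : opT Φ t n x = monomial (-t) (1 : ℂ) • (cEnd Φ ^ n) x := rfl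

theorem cEnd_pow_eq_smul_opT (x : M) : (cEnd Φ ^ n) x = monomial t (1 : ℂ) • opT Φ t n x := by
  rw [opT_apply, smul_smul, monomial_mul_monomial, add_neg_cancel, mul_one, monomial_zero_one,
    one_smul]

theorem opT_smul (f : K) (x : M) : opT Φ t n (f • x) = dilate (qpow τ 1 ^ n) f • opT Φ t n x := by
  rw [opT_apply, opT_apply, cEnd_pow_smul, smul_comm]

/-- The factor comes from moving `z^(-t)` through `Φ`, since `φ(z^(-t)) = q^(-t) z^(-t)`. -/
theorem opT_cEnd (x : M) :
    opT Φ t n (cEnd Φ x) = (qpow τ 1 : ℂ) ^ t • cEnd Φ (opT Φ t n x) := by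
  rw [opT_apply, opT_apply, cEnd_apply, cEnd_apply, map_smulₛₗ, φ_apply, dilate_monomial, mul_one,
    ← smul_assoc, smul_monomial, ← zpow_add₀ (Units.ne_zero _), add_neg_cancel, zpow_zero]
  congr 1
  rw [← cEnd_apply, ← cEnd_apply, ← Module.End.mul_apply, ← Module.End.mul_apply, ← pow_succ,
    ← pow_succ']

theorem opT_cEnd_pow (i : ℕ) (x : M) :
    opT Φ t n ((cEnd Φ ^ i) x) = (qpow τ 1 : ℂ) ^ (t * i) • (cEnd Φ ^ i) (opT Φ t n x) := by
  induction i with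
  | zero => simp
  | succ i ih =>
    rw [pow_succ', Module.End.mul_apply, opT_cEnd, ih, map_smul, smul_smul, Module.End.mul_apply,
      ← zpow_add₀ (Units.ne_zero _)]
    congr 2
    push_cast
    ring

/-- The `γ k` are powers of `q` collected when the factors `z^(-t)` are moved to the left; their
nonvanishing is what matters. -/
theorem exists_opT_pow : ∃ γ : ℕ → ℂ, (∀ k, γ k ≠ 0) ∧ γ 0 = 1 ∧
    ∀ (k : ℕ) (x : M), (opT Φ t n ^ k) x = monomial (-(t * k)) (γ k) • (cEnd Φ ^ (n * k)) x := by
  have key : ∀ k : ℕ, ∃ γ : ℂ, γ ≠ 0 ∧ (k = 0 → γ = 1) ∧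
      ∀ x : M, (opT Φ t n ^ k) x = monomial (-(t * k)) γ • (cEnd Φ ^ (n * k)) x := by
    intro k
    induction k with
    | zero =>
      refine ⟨1, one_ne_zero, fun _ => rfl, fun x => ?_⟩
      simp [monomial_zero_one]
    | succ k ih =>
      obtain ⟨γ, hγ, -, h⟩ := ih
      refine ⟨((qpow τ 1 ^ n : ℂˣ) : ℂ) ^ (-(t * k)) * γ,
        mul_ne_zero (zpow_ne_zero _ (Units.ne_zero _)) hγ, fun h => by omega, fun x => ?_⟩
      rw [pow_succ', Module.End.mul_apply, h, opT_smul, dilate_monomial, opT_apply, smul_smul,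
        monomial_mul_monomial, mul_one, ← Module.End.mul_apply, ← pow_add]
      congr 2
      · push_cast
        ring_nf
      · congr 1
        ring
  choose γ h0 h1 h using key
  exact ⟨γ, h0, h1 0 rfl, h⟩

theorem sh_opT_cEnd_pow (i k : ℕ) (lam : ℂ) (x : M) :
    (sh (opT Φ t n) ((qpow τ 1 : ℂ) ^ (t * i) * lam) ^ k) ((cEnd Φ ^ i) x) =
      ((qpow τ 1 : ℂ) ^ (t * i)) ^ k • (cEnd Φ ^ i) ((sh (opT Φ t n) lam ^ k) x) := by
  induction k with
  | zero => simp
  | succ k ih =>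
    rw [pow_succ', Module.End.mul_apply, ih, map_smul, sh_apply, opT_cEnd_pow, mul_smul, ← smul_sub,
      ← map_smul (cEnd Φ ^ i), ← map_sub, smul_smul, ← pow_succ, pow_succ' (sh _ _),
      Module.End.mul_apply, sh_apply]

theorem cEnd_pow_mem_iff (hΦ : Function.Injective Φ) (i : ℕ) (lam : ℂ) (x : M) :
    (cEnd Φ ^ i) x ∈ (opT Φ t n).maxGenEigenspace ((qpow τ 1 : ℂ) ^ (t * i) * lam) ↔
      x ∈ (opT Φ t n).maxGenEigenspace lam := by
  rw [Module.End.mem_maxGenEigenspace, Module.End.mem_maxGenEigenspace]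
  refine exists_congr fun k => ?_
  have h := sh_opT_cEnd_pow Φ t n i k lam x
  rw [h, smul_eq_zero, or_iff_right (pow_ne_zero _ (zpow_ne_zero _ (Units.ne_zero _)))]
  have hinj : Function.Injective (cEnd Φ ^ i) := by
    rw [Module.End.coe_pow]
    exact hΦ.iterate i
  exact ⟨fun h => hinj (by rw [h, map_zero]), fun h => by rw [h, map_zero]⟩

theorem sh_opT_monomial (l : ℤ) (k : ℕ) (lam : ℂ) (x : M) :
    (sh (opT Φ t n) ((qpow τ 1 : ℂ) ^ (n * l) * lam) ^ k) (monomial l (1 : ℂ) • x) =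
      ((qpow τ 1 : ℂ) ^ (n * l)) ^ k • monomial l (1 : ℂ) • (sh (opT Φ t n) lam ^ k) x := by
  induction k with
  | zero => simp
  | succ k ih =>
    have e : monomial l (((qpow τ 1 ^ n : ℂˣ) : ℂ) ^ l * 1) =
        (qpow τ 1 : ℂ) ^ (n * l) • monomial l (1 : ℂ) := by
      rw [smul_monomial, Units.val_pow_eq_pow_val, zpow_mul, zpow_natCast]
    rw [pow_succ', Module.End.mul_apply, ih, map_smul, sh_apply, opT_smul, dilate_monomial, e,
      mul_smul, smul_assoc, ← smul_sub, smul_comm lam, ← smul_sub, smul_smul, ← pow_succ,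
      pow_succ' (sh _ _), Module.End.mul_apply, sh_apply]

theorem monomial_smul_mem {l : ℤ} {lam : ℂ} {x : M}
    (hx : x ∈ (opT Φ t n).maxGenEigenspace lam) :
    monomial l (1 : ℂ) • x ∈ (opT Φ t n).maxGenEigenspace ((qpow τ 1 : ℂ) ^ (n * l) * lam) := by
  rw [Module.End.mem_maxGenEigenspace] at hx ⊢
  obtain ⟨k, hk⟩ := hx
  exact ⟨k, by rw [sh_opT_monomial, hk, smul_zero, smul_zero]⟩

/-- Both translations are invertible, so the eigenspace is an exact translate of the one for `lam`,
not merely larger. -/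
theorem exists_of_mem_maxGenEigenspace (hΦ : Function.Bijective Φ) (i : ℕ) (l : ℤ) {lam : ℂ} {y : M}
    (hy : y ∈ (opT Φ t n).maxGenEigenspace ((qpow τ 1 : ℂ) ^ (t * i + n * l) * lam)) :
    ∃ x ∈ (opT Φ t n).maxGenEigenspace lam, y = monomial l (1 : ℂ) • (cEnd Φ ^ i) x := by
  have h1 := monomial_smul_mem Φ t n (l := -l) hy
  rw [← mul_assoc, ← zpow_add₀ (Units.ne_zero _),
    show (n : ℤ) * -l + (t * i + n * l) = t * i by ring] at h1
  obtain ⟨x, hx⟩ := hΦ.2.iterate i (monomial (-l) (1 : ℂ) • y)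
  rw [← cEnd_pow_apply] at hx
  rw [← hx, cEnd_pow_mem_iff Φ t n hΦ.1] at h1
  refine ⟨x, h1, ?_⟩
  rw [hx, smul_smul, monomial_mul_monomial, add_neg_cancel, mul_one, monomial_zero_one, one_smul]

end Operator

/-! ### The Newton polygon with one slope -/

section Slope

theorem coef_of_lt_ord {f : K} {k : ℤ} (h : k < ord f) : coef f k = 0 :=
  HahnSeries.coeff_eq_zero_of_lt_order h

theorem coef_ord_ne_zero {f : K} (hf : f ≠ 0) : coef f (ord f) ≠ 0 :=
  HahnSeries.coeff_order_eq_zero.not.2 (by simpa using hf)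

theorem ord_monomial (k : ℤ) {c : ℂ} (hc : c ≠ 0) : ord (monomial k c) = k :=
  HahnSeries.order_single hc

theorem ord_one : ord 1 = 0 := HahnSeries.order_one

/-- The leftmost and the rightmost edge of the Newton polygon both have slope `s`. The first bounds
`v(a_0)` from above, the second all `v(a_k)` from below, so the polygon is one segment. -/
theorem newton_of_unique_slope {L : Polynomial K} (hL : L.Monic) (h0 : L.coeff 0 ≠ 0)
    (hd : 0 < L.natDegree) {s : ℚ} (hs : ∀ s', IsSlope L s' → s' = s) :
    (ord (L.coeff 0) : ℚ) = s * L.natDegree ∧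
      ∀ k ∈ L.support, s * (L.natDegree - k) ≤ ord (L.coeff k) := by
  classical
  have hdm : L.natDegree ∈ L.support := by
    rw [Polynomial.mem_support_iff, hL.coeff_natDegree]
    exact one_ne_zero
  have h0m : 0 ∈ L.support := Polynomial.mem_support_iff.2 h0
  have hd1 : ord (L.coeff L.natDegree) = 0 := by rw [hL.coeff_natDegree, ord_one]
  have hdQ : (0 : ℚ) < L.natDegree := by exact_mod_cast hd
  have hA : (ord (L.coeff 0) : ℚ) ≤ s * L.natDegree := by
    -- The steepest line through `(0, v(a_0))` and another point supports the polygon: its leftmost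
    -- edge.
    obtain ⟨j, hj, hmax⟩ := Finset.exists_max_image (L.support.erase 0)
      (fun k => ((ord (L.coeff 0) : ℚ) - ord (L.coeff k)) / k)
      ⟨L.natDegree, Finset.mem_erase.2 ⟨hd.ne', hdm⟩⟩
    obtain ⟨hj0, hjm⟩ := Finset.mem_erase.1 hj
    set s' := ((ord (L.coeff 0) : ℚ) - ord (L.coeff j)) / j with hs'
    have hjQ : (0 : ℚ) < j := by exact_mod_cast Nat.pos_of_ne_zero hj0
    have hle : ∀ k ∈ L.support, (ord (L.coeff 0) : ℚ) ≤ ord (L.coeff k) + s' * k := by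
      intro k hk
      rcases Nat.eq_zero_or_pos k with rfl | hk0
      · simp
      · have := hmax k (Finset.mem_erase.2 ⟨hk0.ne', hk⟩)
        rw [div_le_iff₀ (by exact_mod_cast hk0)] at this
        linarith
    have hsl : s' = s := hs s' ⟨0, h0m, j, hjm, Nat.pos_of_ne_zero hj0, by
      rw [hs']
      field_simp
      simp [mul_comm], fun k hk => by simpa using hle k hk⟩
    have := hle _ hdm
    rw [hd1, hsl] at this
    simpa using this
  have hB : ∀ k ∈ L.support, s * (L.natDegree - k) ≤ ord (L.coeff k) := by
    -- Likewise at the right end `(d, 0)`: the rightmost edge.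
    obtain ⟨i, hi, hmin⟩ := Finset.exists_min_image (L.support.erase L.natDegree)
      (fun k => (ord (L.coeff k) : ℚ) / (L.natDegree - k)) ⟨0, Finset.mem_erase.2 ⟨hd.ne, h0m⟩⟩
    obtain ⟨hid, him⟩ := Finset.mem_erase.1 hi
    have hlt : ∀ k ∈ L.support, k ≠ L.natDegree → (0 : ℚ) < L.natDegree - k := fun k hk hkd =>
      sub_pos.2 (by exact_mod_cast lt_of_le_of_ne (Polynomial.le_natDegree_of_mem_supp k hk) hkd)
    set s' := (ord (L.coeff i) : ℚ) / (L.natDegree - i) with hs'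
    have hi' : (ord (L.coeff i) : ℚ) = s' * (L.natDegree - i) := by
      rw [hs', div_mul_cancel₀ _ (hlt i him hid).ne']
    have hle : ∀ k ∈ L.support, s' * (L.natDegree - k) ≤ ord (L.coeff k) := by
      intro k hk
      by_cases hkd : k = L.natDegree
      · rw [hkd, hd1]
        simp
      · have := hmin k (Finset.mem_erase.2 ⟨hkd, hk⟩)
        rwa [le_div_iff₀ (hlt k hk hkd)] at this
    have hsl : s' = s := hs s' ⟨i, him, L.natDegree, hdm,
      lt_of_le_of_ne (Polynomial.le_natDegree_of_mem_supp i him) hid, by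
        rw [hd1, hi']
        push_cast
        ring, fun k hk => by
        have := hle k hk
        rw [hi']
        linarith⟩
    rwa [hsl] at hle
  refine ⟨le_antisymm hA ?_, hB⟩
  simpa using hB 0 h0m

end Slope

/-! ### The lattice of a pure module -/

/-- All coefficients of `z ^ k` with `k < r` vanish. -/
def Vanishes (r : ℚ) (f : K) : Prop := ∀ k : ℤ, (k : ℚ) < r → coef f k = 0

theorem Vanishes.add {r : ℚ} {f g : K} (hf : Vanishes r f) (hg : Vanishes r g) :
    Vanishes r (f + g) := fun k hk => by rw [coef_add, hf k hk, hg k hk, add_zero]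

theorem Vanishes.neg {r : ℚ} {f : K} (hf : Vanishes r f) : Vanishes r (-f) := fun k hk => by
  rw [coef_neg, hf k hk, neg_zero]

theorem vanishes_zero (r : ℚ) : Vanishes r 0 := fun _ _ => rfl

theorem Vanishes.mul {r s : ℚ} {f g : K} (hf : Vanishes r f) (hg : Vanishes s g) :
    Vanishes (r + s) (f * g) := fun k hk => by
  refine coef_mul_of_lt (a := ⌈r⌉) (b := ⌈s⌉) (fun k hk => hf k (Int.lt_ceil.1 hk))
    (fun k hk => hg k (Int.lt_ceil.1 hk)) k ?_
  have h1 := Int.le_ceil r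
  have h2 := Int.le_ceil s
  have : (k : ℚ) < ((⌈r⌉ + ⌈s⌉ : ℤ) : ℚ) := by push_cast; linarith
  exact_mod_cast this

theorem Vanishes.dilate {r : ℚ} {f : K} (hf : Vanishes r f) (a : ℂˣ) :
    Vanishes r (dilate a f) := fun k hk => by rw [coef_dilate, hf k hk, mul_zero]

theorem vanishes_of_le_ord {r : ℚ} {f : K} (h : r ≤ ord f) : Vanishes r f := fun k hk =>
  coef_of_lt_ord (by
    have : (k : ℚ) < (ord f : ℚ) := hk.trans_le h
    exact_mod_cast this)

theorem ord_inv {f : K} (hf : f ≠ 0) : ord f⁻¹ = -ord f := by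
  have h : (f : LaurentSeries ℂ) * ((f⁻¹ : K) : LaurentSeries ℂ) = 1 := by
    rw [← Subfield.coe_mul, mul_inv_cancel₀ hf]
    rfl
  have h1 := congrArg HahnSeries.order h
  rw [HahnSeries.order_mul (by simpa using hf) (by simpa using hf), HahnSeries.order_one] at h1
  unfold ord
  omega

section Weight

variable {τ : ℂ} {M : Type*} [AddCommGroup M] [Module K M] [Module ℂ M] [IsScalarTower ℂ K M]
  {d : ℕ} (B : Module.Basis (Fin d) K M) (s : ℚ)

/-- The lattices with weights `s i` at the `i`-th basis vector. -/
def InWeight (r : ℚ) (x : M) : Prop := ∀ i : Fin d, Vanishes (r - s * (i : ℕ)) (B.repr x i)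

variable {B s}

theorem InWeight.add {r : ℚ} {x y : M} (hx : InWeight B s r x) (hy : InWeight B s r y) :
    InWeight B s r (x + y) := fun i => by
  rw [map_add, Finsupp.add_apply]
  exact (hx i).add (hy i)

theorem inWeight_zero (r : ℚ) : InWeight B s r 0 := fun i => by
  rw [map_zero]
  exact vanishes_zero _

theorem inWeight_sum {α : Type*} {S : Finset α} {x : α → M} {r : ℚ}
    (h : ∀ a ∈ S, InWeight B s r (x a)) : InWeight B s r (∑ a ∈ S, x a) :=
  Finset.sum_induction _ _ (fun _ _ => InWeight.add) (inWeight_zero r) h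

theorem inWeight_smul_basis {r : ℚ} {f : K} (i : Fin d) (hf : Vanishes (r - s * (i : ℕ)) f) :
    InWeight B s r (f • B i) := fun j => by
  classical
  rw [map_smul, Finsupp.smul_apply, B.repr_self, Finsupp.single_apply]
  split_ifs with h
  · rw [← h]
    simpa using hf
  · simpa using vanishes_zero _

theorem inWeight_monomial_smul (r : ℚ) (l : ℤ) (x : M) :
    InWeight B s r (monomial l (1 : ℂ) • x) ↔ InWeight B s (r - l) x := by
  refine forall_congr' fun i => ?_
  rw [map_smul, Finsupp.smul_apply, smul_eq_mul]
  constructor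
  · intro h k hk
    have := h (k + l) (by push_cast; linarith)
    rwa [coef_monomial_mul, one_mul, add_sub_cancel_right] at this
  · intro h k hk
    rw [coef_monomial_mul, one_mul]
    exact h _ (by push_cast; linarith)

variable {Φ : M →ₛₗ[φ τ] M} {e : M} {a : ℕ → K}

/-- Only `i = d` needs an argument: `Φ^d e = -∑ a_k Φ^k e` has weight `s d` because `v(a_k) ≥ s (d -
k)`. -/
theorem inWeight_smul_iterate (hB : ∀ i : Fin d, B i = (cEnd Φ ^ (i : ℕ)) e) (had : a d = 1)
    (hrel : ∑ i ∈ Finset.range (d + 1), a i • (cEnd Φ ^ i) e = 0)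
    (ha : ∀ k ≤ d, Vanishes (s * (d - k)) (a k)) {r : ℚ} {i : ℕ} (hi : i ≤ d) {f : K}
    (hf : Vanishes (r - s * i) f) : InWeight B s r (f • (cEnd Φ ^ i) e) := by
  rcases lt_or_eq_of_le hi with h | rfl
  · have := inWeight_smul_basis (B := B) ⟨i, h⟩ hf
    rwa [hB] at this
  · rw [Finset.sum_range_succ, had, one_smul] at hrel
    rw [eq_neg_of_add_eq_zero_right hrel, smul_neg, ← neg_smul, Finset.smul_sum]
    refine inWeight_sum fun k hk => ?_
    have hk := Finset.mem_range.1 hk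
    rw [smul_smul]
    have := inWeight_smul_basis (B := B) (s := s) (r := r) (f := -f * a k) ⟨k, hk⟩ (by
      convert hf.neg.mul (ha k hk.le) using 1
      simp only
      ring)
    rwa [hB] at this

theorem inWeight_apply (hB : ∀ i : Fin d, B i = (cEnd Φ ^ (i : ℕ)) e) (had : a d = 1)
    (hrel : ∑ i ∈ Finset.range (d + 1), a i • (cEnd Φ ^ i) e = 0)
    (ha : ∀ k ≤ d, Vanishes (s * (d - k)) (a k)) {r : ℚ} {x : M} (hx : InWeight B s r x) :
    InWeight B s (r + s) (Φ x) := by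
  rw [← B.sum_repr x, map_sum]
  refine inWeight_sum fun i _ => ?_
  rw [map_smulₛₗ, φ_apply, hB, ← cEnd_apply, ← Module.End.mul_apply, ← pow_succ']
  refine inWeight_smul_iterate hB had hrel ha i.2 ?_
  convert (hx i).dilate (qpow τ 1) using 1
  push_cast
  ring

/-- A preimage of `Φ x` of the right weight is built from the coordinates of `Φ x`, and injectivity
identifies it with `x`. For the coordinate at `e` one solves `L e = 0` for `e`; no weight is lost
because `v(a_0)` is exactly `s d`. -/
theorem inWeight_of_apply (hΦ : Function.Injective Φ)
    (hB : ∀ i : Fin d, B i = (cEnd Φ ^ (i : ℕ)) e) (had : a d = 1)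
    (hrel : ∑ i ∈ Finset.range (d + 1), a i • (cEnd Φ ^ i) e = 0)
    (ha : ∀ k ≤ d, Vanishes (s * (d - k)) (a k)) (ha0 : a 0 ≠ 0)
    (ha0' : Vanishes (-(s * d)) (a 0)⁻¹) {r : ℚ} {x : M} (hx : InWeight B s (r + s) (Φ x)) :
    InWeight B s r x := by
  have key : ∀ k : ℕ, 1 ≤ k → k ≤ d → ∀ f : K, Vanishes (r + s - s * k) f →
      ∃ y, InWeight B s r y ∧ Φ y = f • (cEnd Φ ^ k) e := by
    intro k hk hkd f hf
    obtain ⟨k, rfl⟩ := Nat.exists_eq_add_of_le' hk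
    refine ⟨dilate (qpow τ 1)⁻¹ f • (cEnd Φ ^ k) e, ?_, ?_⟩
    · refine inWeight_smul_iterate hB had hrel ha (by omega) ?_
      convert hf.dilate (qpow τ 1)⁻¹ using 1
      push_cast
      ring
    · rw [map_smulₛₗ, φ_apply, dilate_inv_dilate, ← cEnd_apply, ← Module.End.mul_apply, ← pow_succ']
  have hsum : ∀ {α : Type} (S : Finset α) (z : α → M),
      (∀ i ∈ S, ∃ y, InWeight B s r y ∧ Φ y = z i) → ∃ y, InWeight B s r y ∧ Φ y = ∑ i ∈ S, z i := by
    intro α S z h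
    refine Finset.sum_induction _ (fun z => ∃ y, InWeight B s r y ∧ Φ y = z) ?_
      ⟨0, inWeight_zero r, map_zero Φ⟩ h
    rintro _ _ ⟨y, hy, rfl⟩ ⟨y', hy', rfl⟩
    exact ⟨y + y', hy.add hy', map_add Φ y y'⟩
  obtain ⟨y, hy, hyx⟩ : ∃ y, InWeight B s r y ∧ Φ y = Φ x := by
    rw [← B.sum_repr (Φ x)]
    refine hsum _ _ fun i _ => ?_
    rw [hB]
    rcases Nat.eq_zero_or_pos i with hi | hi
    · have h0 : e = ∑ k ∈ Finset.range d, (-((a 0)⁻¹ * a (k + 1))) • (cEnd Φ ^ (k + 1)) e := by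
        rw [Finset.sum_range_succ'] at hrel
        have h := eq_neg_of_add_eq_zero_right hrel
        simp only [neg_smul, mul_smul, Finset.sum_neg_distrib, ← Finset.smul_sum]
        rw [← smul_neg, ← h, smul_smul, inv_mul_cancel₀ ha0, one_smul]
        rfl
      rw [hi, pow_zero, Module.End.one_apply]
      nth_rewrite 1 [h0]
      rw [Finset.smul_sum]
      refine hsum _ _ fun k hk => ?_
      have hk := Finset.mem_range.1 hk
      rw [smul_smul]
      refine key (k + 1) (by omega) (by omega) _ ?_
      convert (hx i).mul (ha0'.mul (ha (k + 1) (by omega))).neg using 1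
      rw [hi]
      push_cast
      ring
    · exact key i hi i.2.le _ (hx i)
  rwa [← hΦ hyx]

/-- Orders are integers, so rational weights may be rounded: the basis is `z^(-⌊s i⌋) B i`. -/
theorem exists_lattice_basis (B : Module.Basis (Fin d) K M) (s : ℚ) :
    ∃ b : Module.Basis (Fin d) K M, ∀ (j : ℤ) (x : M), InLattice b j x ↔ InWeight B s j x := by
  let w : Fin d → Kˣ := fun i =>
    Units.mk0 (monomial (-⌊s * (i : ℕ)⌋) 1) (monomial_ne_zero _ one_ne_zero)
  have hw : ∀ i, (((w i)⁻¹ : Kˣ) : K) = monomial ⌊s * (i : ℕ)⌋ 1 := fun i => by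
    rw [Units.val_inv_eq_inv_val]
    refine inv_eq_of_mul_eq_one_right ?_
    change monomial _ _ * _ = _
    rw [monomial_mul_monomial, neg_add_cancel, mul_one, monomial_zero_one]
  refine ⟨B.unitsSMul w, fun j x => ?_⟩
  have hv : ∀ k i, vcoef (B.unitsSMul w) x k i = coef (B.repr x i) (k - ⌊s * (i : ℕ)⌋) := by
    intro k i
    rw [vcoef, Module.Basis.repr_unitsSMul, Units.smul_def, hw, smul_eq_mul, coef_monomial_mul,
      one_mul]
  constructor
  · intro h i k hk
    have h1 := Int.floor_le (s * (i : ℕ))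
    have h2 : ((k + ⌊s * (i : ℕ)⌋ : ℤ) : ℚ) < j := by push_cast; linarith
    have := congrFun (h (k + ⌊s * (i : ℕ)⌋) (by exact_mod_cast h2)) i
    rwa [hv, add_sub_cancel_right] at this
  · intro h k hk
    funext i
    rw [hv]
    refine h i _ ?_
    have h1 := Int.lt_floor_add_one (s * (i : ℕ))
    have h2 : (k : ℚ) + 1 ≤ j := by exact_mod_cast hk
    push_cast
    linarith

/-- `Φ` shifts weights by exactly `s = t/n`, so `T = z^(-t) Φ^n` shifts them by `n s - t = 0` and is
an automorphism of the lattice. -/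
theorem eq_top_of_isPresentedBy (hτ : 0 < τ.im) (hΦ : Function.Injective Φ) {L : Polynomial K}
    (hL : IsPresentedBy Φ L) (hd : 0 < L.natDegree) (hs : ∀ s', IsSlope L s' → s' = s) {t : ℤ}
    {n : ℕ} (hn : n ≠ 0) (hst : s = t / n) (P : Submodule K M)
    (hP : ∀ μ : ℂ, μ ≠ 0 → ∀ x ∈ (opT Φ t n).maxGenEigenspace μ, x ∈ P) : P = ⊤ := by
  obtain ⟨hmon, h0, e, hli, hspan, hrel⟩ := hL
  obtain ⟨hA, hB⟩ := newton_of_unique_slope hmon h0 hd hs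
  let B := Module.Basis.mk hli hspan.ge
  have hBe : ∀ i : Fin L.natDegree, B i = (cEnd Φ ^ (i : ℕ)) e := fun i => by
    rw [Module.Basis.mk_apply, cEnd_pow_apply]
  have ha : ∀ k ≤ L.natDegree, Vanishes (s * (L.natDegree - k)) (L.coeff k) := by
    intro k _
    by_cases hk : L.coeff k = 0
    · rw [hk]
      exact vanishes_zero _
    · exact vanishes_of_le_ord (hB k (Polynomial.mem_support_iff.2 hk))
  have ha0' : Vanishes (-(s * L.natDegree)) (L.coeff 0)⁻¹ := by
    refine vanishes_of_le_ord ?_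
    rw [ord_inv h0]
    push_cast
    rw [hA]
  have hrel' : ∑ i ∈ Finset.range (L.natDegree + 1), L.coeff i • (cEnd Φ ^ i) e = 0 := by
    simpa only [cEnd_pow_apply] using hrel
  have hpow : ∀ (i : ℕ) (r : ℚ) (x : M),
      InWeight B s r x ↔ InWeight B s (r + s * i) ((cEnd Φ ^ i) x) := by
    intro i
    induction i with
    | zero => simp
    | succ i ih =>
      intro r x
      rw [ih, pow_succ', Module.End.mul_apply, cEnd_apply,
        show r + s * ((i + 1 : ℕ) : ℚ) = r + s * i + s by push_cast; ring]
      exact ⟨inWeight_apply hBe hmon.coeff_natDegree hrel' ha,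
        inWeight_of_apply hΦ hBe hmon.coeff_natDegree hrel' ha h0 ha0'⟩
  have hT : ∀ (r : ℚ) (x : M), InWeight B s r x ↔ InWeight B s r (opT Φ t n x) := by
    intro r x
    rw [hpow n, opT_apply, inWeight_monomial_smul, hst,
      div_mul_cancel₀ _ (by exact_mod_cast hn)]
    push_cast
    rw [sub_neg_eq_add]
  obtain ⟨b, hb⟩ := exists_lattice_basis B s
  refine eq_top_of_genEigenvectors_mem (b := b) (opT_smul Φ t n) (fun x hx => ?_) ?_
    (fun x _ hx => ?_) P hP
  · rw [hb] at hx ⊢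
    exact (hT _ _).1 hx
  · rw [Units.val_pow_eq_pow_val, norm_pow]
    exact pow_lt_one₀ (norm_nonneg _) (norm_qpow_lt_one hτ) hn
  · rw [hb] at hx ⊢
    exact (hT _ _).2 hx

end Weight

/-! ### Modules generated by a Jordan chain -/

section Jordan

variable {τ : ℂ} {M : Type*} [AddCommGroup M] [Module K M] [Module ℂ M] [IsScalarTower ℂ K M]
  {N : Type*} [AddCommGroup N] [Module K N] [Module ℂ N] [IsScalarTower ℂ K N]

/-- The vectors `Φ^i (T - λ)^j v` for `T = z^(-t) Φ^n`. -/
def jordanVec (Φ : M →ₛₗ[φ τ] M) (t : ℤ) (n : ℕ) (lam : ℂ) (v : M) (i j : ℕ) : M :=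
  (cEnd Φ ^ i) ((sh (opT Φ t n) lam ^ j) v)

/-- `v` is killed by `(T - λ)^m`, where `T = z^(-t) Φ^n`, and the vectors `Φ^i (T - λ)^j v` with
`i < n` and `j < m` are a basis. -/
structure IsJordanGenerator (Φ : M →ₛₗ[φ τ] M) (t : ℤ) (n : ℕ) (lam : ℂ) (m : ℕ) (v : M) : Prop where
  pow_eq_zero : (sh (opT Φ t n) lam ^ m) v = 0
  linearIndependent :
    LinearIndependent K fun ij : Fin n × Fin m => jordanVec Φ t n lam v ij.1 ij.2
  span_eq_top :
    Submodule.span K (Set.range fun ij : Fin n × Fin m => jordanVec Φ t n lam v ij.1 ij.2) = ⊤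

section Transport

variable {Φ : M →ₛₗ[φ τ] M} {Ψ : N →ₛₗ[φ τ] N} {t : ℤ} {n : ℕ} {lam : ℂ} {m : ℕ} {v : M}

theorem map_jordanVec {e : M ≃ₗ[K] N} (he : ∀ x, e (Φ x) = Ψ (e x)) (i j : ℕ) :
    e (jordanVec Φ t n lam v i j) = jordanVec Ψ t n lam (e v) i j := by
  have h1 : ∀ (i : ℕ) (x : M), e ((cEnd Φ ^ i) x) = (cEnd Ψ ^ i) (e x) := by
    intro i
    induction i with
    | zero => exact fun x => rfl
    | succ i ih =>
      intro x
      rw [pow_succ', pow_succ', Module.End.mul_apply, Module.End.mul_apply, cEnd_apply, he, ih,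
        cEnd_apply]
  have hC : ∀ (c : ℂ) (x : M), e (c • x) = c • e x := fun c x => by
    rw [← algebraMap_smul K c x, map_smul, algebraMap_smul]
  have h2 : ∀ (j : ℕ) (x : M),
      e ((sh (opT Φ t n) lam ^ j) x) = (sh (opT Ψ t n) lam ^ j) (e x) := by
    intro j
    induction j with
    | zero => exact fun x => rfl
    | succ j ih =>
      intro x
      rw [pow_succ', pow_succ', Module.End.mul_apply, Module.End.mul_apply, sh_apply, sh_apply,
        map_sub, hC, opT_apply, map_smul, h1, ih, opT_apply]
  rw [jordanVec, jordanVec, h1, h2]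

theorem IsJordanGenerator.map {e : M ≃ₗ[K] N} (he : ∀ x, e (Φ x) = Ψ (e x))
    (h : IsJordanGenerator Φ t n lam m v) : IsJordanGenerator Ψ t n lam m (e v) where
  pow_eq_zero := by
    have := map_jordanVec (t := t) (n := n) (lam := lam) (v := v) he 0 m
    rw [jordanVec, jordanVec, h.pow_eq_zero, map_zero, map_zero] at this
    simpa using this.symm
  linearIndependent := by
    have := h.linearIndependent.map' (e : M →ₗ[K] N) e.ker
    rwa [show ((e : M →ₗ[K] N) ∘ fun ij : Fin n × Fin m => jordanVec Φ t n lam v ij.1 ij.2) =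
      fun ij : Fin n × Fin m => jordanVec Ψ t n lam (e v) ij.1 ij.2 from
      funext fun ij => map_jordanVec he _ _] at this
  span_eq_top := by
    have := congrArg (Submodule.map (e : M →ₗ[K] N)) h.span_eq_top
    rw [Submodule.map_span, ← Set.range_comp, Submodule.map_top, LinearEquiv.range] at this
    rw [← this]
    congr 2
    funext ij
    exact (map_jordanVec he _ _).symm

end Transport

variable {Φ : M →ₛₗ[φ τ] M} {t : ℤ} {n : ℕ} {lam : ℂ} {m : ℕ} {v : M}

theorem cEnd_jordanVec (i j : ℕ) :
    Φ (jordanVec Φ t n lam v i j) = jordanVec Φ t n lam v (i + 1) j := by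
  rw [jordanVec, jordanVec, pow_succ', Module.End.mul_apply, cEnd_apply]

theorem sh_succ_apply (T : Module.End ℂ M) (j : ℕ) :
    T ((sh T lam ^ j) v) = (sh T lam ^ (j + 1)) v + lam • (sh T lam ^ j) v := by
  rw [pow_succ', Module.End.mul_apply, sh_apply, sub_add_cancel]

theorem jordanVec_last (j : ℕ) : jordanVec Φ t n lam v n j =
    monomial t (1 : ℂ) • (jordanVec Φ t n lam v 0 (j + 1) + lam • jordanVec Φ t n lam v 0 j) := by
  simp only [jordanVec, pow_zero, Module.End.one_apply]
  rw [cEnd_pow_eq_smul_opT Φ t n, sh_succ_apply]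

theorem opT_jordanVec (i j : ℕ) : opT Φ t n (jordanVec Φ t n lam v i j) =
    (qpow τ 1 : ℂ) ^ (t * i) • (jordanVec Φ t n lam v i (j + 1) +
      lam • jordanVec Φ t n lam v i j) := by
  simp only [jordanVec]
  rw [opT_cEnd_pow, sh_succ_apply, map_add, map_smul (cEnd Φ ^ i)]

theorem IsDifferenceSubmodule.cEnd_pow_mem {V : Submodule K M} (hV : IsDifferenceSubmodule Φ V)
    (i : ℕ) {x : M} (hx : x ∈ V) : (cEnd Φ ^ i) x ∈ V := by
  induction i with
  | zero => exact hx
  | succ i ih =>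
    rw [pow_succ', Module.End.mul_apply]
    exact (hV _).2 ih

theorem IsDifferenceSubmodule.sh_pow_mem {V : Submodule K M} (hV : IsDifferenceSubmodule Φ V)
    (j : ℕ) {x : M} (hx : x ∈ V) : (sh (opT Φ t n) lam ^ j) x ∈ V := by
  induction j with
  | zero => exact hx
  | succ j ih =>
    rw [pow_succ', Module.End.mul_apply, sh_apply, opT_apply, ← algebraMap_smul K lam]
    exact V.sub_mem (V.smul_mem _ (hV.cEnd_pow_mem _ ih)) (V.smul_mem _ ih)

namespace IsJordanGenerator

variable (h : IsJordanGenerator Φ t n lam m v)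
include h

theorem jordanVec_eq_zero (i : ℕ) {j : ℕ} (hj : m ≤ j) : jordanVec Φ t n lam v i j = 0 := by
  obtain ⟨k, rfl⟩ := Nat.exists_eq_add_of_le' hj
  rw [jordanVec, pow_add, Module.End.mul_apply, h.pow_eq_zero, map_zero, map_zero]

/-- The basis `Φ^i (T - λ)^j v`. -/
def basis : Module.Basis (Fin n × Fin m) K M :=
  Module.Basis.mk h.linearIndependent h.span_eq_top.ge

theorem basis_apply (ij : Fin n × Fin m) : h.basis ij = jordanVec Φ t n lam v ij.1 ij.2 :=
  Module.Basis.mk_apply _ _ _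

theorem finrank_eq : Module.finrank K M = n * m := by
  rw [Module.finrank_eq_card_basis h.basis, Fintype.card_prod, Fintype.card_fin, Fintype.card_fin]

theorem repr_jordanVec (i : Fin n) (j : ℕ) (k : Fin n × Fin m) :
    h.basis.repr (jordanVec Φ t n lam v i j) k = if i = k.1 ∧ j = k.2 then 1 else 0 := by
  classical
  rcases lt_or_ge j m with hj | hj
  · rw [← h.basis_apply (i, ⟨j, hj⟩), h.basis.repr_self, Finsupp.single_apply]
    simp [Prod.ext_iff, Fin.ext_iff]
  · rw [h.jordanVec_eq_zero _ hj, map_zero, if_neg]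
    · rfl
    · rintro ⟨-, h⟩
      have := k.2.2
      omega

/-- The coordinates with fixed `i` form a block on which `T` is the scalar `q^(t i)` times a Jordan
block, composed with the dilation. -/
theorem repr_opT (x : M) (i : Fin n) (j : Fin m) : h.basis.repr (opT Φ t n x) (i, j) =
    (qpow τ 1 : ℂ) ^ (t * (i : ℕ)) • (lam • dilate (qpow τ 1 ^ n) (h.basis.repr x (i, j)) +
      ∑ l : Fin m, if (l : ℕ) + 1 = j then dilate (qpow τ 1 ^ n) (h.basis.repr x (i, l)) else 0) := by
  classical
  rw [repr_apply (opT_smul Φ t n), Fintype.sum_prod_type, Finset.sum_eq_single i]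
  · have : ∀ l : Fin m, h.basis.repr (opT Φ t n (h.basis (i, l))) (i, j) =
        (qpow τ 1 : ℂ) ^ (t * (i : ℕ)) • ((if (l : ℕ) + 1 = j then 1 else 0) +
          lam • if l = j then 1 else 0) := by
      intro l
      rw [h.basis_apply, opT_jordanVec, ← algebraMap_smul K, ← algebraMap_smul K lam, map_smul,
        map_add, map_smul, Finsupp.smul_apply, Finsupp.add_apply, Finsupp.smul_apply,
        h.repr_jordanVec, h.repr_jordanVec, algebraMap_smul, algebraMap_smul]
      simp only [true_and, Fin.ext_iff]
    simp only [this]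
    simp only [smul_mul_assoc, add_mul, ite_mul, one_mul, zero_mul, Finset.smul_sum, smul_add,
      Finset.sum_add_distrib, smul_ite, smul_zero]
    rw [add_comm]
    congr 1
    rw [Finset.sum_ite_eq' Finset.univ j]
    simp
  · intro i' _ hi'
    refine Finset.sum_eq_zero fun l _ => ?_
    rw [h.basis_apply, opT_jordanVec, ← algebraMap_smul K, ← algebraMap_smul K lam, map_smul,
      map_add, map_smul, Finsupp.smul_apply, Finsupp.add_apply, Finsupp.smul_apply,
      h.repr_jordanVec, h.repr_jordanVec]
    simp [hi']
  · intro h; exact absurd (Finset.mem_univ _) h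

theorem ne_zero (hn : 0 < n) (hm : 0 < m) : v ≠ 0 := by
  rintro rfl
  refine h.linearIndependent.ne_zero (⟨0, hn⟩, ⟨0, hm⟩) ?_
  simp [jordanVec]

theorem pow_pred_ne_zero (hn : 0 < n) (hm : 0 < m) : (sh (opT Φ t n) lam ^ (m - 1)) v ≠ 0 := by
  have := h.linearIndependent.ne_zero (⟨0, hn⟩, ⟨m - 1, by omega⟩)
  simpa [jordanVec] using this

/-- Modules generated by Jordan chains with the same data are isomorphic. -/
theorem iso {Ψ : N →ₛₗ[φ τ] N} {w : N} (h' : IsJordanGenerator Ψ t n lam m w) : Iso Φ Ψ := by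
  let e := h.basis.equiv h'.basis (Equiv.refl _)
  have he : ∀ (i : Fin n) (j : ℕ), e (jordanVec Φ t n lam v i j) = jordanVec Ψ t n lam w i j := by
    intro i j
    rcases lt_or_ge j m with hj | hj
    · have := h.basis.equiv_apply (i, ⟨j, hj⟩) h'.basis (Equiv.refl _)
      rwa [basis_apply, Equiv.refl_apply, basis_apply] at this
    · rw [h.jordanVec_eq_zero _ hj, h'.jordanVec_eq_zero _ hj, map_zero]
  refine ⟨e, fun x => ?_⟩
  rw [← h.basis.sum_repr x]
  simp only [map_sum, map_smulₛₗ, RingHom.id_apply]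
  refine Finset.sum_congr rfl fun ij _ => ?_
  congr 1
  obtain ⟨i, j⟩ := ij
  rw [h.basis_apply, he, cEnd_jordanVec, cEnd_jordanVec]
  rcases lt_or_eq_of_le (Nat.succ_le_of_lt i.2) with hi | hi
  · exact he ⟨i + 1, hi⟩ j
  · have hn : 0 < n := i.pos
    rw [show (i : ℕ) + 1 = n from hi, jordanVec_last, jordanVec_last, map_smul, map_add]
    have hC : ∀ (c : ℂ) (x : M), e (c • x) = c • e x := fun c x => by
      rw [← algebraMap_smul K c x, map_smul, algebraMap_smul]
    have h0 : ∀ j, e (jordanVec Φ t n lam v 0 j) = jordanVec Ψ t n lam w 0 j := he ⟨0, hn⟩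
    rw [hC, h0, h0]

/-- The generalized eigenspace of the generator. -/
theorem eq_sum_of_pow_eq_zero (hτ : 0 < τ.im) (hcop : IsCoprime t (n : ℤ)) (hlam : lam ≠ 0)
    (hn : 0 < n) {k : ℕ} {x : M} (hx : (sh (opT Φ t n) lam ^ k) x = 0) :
    ∃ a : Fin m → ℂ, x = ∑ j : Fin m, a j • (sh (opT Φ t n) lam ^ (j : ℕ)) v := by
  -- On the coefficient of `z^k` in block `i`, the diagonal entry of `T - λ` is `λ (q^(t i + n k) -
  -- 1)`. By coprimality it vanishes only for `i = 0`, `k = 0`; elsewhere the triangular system in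
  -- `j` is solved from the bottom.
  have step : ∀ x : M,
      (∀ (i : Fin n) j k, ¬ ((i : ℕ) = 0 ∧ k = 0) → coef (h.basis.repr (sh (opT Φ t n) lam x) (i, j)) k = 0) →
      ∀ (i : Fin n) j k, ¬ ((i : ℕ) = 0 ∧ k = 0) → coef (h.basis.repr x (i, j)) k = 0 := by
    intro x hx i j k hik
    obtain ⟨j, hj⟩ := j
    induction j using Nat.strong_induction_on with
    | _ j ih =>
      have h1 := hx i ⟨j, hj⟩ k hik
      rw [sh_apply, ← algebraMap_smul K lam x, map_sub, map_smul, Finsupp.sub_apply,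
        Finsupp.smul_apply, algebraMap_smul, h.repr_opT, coef_sub, coef_smul, coef_add, coef_sum,
        Finset.sum_eq_zero] at h1
      · rw [coef_smul, coef_dilate, add_zero, coef_smul, Units.val_pow_eq_pow_val, ← zpow_natCast,
          ← zpow_mul] at h1
        have h2 : lam * ((qpow τ 1 : ℂ) ^ (t * (i : ℕ) + n * k) - 1) *
            coef (h.basis.repr x (i, ⟨j, hj⟩)) k = 0 := by
          rw [zpow_add₀ (Units.ne_zero _), ← h1]
          ring
        refine (mul_eq_zero.1 h2).resolve_left (mul_ne_zero hlam (sub_ne_zero.2 fun h3 => hik ?_))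
        have h4 := qpow_zpow_eq_one hτ h3
        have h5 : (n : ℤ) ∣ (i : ℕ) := by
          refine hcop.symm.dvd_of_dvd_mul_left ⟨-k, ?_⟩
          linarith
        have h6 : (i : ℕ) = 0 := Nat.eq_zero_of_dvd_of_lt (by exact_mod_cast h5) i.2
        refine ⟨h6, ?_⟩
        rw [h6] at h4
        simpa [hn.ne'] using h4
      · intro l _
        split_ifs with hl
        · rw [coef_dilate, ih l (by simp only at hl; omega) l.2, mul_zero]
        · rfl
  have hall : ∀ (i : Fin n) j l, ¬ ((i : ℕ) = 0 ∧ l = 0) → coef (h.basis.repr x (i, j)) l = 0 := by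
    induction k generalizing x with
    | zero =>
      rw [pow_zero, Module.End.one_apply] at hx
      intro i j l _
      rw [hx, map_zero]
      rfl
    | succ k ih =>
      rw [pow_succ, Module.End.mul_apply] at hx
      exact step x (ih hx)
  refine ⟨fun j => coef (h.basis.repr x (⟨0, hn⟩, j)) 0, ?_⟩
  conv_lhs => rw [← h.basis.sum_repr x]
  rw [Fintype.sum_prod_type, Finset.sum_eq_single ⟨0, hn⟩]
  · refine Finset.sum_congr rfl fun j _ => ?_
    rw [algebraMap_of_coef (f := h.basis.repr x (⟨0, hn⟩, j))
      fun k hk => hall _ _ _ fun hc => hk hc.2, algebraMap_smul, h.basis_apply]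
    rfl
  · intro i _ hi
    refine Finset.sum_eq_zero fun j _ => ?_
    have : h.basis.repr x (i, j) = 0 := coef_ext fun k =>
      hall i j k fun hc => hi (Fin.ext hc.1)
    rw [this, zero_smul]
  · intro h; exact absurd (Finset.mem_univ _) h

theorem eq_top_of_pow_mem {V : Submodule K M} (hV : IsDifferenceSubmodule Φ V)
    (hv : v ∈ V) : V = ⊤ := by
  rw [eq_top_iff, ← h.span_eq_top, Submodule.span_le]
  rintro _ ⟨ij, rfl⟩
  exact hV.cEnd_pow_mem _ (hV.sh_pow_mem _ hv)

/-- If `v = x + y` along a decomposition, both components lie in `ℂ[N]v`, a quotient of a local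
ring. One of them is a unit multiple of `v`, so its summand contains `v` and is everything. -/
theorem isIndecomposable (hτ : 0 < τ.im) (hcop : IsCoprime t (n : ℤ)) (hlam : lam ≠ 0)
    (hn : 0 < n) (hm : 0 < m) : IsIndecomposable Φ := by
  refine ⟨⟨v, 0, h.ne_zero hn hm⟩, fun V W hV hW hVW => ?_⟩
  set S := sh (opT Φ t n) lam with hS
  have hzero : ∀ j, m ≤ j → (S ^ j) v = 0 := fun j hj => by
    have := h.jordanVec_eq_zero 0 hj
    simpa [jordanVec] using this
  have hne := h.pow_pred_ne_zero hn hm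
  obtain ⟨x, hx, y, hy, hxy⟩ := Submodule.mem_sup.1
    (show v ∈ V ⊔ W by rw [hVW.sup_eq_top]; exact Submodule.mem_top)
  have hsum0 : (S ^ m) x + (S ^ m) y = 0 := by rw [← map_add, hxy, hzero m le_rfl]
  have hx0 : (S ^ m) x = 0 := by
    refine Submodule.disjoint_def.1 hVW.disjoint _ (hV.sh_pow_mem m hx) ?_
    rw [eq_neg_of_add_eq_zero_left hsum0]
    exact W.neg_mem (hW.sh_pow_mem m hy)
  have hy0 : (S ^ m) y = 0 := by rwa [hx0, zero_add] at hsum0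
  obtain ⟨a, ha⟩ := h.eq_sum_of_pow_eq_zero hτ hcop hlam hn hx0
  obtain ⟨c, hc⟩ := h.eq_sum_of_pow_eq_zero hτ hcop hlam hn hy0
  -- a vector with nonzero leading coefficient generates
  have hgen : ∀ (V : Submodule K M), IsDifferenceSubmodule Φ V → ∀ (a : Fin m → ℂ),
      (∑ j : Fin m, a j • (S ^ (j : ℕ)) v) ∈ V → a ⟨0, hm⟩ ≠ 0 → ∀ j ≤ m, (S ^ (m - j)) v ∈ V := by
    intro V hV a hx ha0 j
    have hCsmul : ∀ (c : ℂ), ∀ x ∈ V, c • x ∈ V := fun c x hx => by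
      rw [← algebraMap_smul K c]
      exact V.smul_mem _ hx
    induction j using Nat.strong_induction_on with
    | _ j ih =>
      intro hj
      have h1 := hV.sh_pow_mem (t := t) (n := n) (lam := lam) (m - j) hx
      rw [map_sum, ← Finset.add_sum_erase _ _ (Finset.mem_univ (⟨0, hm⟩ : Fin m))] at h1
      have h2 : (∑ l ∈ Finset.univ.erase (⟨0, hm⟩ : Fin m),
          (S ^ (m - j)) (a l • (S ^ (l : ℕ)) v)) ∈ V := by
        refine V.sum_mem fun l hl => ?_
        have hl : (l : ℕ) ≠ 0 := fun hl0 => (Finset.mem_erase.1 hl).1 (Fin.ext hl0)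
        rw [map_smul, ← Module.End.mul_apply, ← pow_add]
        refine hCsmul _ _ ?_
        rcases lt_or_ge (l : ℕ) j with hlj | hlj
        · rw [show m - j + l = m - (j - l) by omega]
          exact ih (j - l) (by omega) (by omega)
        · rw [hzero _ (by omega)]
          exact V.zero_mem
      have h3 := (Submodule.add_mem_iff_left V h2).1 h1
      rw [map_smul] at h3
      have h4 := hCsmul (a ⟨0, hm⟩)⁻¹ _ h3
      rw [smul_smul, inv_mul_cancel₀ ha0, one_smul] at h4
      simpa using h4
  by_cases ha0 : a ⟨0, hm⟩ = 0
  · by_cases hc0 : c ⟨0, hm⟩ = 0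
    -- With both constant terms zero, `N^(m-1)` would kill `x + y = v`.
    · exfalso
      have hkill : ∀ a : Fin m → ℂ, a ⟨0, hm⟩ = 0 →
          (S ^ (m - 1)) (∑ j : Fin m, a j • (S ^ (j : ℕ)) v) = 0 := by
        intro a ha0
        rw [map_sum]
        refine Finset.sum_eq_zero fun j _ => ?_
        rw [map_smul, ← Module.End.mul_apply, ← pow_add]
        rcases Nat.eq_zero_or_pos j with hj | hj
        · rw [show j = ⟨0, hm⟩ from Fin.ext hj, ha0, zero_smul]
        · rw [hzero _ (by omega), smul_zero]
      refine hne ?_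
      rw [← hxy, map_add, ha, hc, hkill a ha0, hkill c hc0, add_zero]
    · right
      have := hgen W hW c (hc ▸ hy) hc0 m le_rfl
      rw [Nat.sub_self] at this
      exact h.eq_top_of_pow_mem hW this
  · left
    have := hgen V hV a (ha ▸ hx) ha0 m le_rfl
    rw [Nat.sub_self] at this
    exact h.eq_top_of_pow_mem hV this

theorem exists_minimal_coordinate {u : M} (hu : u ≠ 0) : ∃ (i : Fin n) (j : Fin m),
    h.basis.repr u (i, j) ≠ 0 ∧ ∀ l < j, h.basis.repr u (i, l) = 0 := by
  have hne : ∃ ij, h.basis.repr u ij ≠ 0 := by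
    by_contra! hall
    exact hu (h.basis.ext_elem fun ij => by rw [hall ij, map_zero]; rfl)
  obtain ⟨⟨i, j⟩, hij⟩ := hne
  induction j using WellFoundedLT.induction with
  | _ j ih =>
    by_cases hl : ∃ l < j, h.basis.repr u (i, l) ≠ 0
    · obtain ⟨l, hlj, hl⟩ := hl
      exact ih l hlj hl
    · push Not at hl
      exact ⟨i, j, hij, hl⟩

/-- `T` is triangular in `j`, so the first nonzero coordinate of a block is only scaled and dilated.
In particular its order at `z = 0` is preserved. -/
theorem repr_opT_pow {u : M} {i : Fin n} {j : Fin m} (hu : ∀ l < j, h.basis.repr u (i, l) = 0)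
    (k : ℕ) : (∀ l < j, h.basis.repr ((opT Φ t n ^ k) u) (i, l) = 0) ∧
      h.basis.repr ((opT Φ t n ^ k) u) (i, j) = ((qpow τ 1 : ℂ) ^ (t * (i : ℕ)) * lam) ^ k •
        dilate ((qpow τ 1 ^ n) ^ k) (h.basis.repr u (i, j)) := by
  induction k with
  | zero =>
    refine ⟨hu, ?_⟩
    rw [pow_zero, pow_zero, pow_zero, one_smul, dilate_one]
    rfl
  | succ k ih =>
    have hs : ∀ l ≤ j, (∑ l' : Fin m, if (l' : ℕ) + 1 = l then
        dilate (qpow τ 1 ^ n) (h.basis.repr ((opT Φ t n ^ k) u) (i, l')) else 0) = 0 := by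
      intro l hl
      refine Finset.sum_eq_zero fun l' _ => ?_
      split_ifs with h'
      · rw [ih.1 l' (lt_of_lt_of_le (Fin.lt_def.2 (by omega)) hl), map_zero]
      · rfl
    rw [pow_succ', Module.End.mul_apply]
    refine ⟨fun l hl => ?_, ?_⟩
    · rw [h.repr_opT, hs l hl.le, ih.1 l hl, map_zero, smul_zero, add_zero, smul_zero]
    · rw [h.repr_opT, hs j le_rfl, add_zero, ih.2, dilate_smul, dilate_dilate, smul_smul, smul_smul,
        ← pow_succ' (qpow τ 1 ^ n),
        ← pow_succ' ((qpow τ 1 : ℂ) ^ (t * (i : ℕ)) * lam)]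

/-- The eigenvalues of `T`. -/
theorem exists_eigenvalue_eq {μ : ℂ} {u : M} (hu : u ≠ 0) (hTu : opT Φ t n u = μ • u) :
    ∃ k : ℤ, μ = (qpow τ 1 : ℂ) ^ k * lam := by
  obtain ⟨i, j, hij, hmin⟩ := h.exists_minimal_coordinate hu
  have h1 := (h.repr_opT_pow hmin 1).2
  rw [pow_one, hTu, pow_one, pow_one, ← algebraMap_smul K μ, map_smul, Finsupp.smul_apply,
    algebraMap_smul] at h1
  -- The lowest nonzero coefficient of this coordinate determines `μ`.
  have h2 := congrArg (coef · (ord (h.basis.repr u (i, j)))) h1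
  simp only [coef_smul, coef_dilate] at h2
  refine ⟨t * (i : ℕ) + n * ord (h.basis.repr u (i, j)), ?_⟩
  refine mul_right_cancel₀ (coef_ord_ne_zero hij) ?_
  rw [h2, zpow_add₀ (Units.ne_zero _), zpow_mul _ (n : ℤ), zpow_natCast, Units.val_pow_eq_pow_val]
  ring

/-- Two modules generated by Jordan chains which are isomorphic have the same slope. -/
theorem slope_eq {t' : ℤ} {n' : ℕ} {lam' : ℂ} {m' : ℕ} {v' : M}
    (h' : IsJordanGenerator Φ t' n' lam' m' v') (hlam : lam ≠ 0) (hlam' : lam' ≠ 0)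
    (hn' : 0 < n') (hm' : 0 < m') : t * n' = t' * n := by
  set u := (sh (opT Φ t' n') lam' ^ (m' - 1)) v' with hu_def
  have hu : u ≠ 0 := h'.pow_pred_ne_zero hn' hm'
  have hTu : opT Φ t' n' u = lam' • u := by
    have := sh_succ_apply (lam := lam') (v := v') (opT Φ t' n') (m' - 1)
    rwa [Nat.sub_add_cancel hm', h'.pow_eq_zero, zero_add, ← hu_def] at this
  have hTu' : ∀ k : ℕ, (opT Φ t' n' ^ k) u = lam' ^ k • u := by
    intro k
    induction k with
    | zero => simp
    | succ k ih =>
      rw [pow_succ', Module.End.mul_apply, ih, map_smul, hTu, smul_smul, pow_succ]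
  obtain ⟨γ, hγ, -, hpow⟩ := exists_opT_pow Φ t n
  obtain ⟨γ', hγ', -, hpow'⟩ := exists_opT_pow Φ t' n'
  -- An eigenvector `u` of the second operator makes `Φ^(n n')` act by a monomial of exponent `t'
  -- n`, so `T^(n')` acts on `u` by one of exponent `t' n - t n'`. Since `T^(n')` preserves the
  -- order of a coordinate, this exponent is `0`.
  have e1 : (cEnd Φ ^ (n * n')) u = monomial (t' * n) (lam' ^ n / γ' n) • u := by
    have h1 := hpow' n u
    rw [hTu' n] at h1
    have h2 := congrArg (monomial (t' * n) ((γ' n)⁻¹) • ·) h1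
    simp only [smul_smul] at h2
    rw [monomial_mul_monomial, add_neg_cancel, inv_mul_cancel₀ (hγ' n), monomial_zero_one, one_smul,
      mul_comm n' n] at h2
    rw [← h2, ← algebraMap_smul K (lam' ^ n) u, smul_smul, algebraMap_eq, monomial_mul_monomial, add_zero,
      div_eq_mul_inv, mul_comm (lam' ^ n)]
  have e2 : (opT Φ t n ^ n') u =
      monomial (-(t * n') + t' * n) (γ n' * (lam' ^ n / γ' n)) • u := by
    rw [hpow, e1, smul_smul, monomial_mul_monomial]
  obtain ⟨i, j, hij, hmin⟩ := h.exists_minimal_coordinate hu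
  have h1 := (h.repr_opT_pow hmin n').2
  rw [e2, map_smul, Finsupp.smul_apply, smul_eq_mul] at h1
  set f := h.basis.repr u (i, j) with hf
  have h2 : ∀ k, γ n' * (lam' ^ n / γ' n) * coef f (k - (-(t * n') + t' * n)) =
      ((qpow τ 1 : ℂ) ^ (t * (i : ℕ)) * lam) ^ n' *
        ((((qpow τ 1 ^ n) ^ n' : ℂˣ) : ℂ) ^ k * coef f k) := by
    intro k
    have := congrArg (coef · k) h1
    simpa only [coef_monomial_mul, coef_smul, coef_dilate] using this
  have hc : γ n' * (lam' ^ n / γ' n) ≠ 0 :=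
    mul_ne_zero (hγ _) (div_ne_zero (pow_ne_zero _ hlam') (hγ' _))
  have hord := coef_ord_ne_zero hij
  have hle : -(t * n') + t' * n ≥ 0 := by
    by_contra hlt
    push Not at hlt
    have h3 := h2 (ord f + (-(t * n') + t' * n))
    rw [add_sub_cancel_right, coef_of_lt_ord (k := ord f + (-(t * n') + t' * n)) (by linarith),
      mul_zero, mul_zero] at h3
    exact mul_ne_zero hc hord h3
  have hge : -(t * n') + t' * n ≤ 0 := by
    by_contra hlt
    push Not at hlt
    have h3 := h2 (ord f)
    rw [coef_of_lt_ord (k := ord f - (-(t * n') + t' * n)) (by linarith), mul_zero] at h3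
    exact mul_ne_zero (pow_ne_zero _ (mul_ne_zero (zpow_ne_zero _ (Units.ne_zero _)) hlam))
      (mul_ne_zero (zpow_ne_zero _ (Units.ne_zero _)) hord) h3.symm
  linarith

end IsJordanGenerator

end Jordan

/-! ### Purity of modules generated by a Jordan chain. -/

section Pure

variable {τ : ℂ} {M : Type*} [AddCommGroup M] [Module K M] [Module ℂ M] [IsScalarTower ℂ K M]

/-- The polynomial `∑ ε_k z^(t (m - k)) X^(n k)`, `0 ≤ k ≤ m`. -/
def chainPoly (t : ℤ) (n m : ℕ) (ε : ℕ → ℂ) : Polynomial K :=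
  ∑ k ∈ Finset.range (m + 1), Polynomial.monomial (n * k) (monomial (t * m - t * k) (ε k))

variable {t : ℤ} {n m : ℕ} {ε : ℕ → ℂ}

theorem coeff_chainPoly_mul (hn : 0 < n) {k : ℕ} (hk : k ≤ m) :
    (chainPoly t n m ε).coeff (n * k) = monomial (t * m - t * k) (ε k) := by
  rw [chainPoly, Polynomial.finsetSum_coeff, Finset.sum_eq_single k]
  · rw [Polynomial.coeff_monomial, if_pos rfl]
  · intro l _ hl
    rw [Polynomial.coeff_monomial, if_neg fun h => hl (Nat.eq_of_mul_eq_mul_left hn h)]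
  · intro h
    exact absurd (Finset.mem_range.2 (by omega)) h

theorem exists_of_coeff_chainPoly_ne_zero {i : ℕ} (hi : (chainPoly t n m ε).coeff i ≠ 0) :
    ∃ k ≤ m, i = n * k := by
  by_contra! hne
  refine hi ?_
  rw [chainPoly, Polynomial.finsetSum_coeff]
  refine Finset.sum_eq_zero fun k hk => ?_
  rw [Polynomial.coeff_monomial, if_neg fun h => hne k (by have := Finset.mem_range.1 hk; omega) h.symm]

theorem natDegree_chainPoly (hn : 0 < n) (hε : ∀ k ≤ m, ε k ≠ 0) :
    (chainPoly t n m ε).natDegree = n * m := by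
  refine Polynomial.natDegree_eq_of_le_of_coeff_ne_zero ?_ ?_
  · rw [Polynomial.natDegree_le_iff_coeff_eq_zero]
    intro i hi
    by_contra hne
    obtain ⟨k, hk, rfl⟩ := exists_of_coeff_chainPoly_ne_zero hne
    exact absurd (Nat.mul_le_mul_left n hk) (by omega)
  · rw [coeff_chainPoly_mul hn le_rfl]
    exact monomial_ne_zero _ (hε m le_rfl)

/-- The Newton points are `(n k, t (m - k))`, all on one line. -/
theorem isSlope_chainPoly_iff (hn : 0 < n) (hm : 0 < m) (hε : ∀ k ≤ m, ε k ≠ 0) (s : ℚ) :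
    IsSlope (chainPoly t n m ε) s ↔ s = t / n := by
  have hnQ : (n : ℚ) ≠ 0 := by exact_mod_cast hn.ne'
  have hord : ∀ k ≤ m, ord ((chainPoly t n m ε).coeff (n * k)) = t * m - t * k := fun k hk => by
    rw [coeff_chainPoly_mul hn hk, ord_monomial _ (hε k hk)]
  have hsup : ∀ k ≤ m, n * k ∈ (chainPoly t n m ε).support := fun k hk => by
    rw [Polynomial.mem_support_iff, coeff_chainPoly_mul hn hk]
    exact monomial_ne_zero _ (hε k hk)
  constructor
  · rintro ⟨i, hi, j, hj, hij, heq, -⟩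
    obtain ⟨k, hk, rfl⟩ := exists_of_coeff_chainPoly_ne_zero (Polynomial.mem_support_iff.1 hi)
    obtain ⟨l, hl, rfl⟩ := exists_of_coeff_chainPoly_ne_zero (Polynomial.mem_support_iff.1 hj)
    rw [hord k hk, hord l hl] at heq
    have hkl : k < l := lt_of_mul_lt_mul_left hij (Nat.zero_le n)
    have hkl' : (l : ℚ) - k ≠ 0 := sub_ne_zero.2 (by exact_mod_cast hkl.ne')
    push_cast at heq
    rw [eq_div_iff hnQ]
    refine mul_right_cancel₀ hkl' ?_
    linarith
  · rintro rfl
    have hline : ∀ k ≤ m, ((ord ((chainPoly t n m ε).coeff (n * k)) : ℤ) : ℚ) +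
        t / n * ((n * k : ℕ) : ℚ) = t * m := fun k hk => by
      rw [hord k hk]
      push_cast
      field_simp
      ring
    refine ⟨n * 0, hsup 0 (Nat.zero_le m), n * m, hsup m le_rfl, Nat.mul_lt_mul_of_pos_left hm hn,
      ?_, fun i hi => ?_⟩
    · rw [hline 0 (Nat.zero_le m), hline m le_rfl]
    · obtain ⟨k, hk, rfl⟩ := exists_of_coeff_chainPoly_ne_zero (Polynomial.mem_support_iff.1 hi)
      rw [hline 0 (Nat.zero_le m), hline k hk]

variable {Φ : M →ₛₗ[φ τ] M} {lam : ℂ} {v : M}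

theorem sh_pow_eq_sum (T : Module.End ℂ M) (j : ℕ) (x : M) : (sh T lam ^ j) x =
    ∑ k ∈ Finset.range (j + 1), ((-lam) ^ (j - k) * (j.choose k : ℂ)) • (T ^ k) x := by
  have hc : Commute T ((-lam) • (1 : Module.End ℂ M)) := (Commute.one_right T).smul_right _
  rw [show sh T lam = T + (-lam) • 1 by rw [neg_smul, ← sub_eq_add_neg], hc.add_pow,
    LinearMap.sum_apply]
  refine Finset.sum_congr rfl fun k _ => ?_
  rw [smul_pow, one_pow, mul_smul_comm, mul_one, ← (Nat.cast_commute _ _).eq,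
    ← nsmul_eq_mul, LinearMap.smul_apply, LinearMap.smul_apply, ← Nat.cast_smul_eq_nsmul ℂ,
    smul_smul, mul_comm]

/-- `v` is a cyclic vector, and the binomial expansion of `(T - λ)^m v = 0`, multiplied by `z^(t
m)/γ_m`, is its monic equation. As `λ ≠ 0`, no coefficient of a power of `Φ^n` vanishes. -/
theorem IsJordanGenerator.isPure (h : IsJordanGenerator Φ t n lam m v) (hlam : lam ≠ 0)
    (hn : 0 < n) (hm : 0 < m) : IsPure Φ := by
  obtain ⟨γ, hγ, -, hpow⟩ := exists_opT_pow Φ t n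
  let ε : ℕ → ℂ := fun k => γ k * ((-lam) ^ (m - k) * (m.choose k : ℂ)) / γ m
  have hε : ∀ k ≤ m, ε k ≠ 0 := fun k hk => by
    refine div_ne_zero (mul_ne_zero (hγ k) (mul_ne_zero (pow_ne_zero _ (neg_ne_zero.2 hlam)) ?_))
      (hγ m)
    exact_mod_cast (Nat.choose_pos hk).ne'
  have hdeg := natDegree_chainPoly (t := t) hn hε
  refine ⟨chainPoly t n m ε, ⟨?_, ?_, v, ?_⟩, t / n,
    (isSlope_chainPoly_iff hn hm hε _).2 rfl, fun s hs => (isSlope_chainPoly_iff hn hm hε s).1 hs⟩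
  · rw [Polynomial.Monic, Polynomial.leadingCoeff, hdeg, coeff_chainPoly_mul hn le_rfl, sub_self]
    have : ε m = 1 := by
      simp [ε, hγ m]
    rw [this, monomial_zero_one]
  · have := coeff_chainPoly_mul (t := t) (ε := ε) hn (Nat.zero_le m)
    rw [mul_zero] at this
    rw [this]
    exact monomial_ne_zero _ (hε 0 (Nat.zero_le m))
  · rw [hdeg]
    set P := Submodule.span K (Set.range fun i : Fin (n * m) => Φ^[i] v) with hP
    -- `Φ^i T^k v` is a `K`-multiple of `Φ^(i + n k) v`, and `i + n k < n m`.
    have hmem : ∀ i < n, ∀ k < m, (cEnd Φ ^ i) ((opT Φ t n ^ k) v) ∈ P := by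
      intro i hi k hk
      rw [hpow, cEnd_pow_smul, ← Module.End.mul_apply, ← pow_add, cEnd_pow_apply]
      refine P.smul_mem _ (Submodule.subset_span ⟨⟨i + n * k, ?_⟩, rfl⟩)
      calc i + n * k < n + n * k := by omega
        _ = n * (k + 1) := by ring
        _ ≤ n * m := Nat.mul_le_mul_left n hk
    have htop : P = ⊤ := by
      rw [eq_top_iff, ← h.span_eq_top, Submodule.span_le]
      rintro _ ⟨⟨i, j⟩, rfl⟩
      change (cEnd Φ ^ (i : ℕ)) ((sh (opT Φ t n) lam ^ (j : ℕ)) v) ∈ P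
      rw [sh_pow_eq_sum, map_sum]
      refine P.sum_mem fun k hk => ?_
      have hk := Finset.mem_range.1 hk
      rw [map_smul, ← algebraMap_smul K]
      exact P.smul_mem _ (hmem i i.2 k (by omega))
    have hfin : Module.Finite K M := Module.Finite.of_basis h.basis
    refine ⟨?_, htop, ?_⟩
    · refine linearIndependent_of_top_le_span_of_card_eq_finrank htop.ge ?_
      rw [Fintype.card_fin, h.finrank_eq]
    · have h1 := h.pow_eq_zero
      rw [sh_pow_eq_sum] at h1
      have h2 : ∑ i ∈ Finset.range (n * m + 1), (chainPoly t n m ε).coeff i • Φ^[i] v =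
          ∑ k ∈ Finset.range (m + 1), monomial (t * m - t * k) (ε k) • Φ^[n * k] v := by
        symm
        refine Finset.sum_of_injOn (fun k => n * k) ?_ ?_ ?_ ?_
        · intro a _ b _ hab
          exact Nat.eq_of_mul_eq_mul_left hn hab
        · intro k hk
          have hk : k < m + 1 := by simpa using hk
          have := Nat.mul_le_mul_left n (Nat.lt_succ_iff.1 hk)
          simp only [Finset.coe_range, Set.mem_Iio]
          omega
        · intro i _ hi
          by_cases hz : (chainPoly t n m ε).coeff i = 0
          · rw [hz, zero_smul]
          · obtain ⟨k, hk, rfl⟩ := exists_of_coeff_chainPoly_ne_zero hz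
            exact absurd ⟨k, by simpa using Nat.lt_succ_iff.2 hk, rfl⟩ hi
        · intro k hk
          rw [coeff_chainPoly_mul hn (Nat.lt_succ_iff.1 (Finset.mem_range.1 hk))]
      rw [h2]
      have h3 := congrArg (monomial (t * m) ((γ m)⁻¹) • ·) h1
      simp only [smul_zero, Finset.smul_sum] at h3
      rw [← h3]
      refine Finset.sum_congr rfl fun k _ => ?_
      rw [hpow, ← cEnd_pow_apply, ← algebraMap_smul K (_ * _) (_ : M), smul_smul, smul_smul,
        algebraMap_eq, monomial_mul_monomial, monomial_mul_monomial, add_zero, ← sub_eq_add_neg]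
      congr 2
      simp only [ε]
      ring

end Pure

/-! ### The extension `K_n` as a vector space -/

section Extension

variable (n : ℕ+)

/-- The underlying series in `w = z ^ (1 / n)`. -/
def Kn.val (f : Kn n) : K := f

/-- The coefficient of `z ^ (k / n)`. -/
def knCoef (f : Kn n) (k : ℤ) : ℂ := coef (Kn.val n f) k

variable {n}

theorem knCoef_ext {f g : Kn n} (h : ∀ k, knCoef n f k = knCoef n g k) : f = g :=
  coef_ext (f := (Kn.val n f)) (g := (Kn.val n g)) h

theorem monomialKn_mul (j k : ℤ) (a b : ℂ) :
    monomialKn n j a * monomialKn n k b = monomialKn n (j + k) (a * b) :=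
  monomial_mul_monomial j k a b

theorem monomialKn_zero_one : monomialKn n 0 1 = 1 := rfl

theorem φn_monomialKn (τ : ℂ) (k : ℤ) (a : ℂ) :
    φn τ n (monomialKn n k a) = monomialKn n k ((qpow τ ((n : ℂ)⁻¹) : ℂ) ^ k * a) :=
  dilate_monomial _ k a

theorem toKn_monomial (l : ℤ) (a : ℂ) : toKn n (monomial l a) = monomialKn n (n * l) a := by
  refine Subtype.ext ?_
  change substPow n (HahnSeries.single l a) = HahnSeries.single (n * l) a
  exact HahnSeries.embDomain_single

theorem algebraMap_Kn (f : K) : algebraMap K (Kn n) f = toKn n f := rfl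

theorem knCoef_toKn_mul_monomialKn (f : K) (a k : ℤ) :
    knCoef n (toKn n f * monomialKn n a 1) (a + n * k) = coef f k := by
  rw [mul_comm]
  change coef (monomial a 1 * Kn.val n (toKn n f)) (a + n * k) = _
  rw [coef_monomial_mul, one_mul, add_sub_cancel_left]
  exact coeff_substPow_mul n f k

theorem knCoef_toKn_mul_monomialKn_of_not_dvd (f : K) (a k : ℤ) (h : ¬ (n : ℤ) ∣ k - a) :
    knCoef n (toKn n f * monomialKn n a 1) k = 0 := by
  rw [mul_comm]
  change coef (monomial a 1 * Kn.val n (toKn n f)) k = _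
  rw [coef_monomial_mul, one_mul]
  exact coeff_substPow_of_not_dvd n f _ h

variable (n) in
/-- `K_n` has the basis `z ^ (a / n)`, `0 ≤ a < n`. -/
def combKn : (Fin n → K) →ₗ[K] Kn n :=
  Fintype.linearCombination K fun a : Fin n => monomialKn n (a : ℕ) 1

theorem knCoef_combKn (g : Fin n → K) (a : Fin n) (k : ℤ) :
    knCoef n (combKn n g) ((a : ℕ) + n * k) = coef (g a) k := by
  have h : combKn n g = ∑ a : Fin n, toKn n (g a) * monomialKn n (a : ℕ) 1 := by
    rw [combKn, Fintype.linearCombination_apply]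
    refine Finset.sum_congr rfl fun a _ => ?_
    rw [Algebra.smul_def, algebraMap_Kn]
  rw [h]
  have hs : ∀ j, knCoef n (∑ a : Fin n, toKn n (g a) * monomialKn n (a : ℕ) 1) j =
      ∑ a : Fin n, knCoef n (toKn n (g a) * monomialKn n (a : ℕ) 1) j := fun j =>
    coef_sum _ (fun a : Fin n => Kn.val n (toKn n (g a) * monomialKn n (a : ℕ) 1)) j
  rw [hs, Finset.sum_eq_single a]
  · exact knCoef_toKn_mul_monomialKn _ _ _
  · intro b _ hb
    refine knCoef_toKn_mul_monomialKn_of_not_dvd _ _ _ fun hd => hb ?_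
    have h1 : (n : ℤ) ∣ (a : ℕ) - (b : ℕ) := by
      have := dvd_sub hd (dvd_mul_right (n : ℤ) k)
      rwa [show (a : ℕ) + n * k - (b : ℕ) - n * k = ((a : ℕ) : ℤ) - (b : ℕ) by ring] at this
    have h2 := Int.eq_zero_of_abs_lt_dvd h1 (by
      have := a.2
      have := b.2
      rw [abs_lt]
      constructor <;> omega)
    exact Fin.ext (by omega)
  · intro h; exact absurd (Finset.mem_univ _) h

theorem exists_of_zpow_bound {y : ℤ → ℂ} {N : ℤ} {C r : ℝ} (hr : 0 < r) (h0 : ∀ k < N, y k = 0)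
    (h : ∀ k, ‖y k‖ ≤ C * r ^ k) : ∃ f : K, ∀ k, coef f k = y k := by
  obtain ⟨f, hf0, hf⟩ := exists_of_bound (y := fun k : ℕ => y (N + k)) (C := C * r ^ N) hr
    fun k => by
      rw [mul_assoc, ← zpow_natCast, ← zpow_add₀ hr.ne']
      exact h _
  refine ⟨monomial N 1 * f, fun k => ?_⟩
  rw [coef_monomial_mul, one_mul]
  rcases lt_or_ge k N with hk | hk
  · rw [hf0 _ (by omega), h0 k hk]
  · obtain ⟨l, rfl⟩ := Int.le.dest hk
    rw [add_sub_cancel_left, hf]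

/-- The exponents of `z^(1/n)` are sorted by residue class modulo `n`; the series collected in each
class still satisfies a geometric bound, with ratio `r^n`. -/
theorem combKn_bijective : Function.Bijective (combKn n) := by
  constructor
  · intro g g' h
    funext a
    refine coef_ext fun k => ?_
    rw [← knCoef_combKn, ← knCoef_combKn, h]
  · intro f
    obtain ⟨C, r, hC, hr, hb⟩ := (isConvergent_iff _).1 (Kn.val n f).2
    have hn : (1 : ℤ) ≤ n := by exact_mod_cast n.pos
    have hex : ∀ a : Fin n, ∃ g : K, ∀ k, coef g k = knCoef n f ((a : ℕ) + n * k) := by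
      intro a
      -- For `k` below this bound, `a + n k < n (k + 1) ≤ k + 1 < ord f`.
      refine exists_of_zpow_bound (N := -(|ord (Kn.val n f)| + 1)) (C := C * r ^ (a : ℕ))
        (r := r ^ (n : ℕ)) (by positivity) (fun k hk => ?_) fun k => ?_
      · refine coef_of_lt_ord ?_
        have h1 := neg_abs_le (ord (Kn.val n f))
        have h2 : ((a : ℕ) : ℤ) < n := by exact_mod_cast a.2
        have h3 : k + 1 < 0 := by
          have := abs_nonneg (ord (Kn.val n f))
          linarith
        nlinarith
      · refine (hb _).trans_eq ?_
        rw [zpow_add₀ hr.ne', zpow_mul, zpow_natCast, zpow_natCast]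
        ring
    choose g hg using hex
    refine ⟨g, knCoef_ext fun j => ?_⟩
    have hn0 : (n : ℤ) ≠ 0 := by omega
    have h1 := Int.emod_nonneg j hn0
    have h2 := Int.emod_lt_of_pos j (show (0 : ℤ) < n by omega)
    have hj : j = (((⟨(j % n).toNat, by omega⟩ : Fin n) : ℕ) : ℤ) + n * (j / n) := by
      have := Int.emod_add_mul_ediv j n
      simp only
      omega
    rw [hj, knCoef_combKn, hg]

variable (n) in
/-- `K_n` as a coordinate space over `K`. -/
def equivKn : (Fin n → K) ≃ₗ[K] Kn n := LinearEquiv.ofBijective (combKn n) combKn_bijective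

instance : Module.Finite K (Kn n) := Module.Finite.equiv (equivKn n)

theorem finrank_Kn : Module.finrank K (Kn n) = n := by
  rw [← (equivKn n).finrank_eq, Module.finrank_fintype_fun_eq_card, Fintype.card_fin]

theorem exists_eq_sum_monomialKn (f : Kn n) :
    ∃ g : Fin n → K, f = ∑ a : Fin n, g a • monomialKn n (a : ℕ) 1 := by
  obtain ⟨g, rfl⟩ := combKn_bijective.2 f
  exact ⟨g, Fintype.linearCombination_apply _ _ _⟩

end Extension

/-! ### The shift on `ℂ ^ m` -/

section Shift

variable (m : ℕ)

/-- The nilpotent shift. -/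
def shift : Module.End ℂ (Fin m → ℂ) where
  toFun y i := if h : (i : ℕ) + 1 < m then y ⟨i + 1, h⟩ else 0
  map_add' y z := by
    funext i
    simp only [Pi.add_apply]
    split_ifs <;> simp
  map_smul' a y := by
    funext i
    simp only [Pi.smul_apply, RingHom.id_apply]
    split_ifs <;> simp

variable {m}

theorem shift_pow_apply (k : ℕ) (y : Fin m → ℂ) (i : Fin m) :
    (shift m ^ k) y i = if h : (i : ℕ) + k < m then y ⟨i + k, h⟩ else 0 := by
  induction k generalizing i with
  | zero => simp
  | succ k ih =>
    rw [pow_succ', Module.End.mul_apply]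
    change (if h : (i : ℕ) + 1 < m then (shift m ^ k) y ⟨i + 1, h⟩ else 0) = _
    by_cases h1 : (i : ℕ) + 1 < m
    · rw [dif_pos h1, ih]
      have e : (i : ℕ) + 1 + k = i + (k + 1) := by ring
      simp only [e]
    · rw [dif_neg h1, dif_neg (by omega)]

theorem shift_pow_self : shift m ^ m = 0 := by
  refine LinearMap.ext fun y => funext fun i => ?_
  rw [shift_pow_apply, dif_neg (by omega)]
  rfl

theorem isUnit_one_add_shift : IsUnit (1 + shift m) :=
  IsNilpotent.isUnit_one_add ⟨m, shift_pow_self⟩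

theorem one_add_shift_pow_sub_one_pow (n : ℕ) (k : ℕ) : ((1 + shift m) ^ n - 1) ^ k =
    (∑ i ∈ Finset.range n, (1 + shift m) ^ i) ^ k * shift m ^ k := by
  have h : (1 + shift m) ^ n - 1 = (∑ i ∈ Finset.range n, (1 + shift m) ^ i) * shift m := by
    rw [← geom_sum_mul, add_sub_cancel_left]
  have hc : Commute (∑ i ∈ Finset.range n, (1 + shift m) ^ i) (shift m) :=
    Commute.sum_left _ _ _ fun i _ =>
      ((Commute.one_left (shift m)).add_left (Commute.refl (shift m))).pow_left i
  rw [h, hc.mul_pow]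

theorem one_add_shift_pow_sub_one_pow_self (n : ℕ) : ((1 + shift m) ^ n - 1) ^ m = 0 := by
  rw [one_add_shift_pow_sub_one_pow, shift_pow_self, mul_zero]

/-- `(1 + S)^n - 1` is `S` times `∑ (1 + S)^i`. The power `S^(m-1)` carries the last basis vector to
the first, which `S` kills, so there the other factor acts as the scalar `n ≠ 0`. -/
theorem one_add_shift_pow_sub_one_pow_pred {n : ℕ} (hn : n ≠ 0) (hm : 0 < m) :
    (((1 + shift m) ^ n - 1) ^ (m - 1)) (Pi.single ⟨m - 1, by omega⟩ 1) ≠ 0 := by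
  have h0 : (shift m ^ (m - 1)) (Pi.single ⟨m - 1, by omega⟩ 1) = Pi.single ⟨0, hm⟩ 1 := by
    funext i
    rw [shift_pow_apply]
    rcases Nat.eq_zero_or_pos i with hi | hi
    · have : i = ⟨0, hm⟩ := Fin.ext hi
      subst this
      rw [dif_pos (by simp only; omega), Pi.single_eq_same]
      have e : (⟨0 + (m - 1), by omega⟩ : Fin m) = ⟨m - 1, by omega⟩ := Fin.ext (by simp)
      simp only [e, Pi.single_eq_same]
    · rw [dif_neg (by omega), Pi.single_eq_of_ne]
      intro h
      rw [h] at hi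
      simp at hi
  have h1 : (1 + shift m) (Pi.single ⟨0, hm⟩ 1) = Pi.single ⟨0, hm⟩ 1 := by
    rw [LinearMap.add_apply, Module.End.one_apply]
    convert add_zero _
    funext i
    change (if h : (i : ℕ) + 1 < m then
      (Pi.single ⟨0, hm⟩ 1 : Fin m → ℂ) ⟨i + 1, h⟩ else 0) = 0
    split_ifs
    · rw [Pi.single_eq_of_ne]
      simp [Fin.ext_iff]
    · rfl
  have h2 : ∀ i : ℕ, ((1 + shift m) ^ i) (Pi.single ⟨0, hm⟩ 1) = Pi.single ⟨0, hm⟩ 1 := by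
    intro i
    induction i with
    | zero => rfl
    | succ i ih => rw [pow_succ', Module.End.mul_apply, ih, h1]
  have h3 : (∑ i ∈ Finset.range n, (1 + shift m) ^ i) (Pi.single ⟨0, hm⟩ 1) =
      (n : ℂ) • (Pi.single ⟨0, hm⟩ 1 : Fin m → ℂ) := by
    rw [LinearMap.sum_apply, Finset.sum_congr rfl fun i _ => h2 i, Finset.sum_const,
      Finset.card_range, Nat.cast_smul_eq_nsmul]
  have h4 : ∀ k : ℕ, ((∑ i ∈ Finset.range n, (1 + shift m) ^ i) ^ k) (Pi.single ⟨0, hm⟩ 1) =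
      (n : ℂ) ^ k • (Pi.single ⟨0, hm⟩ 1 : Fin m → ℂ) := by
    intro k
    induction k with
    | zero => simp
    | succ k ih =>
      rw [pow_succ', Module.End.mul_apply, ih, map_smul, h3, smul_smul, pow_succ]
  rw [one_add_shift_pow_sub_one_pow, Module.End.mul_apply, h0, h4]
  refine smul_ne_zero (pow_ne_zero _ (by exact_mod_cast hn)) ?_
  intro h
  have := congrFun h ⟨0, hm⟩
  simp at this

theorem span_chain_eq_top {n : ℕ} (hn : n ≠ 0) (hm : 0 < m) :
    Submodule.span ℂ (Set.range fun j : Fin m =>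
      (((1 + shift m) ^ n - 1) ^ (j : ℕ)) (Pi.single ⟨m - 1, by omega⟩ 1 : Fin m → ℂ)) = ⊤ := by
  refine (linearIndependent_nilpotent_chain _ _ m ?_ ?_).span_eq_top_of_card_eq_finrank' ?_
  · rw [one_add_shift_pow_sub_one_pow_self]
    rfl
  · exact one_add_shift_pow_sub_one_pow_pred hn hm
  · rw [Module.finrank_fintype_fun_eq_card]

end Shift

/-! ### The modules `E(c z^{t/n}) ⊗ U_m` -/

/-- Constant vectors. -/
def constVec {m : ℕ} (y : Fin m → ℂ) : Fin m → K := fun i => algebraMap ℂ K (y i)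

theorem constVec_smul {m : ℕ} (a : ℂ) (y : Fin m → ℂ) :
    constVec (a • y) = algebraMap ℂ K a • constVec y := by
  funext i
  simp [constVec]

theorem constVec_single {m : ℕ} (i : Fin m) : constVec (Pi.single i 1) = Pi.single i 1 := by
  funext j
  by_cases h : j = i
  · subst h
    simp [constVec]
  · simp [constVec, h]

/-- On constant vectors the semilinear operator of `U_m` is linear algebra over `ℂ`. -/
theorem ΦU_constVec (τ : ℂ) (m : ℕ) (y : Fin m → ℂ) :
    ΦU τ m (constVec y) = constVec ((1 + shift m) y) := by
  classical
  funext i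
  change ∑ j, unipotentMatrix m i j * φ τ (algebraMap ℂ K (y j)) =
    algebraMap ℂ K (y i + if h : (i : ℕ) + 1 < m then y ⟨i + 1, h⟩ else 0)
  simp only [φ_apply, dilate_algebraMap, unipotentMatrix, Matrix.of_apply, ite_mul, one_mul,
    zero_mul]
  have hsplit : ∀ j : Fin m, (if i = j ∨ (i : ℕ) + 1 = j then algebraMap ℂ K (y j) else 0) =
      (if i = j then algebraMap ℂ K (y j) else 0) +
        if (i : ℕ) + 1 = j then algebraMap ℂ K (y j) else 0 := by
    intro j
    by_cases h1 : i = j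
    · subst h1
      simp
    · simp [h1]
  simp only [hsplit, Finset.sum_add_distrib, Finset.sum_ite_eq, Finset.mem_univ, if_true, map_add]
  congr 1
  by_cases h : (i : ℕ) + 1 < m
  · rw [dif_pos h, Finset.sum_eq_single ⟨i + 1, h⟩]
    · simp
    · intro j _ hj
      rw [if_neg fun h' => hj (Fin.ext h'.symm)]
    · intro h; exact absurd (Finset.mem_univ _) h
  · rw [dif_neg h, map_zero]
    refine Finset.sum_eq_zero fun j _ => if_neg fun h' => h ?_
    have := j.2
    omega

theorem ΦU_surjective (τ : ℂ) (m : ℕ) : Function.Surjective (ΦU τ m) := by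
  intro Y
  have hs : ∀ i : Fin m, ∃ y, ΦU τ m y = Pi.single i 1 := by
    intro i
    obtain ⟨y, hy⟩ := ((Module.End.isUnit_iff _).1 (isUnit_one_add_shift (m := m))).2
      (Pi.single i 1)
    exact ⟨constVec y, by rw [ΦU_constVec, hy, constVec_single]⟩
  choose y hy using hs
  refine ⟨∑ i, dilate (qpow τ 1)⁻¹ (Y i) • y i, ?_⟩
  rw [map_sum]
  simp only [map_smulₛₗ, φ_apply, dilate_inv_dilate, hy]
  exact (pi_eq_sum_univ' Y).symm

theorem ΦE_surjective (τ : ℂ) (t : ℤ) (n : ℕ+) {c : ℂ} (hc : c ≠ 0) :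
    Function.Surjective (ΦE τ t n c) := by
  intro f
  refine ⟨dilate (qpow τ ((n : ℂ)⁻¹))⁻¹ (f * monomialKn n (-t) c⁻¹), ?_⟩
  have h : φn τ n (dilate (qpow τ ((n : ℂ)⁻¹))⁻¹ (f * monomialKn n (-t) c⁻¹)) =
      f * monomialKn n (-t) c⁻¹ := dilate_inv_dilate _ _
  change φn τ n _ * monomialKn n t c = f
  rw [h, mul_assoc, monomialKn_mul, neg_add_cancel, inv_mul_cancel₀ hc, monomialKn_zero_one, mul_one]

theorem ΦEU_surjective (τ : ℂ) (t : ℤ) (n : ℕ+) {c : ℂ} (hc : c ≠ 0) (m : ℕ) :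
    Function.Surjective (ΦEU τ t n c m) := by
  intro x
  induction x using TensorProduct.induction_on with
  | zero => exact ⟨0, map_zero _⟩
  | tmul f Y =>
    obtain ⟨f, rfl⟩ := ΦE_surjective τ t n hc f
    obtain ⟨Y, rfl⟩ := ΦU_surjective τ m Y
    exact ⟨f ⊗ₜ Y, rfl⟩
  | add x y hx hy =>
    obtain ⟨x, rfl⟩ := hx
    obtain ⟨y, rfl⟩ := hy
    exact ⟨x + y, map_add _ _ _⟩

theorem isDifferenceModule_ΦEU (τ : ℂ) (t : ℤ) (n : ℕ+) {c : ℂ} (hc : c ≠ 0) (m : ℕ) :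
    IsDifferenceModule (ΦEU τ t n c m) := by
  refine ⟨inferInstance, ?_, ΦEU_surjective τ t n hc m⟩
  rw [injective_iff_map_eq_zero]
  intro x hx
  have := comap_eq_of_stable (ΦEU τ t n c m) (ΦEU_surjective τ t n hc m) ⊥
    (fun y hy => by rw [(Submodule.mem_bot K).1 hy, map_zero]; exact Submodule.zero_mem _) x
  rw [hx] at this
  exact (Submodule.mem_bot K).1 (this.1 (Submodule.zero_mem _))

/-! ### The Jordan generator of `E(c z^{t/n}) ⊗ U_m`. -/

section Generator

variable (τ : ℂ) (t : ℤ) (n : ℕ+) (c : ℂ) (m : ℕ)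
  [Module ℂ (Kn n ⊗[K] (Fin m → K))] [IsScalarTower ℂ K (Kn n ⊗[K] (Fin m → K))]

/-- The vectors `z ^ (k / n) ⊗ y` with constant `y`. -/
def constTensor (k : ℤ) : (Fin m → ℂ) →ₗ[ℂ] Kn n ⊗[K] (Fin m → K) where
  toFun y := monomialKn n k 1 ⊗ₜ constVec y
  map_add' y z := by
    rw [← TensorProduct.tmul_add]
    congr 1
    funext i
    exact map_add _ _ _
  map_smul' a y := by
    rw [constVec_smul, TensorProduct.tmul_smul, algebraMap_smul, RingHom.id_apply]

theorem constTensor_apply (k : ℤ) (y : Fin m → ℂ) :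
    constTensor n m k y = monomialKn n k 1 ⊗ₜ constVec y := rfl

theorem monomial_smul_constTensor (l k : ℤ) (y : Fin m → ℂ) :
    monomial l (1 : ℂ) • constTensor n m k y = constTensor n m (k + n * l) y := by
  rw [constTensor_apply, constTensor_apply, TensorProduct.smul_tmul', Algebra.smul_def,
    algebraMap_Kn, toKn_monomial, monomialKn_mul, one_mul, add_comm]

theorem ΦEU_constTensor (k : ℤ) (y : Fin m → ℂ) : ΦEU τ t n c m (constTensor n m k y) =
    (c * (qpow τ ((n : ℂ)⁻¹) : ℂ) ^ k) • constTensor n m (k + t) ((1 + shift m) y) := by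
  change (φn τ n (monomialKn n k 1) * monomialKn n t c) ⊗ₜ ΦU τ m (constVec y) = _
  rw [φn_monomialKn, monomialKn_mul, ΦU_constVec, constTensor_apply, ← algebraMap_smul K,
    TensorProduct.smul_tmul', Algebra.smul_def, algebraMap_Kn, algebraMap_eq, toKn_monomial,
    monomialKn_mul]
  rw [mul_zero, zero_add, mul_one, mul_one, mul_comm c]

/-- The scalar by which `Φ ^ i` acts on the monomials in `E(c z^{t/n})`. -/
def chainScalar (i : ℕ) : ℂ := c ^ i * ∏ l ∈ Finset.range i, (qpow τ ((n : ℂ)⁻¹) : ℂ) ^ (t * l)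

theorem chainScalar_ne_zero {c : ℂ} (hc : c ≠ 0) (i : ℕ) : chainScalar τ t n c i ≠ 0 :=
  mul_ne_zero (pow_ne_zero _ hc) (Finset.prod_ne_zero_iff.2 fun _ _ =>
    zpow_ne_zero _ (Units.ne_zero _))

theorem cEnd_pow_constTensor (i : ℕ) (y : Fin m → ℂ) :
    (cEnd (ΦEU τ t n c m) ^ i) (constTensor n m 0 y) =
      chainScalar τ t n c i • constTensor n m (t * i) (((1 + shift m) ^ i) y) := by
  induction i with
  | zero => simp [chainScalar]
  | succ i ih =>
    rw [pow_succ', Module.End.mul_apply, ih, map_smul, cEnd_apply, ΦEU_constTensor, smul_smul,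
      pow_succ', Module.End.mul_apply, chainScalar, chainScalar, Finset.prod_range_succ]
    congr 1
    · ring
    · rw [show t * (i : ℤ) + t = t * ((i + 1 : ℕ) : ℤ) by push_cast; ring]

theorem opT_constTensor (y : Fin m → ℂ) :
    opT (ΦEU τ t n c m) t n (constTensor n m 0 y) =
      chainScalar τ t n c n • constTensor n m 0 (((1 + shift m) ^ (n : ℕ)) y) := by
  rw [opT_apply, cEnd_pow_constTensor, smul_comm, monomial_smul_constTensor,
    show t * ((n : ℕ) : ℤ) + n * -t = 0 by ring]

theorem sh_pow_constTensor (j : ℕ) (y : Fin m → ℂ) :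
    (sh (opT (ΦEU τ t n c m) t n) (chainScalar τ t n c n) ^ j) (constTensor n m 0 y) =
      chainScalar τ t n c n ^ j •
        constTensor n m 0 ((((1 + shift m) ^ (n : ℕ) - 1) ^ j) y) := by
  induction j with
  | zero => simp
  | succ j ih =>
    rw [pow_succ', Module.End.mul_apply, ih, map_smul, sh_apply, opT_constTensor, ← smul_sub,
      ← map_sub, smul_smul, ← pow_succ, pow_succ' ((1 + shift m) ^ (n : ℕ) - 1),
      Module.End.mul_apply, LinearMap.sub_apply, Module.End.one_apply]

/-- From `a t + b n = 1`: `i` is the remainder of `k a` modulo `n`. -/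
theorem exists_eq_mul_add_mul {t : ℤ} {n : ℕ} (hn : 0 < n) (h : IsCoprime t (n : ℤ)) (k : ℤ) :
    ∃ (i : Fin n) (l : ℤ), k = t * (i : ℕ) + n * l := by
  obtain ⟨a, b, hab⟩ := h
  have hn0 : (n : ℤ) ≠ 0 := by omega
  have h1 := Int.emod_nonneg (k * a) hn0
  have h2 := Int.emod_lt_of_pos (k * a) (show (0 : ℤ) < n by omega)
  refine ⟨⟨(k * a % n).toNat, by omega⟩, k * b + t * (k * a / n), ?_⟩
  have h3 := Int.emod_add_mul_ediv (k * a) n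
  rw [Int.toNat_of_nonneg h1]
  linear_combination (-k) * hab - t * h3

/-- On vectors `1 ⊗ y` with constant `y`, `T - λ` is `λ ((1 + S)^n - 1)`, so the last basis vector
gives a chain of length `m`. The exponents `t i + n l` exhaust `ℤ`, so the translates span; as there
are `n m` of them, they form a basis. -/
theorem isJordanGenerator_ΦEU {t : ℤ} {n : ℕ+} {c : ℂ} {m : ℕ}
    [Module ℂ (Kn n ⊗[K] (Fin m → K))] [IsScalarTower ℂ K (Kn n ⊗[K] (Fin m → K))]
    (hcop : IsCoprime t (n : ℤ)) (hc : c ≠ 0) (hm : 0 < m) :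
    IsJordanGenerator (ΦEU τ t n c m) t n (chainScalar τ t n c n) m
      (constTensor n m 0 (Pi.single ⟨m - 1, by omega⟩ 1)) := by
  have hspan : Submodule.span K (Set.range fun ij : Fin n × Fin m =>
      jordanVec (ΦEU τ t n c m) t n (chainScalar τ t n c n)
        (constTensor n m 0 (Pi.single ⟨m - 1, by omega⟩ 1)) ij.1 ij.2) = ⊤ := by
    set P := Submodule.span K (Set.range fun ij : Fin n × Fin m =>
      jordanVec (ΦEU τ t n c m) t n (chainScalar τ t n c n)
        (constTensor n m 0 (Pi.single ⟨m - 1, by omega⟩ 1)) ij.1 ij.2) with hP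
    have hCsmul : ∀ a : ℂ, a ≠ 0 → ∀ x, a • x ∈ P → x ∈ P := by
      intro a ha x hx
      have := P.smul_mem (algebraMap ℂ K a⁻¹) hx
      rwa [algebraMap_smul, smul_smul, inv_mul_cancel₀ ha, one_smul] at this
    have h1 : ∀ (i : Fin n) (y : Fin m → ℂ), constTensor n m (t * (i : ℕ)) y ∈ P := by
      intro i y
      -- `Φ^i` also applies the invertible `(1 + S)^i` to `y`; it is absorbed into the choice of
      -- `y`.
      obtain ⟨y, rfl⟩ := ((Module.End.isUnit_iff _).1
        ((isUnit_one_add_shift (m := m)).pow (i : ℕ))).2 y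
      have hy : y ∈ (⊤ : Submodule ℂ (Fin m → ℂ)) := Submodule.mem_top
      rw [← span_chain_eq_top n.ne_zero hm] at hy
      have hle : Submodule.span ℂ (Set.range fun j : Fin m =>
          (((1 + shift m) ^ (n : ℕ) - 1) ^ (j : ℕ))
            (Pi.single ⟨m - 1, by omega⟩ 1 : Fin m → ℂ)) ≤
          (P.restrictScalars ℂ).comap
            (constTensor n m (t * (i : ℕ)) ∘ₗ ((1 + shift m) ^ (i : ℕ))) := by
        rw [Submodule.span_le]
        rintro _ ⟨j, rfl⟩
        have hij : jordanVec (ΦEU τ t n c m) t n (chainScalar τ t n c n)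
          (constTensor n m 0 (Pi.single ⟨m - 1, by omega⟩ 1)) i j ∈ P :=
          Submodule.subset_span ⟨(i, j), rfl⟩
        rw [jordanVec, sh_pow_constTensor, map_smul, cEnd_pow_constTensor] at hij
        exact hCsmul _ (chainScalar_ne_zero τ t n hc _) _
          (hCsmul _ (pow_ne_zero _ (chainScalar_ne_zero τ t n hc _)) _ hij)
      exact hle hy
    have h2 : ∀ (k : ℤ) (y : Fin m → ℂ), constTensor n m k y ∈ P := by
      intro k y
      obtain ⟨i, l, rfl⟩ := exists_eq_mul_add_mul n.pos hcop k
      rw [← monomial_smul_constTensor]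
      exact P.smul_mem _ (h1 i y)
    have h3 : ∀ (k : ℤ) (Y : Fin m → K), monomialKn n k 1 ⊗ₜ Y ∈ P := by
      intro k Y
      rw [pi_eq_sum_univ' Y, TensorProduct.tmul_sum]
      refine P.sum_mem fun i _ => ?_
      rw [TensorProduct.tmul_smul]
      refine P.smul_mem _ ?_
      have := h2 k (Pi.single i 1)
      rwa [constTensor_apply, constVec_single] at this
    rw [eq_top_iff]
    intro x _
    induction x using TensorProduct.induction_on with
    | zero => exact P.zero_mem
    | tmul f Y =>
      obtain ⟨g, rfl⟩ := exists_eq_sum_monomialKn f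
      rw [TensorProduct.sum_tmul]
      refine P.sum_mem fun a _ => ?_
      rw [← TensorProduct.smul_tmul']
      exact P.smul_mem _ (h3 _ _)
    | add x y hx hy => exact P.add_mem (hx trivial) (hy trivial)
  refine ⟨?_, ?_, hspan⟩
  · rw [sh_pow_constTensor, one_add_shift_pow_sub_one_pow_self, LinearMap.zero_apply, map_zero,
      smul_zero]
  · refine linearIndependent_of_top_le_span_of_card_eq_finrank hspan.ge ?_
    rw [Module.finrank_tensorProduct, finrank_Kn, Module.finrank_fintype_fun_eq_card,
      Fintype.card_prod, Fintype.card_fin, Fintype.card_fin]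

end Generator

/-! ### Splitting off a Jordan chain -/

theorem exists_zpow_mul_mem {r x : ℝ} (hr : 0 < r) (hr1 : r < 1) (hx : 0 < x) :
    ∃ l : ℤ, r < r ^ l * x ∧ r ^ l * x ≤ 1 := by
  obtain ⟨l, h1, h2⟩ := exists_mem_Ioc_zpow hx ((one_lt_inv₀ hr).2 hr1)
  rw [inv_zpow] at h1 h2
  refine ⟨l + 1, ?_, ?_⟩
  · have h3 : 0 < r ^ l := zpow_pos hr l
    rw [zpow_add_one₀ hr.ne', mul_comm (r ^ l), mul_assoc]
    rw [inv_lt_iff_one_lt_mul₀ h3] at h1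
    nlinarith
  · have h3 : 0 < r ^ (l + 1) := zpow_pos hr _
    rwa [le_inv_comm₀ hx h3, inv_eq_one_div, le_div_iff₀ hx] at h2

/-- The interval `(r, 1]` is a fundamental domain for multiplication by `r`; this is the uniqueness
half. -/
theorem zpow_eq_zero_of_mem {r x : ℝ} (hr : 0 < r) (hr1 : r < 1) (hx : r < x) (hx1 : x ≤ 1) {k : ℤ}
    (h : r < r ^ k * x) (h1 : r ^ k * x ≤ 1) : k = 0 := by
  have hx0 : 0 < x := hr.trans hx
  have hk0 : 0 < r ^ k := zpow_pos hr k
  have ha : k < 1 := by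
    by_contra hk
    have : r ^ k ≤ r ^ (1 : ℤ) := zpow_le_zpow_right_of_le_one₀ hr hr1.le (by omega)
    rw [zpow_one] at this
    nlinarith
  have hb : -1 < k := by
    by_contra hk
    have : r ^ (-1 : ℤ) ≤ r ^ k := zpow_le_zpow_right_of_le_one₀ hr hr1.le (by omega)
    rw [zpow_neg_one, inv_le_iff_one_le_mul₀ hr] at this
    nlinarith
  omega

/-- A nilpotent operator with a chain of maximal length: the chain has a stable complement. -/
theorem exists_stable_complement {E : Type*} [AddCommGroup E] [Module ℂ E] (N : Module.End ℂ E)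
    (V : Submodule ℂ E) (hNV : ∀ x ∈ V, N x ∈ V) {m : ℕ} (hV : ∀ x ∈ V, (N ^ m) x = 0) {v : E}
    (hv : v ∈ V) (hm : 0 < m) (hne : (N ^ (m - 1)) v ≠ 0) :
    ∃ W ≤ V, (∀ x ∈ W, N x ∈ W) ∧
      Disjoint (Submodule.span ℂ (Set.range fun j : Fin m => (N ^ (j : ℕ)) v)) W ∧
      V ≤ Submodule.span ℂ (Set.range fun j : Fin m => (N ^ (j : ℕ)) v) ⊔ W := by
  have hz : ∀ x ∈ V, ∀ j, m ≤ j → (N ^ j) x = 0 := fun x hx j hj => by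
    obtain ⟨i, rfl⟩ := Nat.exists_eq_add_of_le' hj
    rw [pow_add, Module.End.mul_apply, hV x hx, map_zero]
  have hNVp : ∀ (j : ℕ), ∀ x ∈ V, (N ^ j) x ∈ V := by
    intro j
    induction j with
    | zero => exact fun x hx => hx
    | succ j ih =>
      intro x hx
      rw [pow_succ', Module.End.mul_apply]
      exact hNV _ (ih x hx)
  have hli := linearIndependent_nilpotent_chain N v m (hV v hv) hne
  -- `ℓ` extends the coordinate of `N^(m-1) v` on the chain. The complement `W` is the largest
  -- `N`-stable subspace of `V` on which `ℓ` vanishes; finite dimensionality of `V` is not needed.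
  obtain ⟨ℓ, hℓ⟩ := LinearMap.exists_extend
    ((Finsupp.lapply (⟨m - 1, by omega⟩ : Fin m)).comp hli.repr)
  have hℓv : ∀ k : ℕ, ℓ ((N ^ k) v) = if k = m - 1 then 1 else 0 := by
    classical
    intro k
    rcases lt_or_ge k m with hk | hk
    · have h1 := LinearMap.congr_fun hℓ ⟨(N ^ k) v, Submodule.subset_span ⟨⟨k, hk⟩, rfl⟩⟩
      rw [LinearMap.comp_apply, LinearMap.comp_apply, Submodule.subtype_apply,
        hli.repr_eq_single ⟨k, hk⟩ _ rfl, Finsupp.lapply_apply, Finsupp.single_apply] at h1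
      rw [h1]
      simp [Fin.ext_iff]
    · rw [hz v hv k hk, map_zero, if_neg (by omega)]
  let W : Submodule ℂ E := V ⊓ ⨅ i : ℕ, LinearMap.ker (ℓ ∘ₗ (N ^ i))
  have hW : ∀ x, x ∈ W ↔ x ∈ V ∧ ∀ i : ℕ, ℓ ((N ^ i) x) = 0 := fun x => by
    simp [W, Submodule.mem_inf, Submodule.mem_iInf]
  have hsumℓ : ∀ (a : Fin m → ℂ) (i : ℕ), ℓ ((N ^ i) (∑ j : Fin m, a j • (N ^ (j : ℕ)) v)) =
      ∑ j : Fin m, if i + j = m - 1 then a j else 0 := by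
    intro a i
    rw [map_sum, map_sum]
    refine Finset.sum_congr rfl fun j _ => ?_
    rw [map_smul, map_smul, ← Module.End.mul_apply, ← pow_add, hℓv, smul_eq_mul, mul_ite, mul_one,
      mul_zero]
  have hsum1 : ∀ (a : Fin m → ℂ) (l : Fin m),
      (∑ j : Fin m, if m - 1 - (l : ℕ) + j = m - 1 then a j else 0) = a l := by
    intro a l
    rw [Finset.sum_eq_single l]
    · rw [if_pos (by omega)]
    · intro j _ hj
      rw [if_neg fun h => hj (Fin.ext (by omega))]
    · intro h; exact absurd (Finset.mem_univ _) h
  refine ⟨W, inf_le_left, fun x hx => ?_, ?_, fun x hx => ?_⟩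
  · rw [hW] at hx ⊢
    refine ⟨hNV x hx.1, fun i => ?_⟩
    have := hx.2 (i + 1)
    rwa [pow_succ, Module.End.mul_apply] at this
  · rw [Submodule.disjoint_def]
    intro x hx hxW
    obtain ⟨a, rfl⟩ := (Submodule.mem_span_range_iff_exists_fun ℂ).1 hx
    refine Finset.sum_eq_zero fun l _ => ?_
    have := ((hW _).1 hxW).2 (m - 1 - l)
    rw [hsumℓ, hsum1] at this
    rw [this, zero_smul]
  -- The pairing of `N^i x` with `ℓ` reads off the coefficient at `j = m - 1 - i`, which dictates
  -- the projection onto the chain.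
  · let a : Fin m → ℂ := fun j => ℓ ((N ^ (m - 1 - (j : ℕ))) x)
    rw [← add_sub_cancel (∑ j : Fin m, a j • (N ^ (j : ℕ)) v) x]
    refine Submodule.add_mem_sup (Submodule.sum_mem _ fun j _ => Submodule.smul_mem _ _
      (Submodule.subset_span ⟨j, rfl⟩)) ((hW _).2 ⟨V.sub_mem hx (V.sum_mem fun j _ =>
        V.smul_mem _ (hNVp j v hv)), fun i => ?_⟩)
    rw [map_sub, map_sub, hsumℓ]
    rcases lt_or_ge i m with hi | hi
    · have := hsum1 a ⟨m - 1 - i, by omega⟩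
      simp only [show m - 1 - (m - 1 - i) = i by omega] at this
      rw [this]
      simp only [a, show m - 1 - (m - 1 - i) = i by omega, sub_self]
    · rw [hz x hx i hi, map_zero, Finset.sum_eq_zero, sub_zero]
      intro j _
      rw [if_neg (by omega)]

section Splitting

variable {τ : ℂ} {M : Type*} [AddCommGroup M] [Module K M] [Module ℂ M] [IsScalarTower ℂ K M]
  {Φ : M →ₛₗ[φ τ] M} {t : ℤ} {n : ℕ} {lam : ℂ}

theorem sh_mem_maxGenEigenspace (T : Module.End ℂ M) {x : M} (hx : x ∈ T.maxGenEigenspace lam) :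
    sh T lam x ∈ T.maxGenEigenspace lam := by
  rw [Module.End.mem_maxGenEigenspace] at hx ⊢
  obtain ⟨k, hk⟩ := hx
  refine ⟨k, ?_⟩
  rw [← Module.End.mul_apply, ← pow_succ, pow_succ', Module.End.mul_apply, hk, map_zero]

theorem sh_pow_mem_maxGenEigenspace (T : Module.End ℂ M) (j : ℕ) {x : M}
    (hx : x ∈ T.maxGenEigenspace lam) : (sh T lam ^ j) x ∈ T.maxGenEigenspace lam := by
  induction j with
  | zero => exact hx
  | succ j ih =>
    rw [pow_succ', Module.End.mul_apply]
    exact sh_mem_maxGenEigenspace T ih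

/-- The eigenvalues on the translates `Φ ^ i` of the eigenspace of `lam` are inequivalent. -/
theorem eq_of_zpow_mul_eq (hτ : 0 < τ.im) (hcop : IsCoprime t (n : ℤ)) (hlam : lam ≠ 0)
    {i j : Fin n} {k : ℤ}
    (h : (qpow τ 1 : ℂ) ^ (n * k) * ((qpow τ 1 : ℂ) ^ (t * (i : ℕ)) * lam) =
      (qpow τ 1 : ℂ) ^ (t * (j : ℕ)) * lam) : i = j ∧ k = 0 := by
  have hq : (qpow τ 1 : ℂ) ≠ 0 := Units.ne_zero _
  rw [← mul_assoc, ← zpow_add₀ hq] at h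
  have h1 := mul_right_cancel₀ hlam h
  have h2 := qpow_zpow_eq_one hτ (a := n * k + t * (i : ℕ) - t * (j : ℕ)) (by
    rw [zpow_sub₀ hq, h1, div_self (zpow_ne_zero _ hq)])
  have h3 : (n : ℤ) ∣ (j : ℕ) - (i : ℕ) := by
    refine hcop.symm.dvd_of_dvd_mul_left ⟨k, ?_⟩
    linarith
  have h4 := Int.eq_zero_of_abs_lt_dvd h3 (by
    have := i.2
    have := j.2
    rw [abs_lt]
    constructor <;> omega)
  have h5 : i = j := Fin.ext (by omega)
  refine ⟨h5, ?_⟩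
  have hn : (n : ℤ) ≠ 0 := by have := i.2; omega
  rw [h5, add_sub_cancel_right] at h2
  exact (mul_eq_zero.1 h2).resolve_left hn

/-- Indices for representatives of the eigenvalues modulo `q ^ n`: the translates of `lam` by
powers of `q`, and the eigenvalues in an annulus which are not such translates. -/
abbrev RepIndex (τ : ℂ) (n : ℕ) (lam : ℂ) : Type :=
  Fin n ⊕ {μ : ℂ // ‖(qpow τ 1 : ℂ)‖ ^ n < ‖μ‖ ∧ ‖μ‖ ≤ 1 ∧ ∀ k : ℤ, μ ≠ (qpow τ 1 : ℂ) ^ k * lam}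

/-- Representatives of the eigenvalues modulo `q ^ n`, containing `q ^ (t i) lam` for `i < n`. -/
def reps (τ : ℂ) (t : ℤ) (n : ℕ) (lam : ℂ) : RepIndex τ n lam → ℂ :=
  Sum.elim (fun i => (qpow τ 1 : ℂ) ^ (t * (i : ℕ)) * lam) Subtype.val

/-- Two translates of `lam` are separated by coprimality, two values of the annulus by absolute
value, and mixed pairs by the exclusion of `q^ℤ lam` from the annulus. -/
theorem reps_inequivalent (hτ : 0 < τ.im) (hn : 0 < n) (hcop : IsCoprime t (n : ℤ))
    (hlam : lam ≠ 0) {a b : RepIndex τ n lam} {k : ℤ}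
    (h : ((qpow τ 1 ^ n : ℂˣ) : ℂ) ^ k * reps τ t n lam a = reps τ t n lam b) : a = b ∧ k = 0 := by
  have hq : (qpow τ 1 : ℂ) ≠ 0 := Units.ne_zero _
  have e : ((qpow τ 1 ^ n : ℂˣ) : ℂ) ^ k = (qpow τ 1 : ℂ) ^ (n * k) := by
    rw [Units.val_pow_eq_pow_val, zpow_mul, zpow_natCast]
  rcases a with i | μ <;> rcases b with j | ν
  · rw [e] at h
    obtain ⟨h1, h2⟩ := eq_of_zpow_mul_eq hτ hcop hlam h
    exact ⟨by rw [h1], h2⟩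
  · rw [e] at h
    refine absurd h.symm ?_
    change (ν : ℂ) ≠ _ * (_ * lam)
    rw [← mul_assoc, ← zpow_add₀ hq]
    exact ν.2.2.2 _
  · rw [e] at h
    refine absurd ?_ (μ.2.2.2 (t * (j : ℕ) - n * k))
    change (qpow τ 1 : ℂ) ^ (n * k) * (μ : ℂ) = (qpow τ 1 : ℂ) ^ (t * (j : ℕ)) * lam at h
    rw [zpow_sub₀ hq, div_mul_eq_mul_div, ← h, mul_div_cancel_left₀ _ (zpow_ne_zero _ hq)]
  · change _ * (μ : ℂ) = (ν : ℂ) at h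
    have hnorm : (‖(qpow τ 1 : ℂ)‖ ^ n) ^ k * ‖(μ : ℂ)‖ = ‖(ν : ℂ)‖ := by
      rw [← h, norm_mul, norm_zpow, Units.val_pow_eq_pow_val, norm_pow]
    have hk : k = 0 := zpow_eq_zero_of_mem (pow_pos (norm_pos_iff.2 hq) n)
      (pow_lt_one₀ (norm_nonneg _) (norm_qpow_lt_one hτ) hn.ne') μ.2.1 μ.2.2.1
      (hnorm ▸ ν.2.1) (hnorm ▸ ν.2.2.1)
    refine ⟨?_, hk⟩
    rw [hk, zpow_zero, one_mul] at h
    rw [Subtype.ext h]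

theorem range_reps_inequivalent (hτ : 0 < τ.im) (hn : 0 < n) (hcop : IsCoprime t (n : ℤ))
    (hlam : lam ≠ 0) (μ : ℂ) (k : ℤ) (h : μ ∈ Set.range (reps τ t n lam))
    (h' : ((qpow τ 1 ^ n : ℂˣ) : ℂ) ^ k * μ ∈ Set.range (reps τ t n lam)) : k = 0 := by
  obtain ⟨a, rfl⟩ := h
  obtain ⟨b, hb⟩ := h'
  exact (reps_inequivalent hτ hn hcop hlam hb.symm).2

theorem reps_injective (hτ : 0 < τ.im) (hn : 0 < n) (hcop : IsCoprime t (n : ℤ))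
    (hlam : lam ≠ 0) : Function.Injective (reps τ t n lam) := fun a b h =>
  (reps_inequivalent hτ hn hcop hlam (k := 0) (by rw [zpow_zero, one_mul, h])).1

theorem cEnd_pow_mem_genSum (hΦ : Function.Injective Φ) (i : Fin n) {x : M}
    (hx : x ∈ (opT Φ t n).maxGenEigenspace lam) :
    (cEnd Φ ^ (i : ℕ)) x ∈ (opT Φ t n).maxGenEigenspace (reps τ t n lam (Sum.inl i)) :=
  (cEnd_pow_mem_iff Φ t n hΦ i lam x).2 hx

theorem cEnd_pow_injective (hΦ : Function.Injective Φ) (i : ℕ) :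
    Function.Injective (cEnd Φ ^ i) := by
  rw [Module.End.coe_pow]
  exact hΦ.iterate i

/-- The vectors `Φ^i (T - λ)^j v` are independent. -/
theorem linearIndependent_jordanVec (hτ : 0 < τ.im) (hn : 0 < n) (hcop : IsCoprime t (n : ℤ))
    (hlam : lam ≠ 0) (hΦ : Function.Injective Φ) {m : ℕ} {v : M}
    (hv : v ∈ (opT Φ t n).maxGenEigenspace lam) (h0 : (sh (opT Φ t n) lam ^ m) v = 0)
    (h1 : (sh (opT Φ t n) lam ^ (m - 1)) v ≠ 0) :
    LinearIndependent K fun ij : Fin n × Fin m => jordanVec Φ t n lam v ij.1 ij.2 := by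
  refine linearIndependent_of_mem_genSum (p := qpow τ 1 ^ n) (T := opT Φ t n) (opT_smul Φ t n)
    (range_reps_inequivalent hτ hn hcop hlam) ?_ fun ij => ?_
  · rw [Fintype.linearIndependent_iff]
    intro g hg
    -- Over `ℂ`, the blocks of different `i` lie in distinct generalized eigenspaces, and each block
    -- is the image of the chain under the injective `Φ^i`.
    rw [Fintype.sum_prod_type] at hg
    have hind := (opT Φ t n).independent_maxGenEigenspace.comp
      (reps_injective hτ hn hcop hlam)
    have hind := hind.comp (Sum.inl_injective)
    have hsum : ∀ i, ∑ j, g (i, j) • jordanVec Φ t n lam v i j =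
        (cEnd Φ ^ (i : ℕ)) (∑ j : Fin m, g (i, j) • (sh (opT Φ t n) lam ^ (j : ℕ)) v) := by
      intro i
      rw [map_sum]
      exact Finset.sum_congr rfl fun j _ => (map_smul _ _ _).symm
    have hz := (iSupIndep_iff_finsetSum_eq_zero_imp_eq_zero _).1 hind Finset.univ
      (fun i => ∑ j, g (i, j) • jordanVec Φ t n lam v i j) (fun i _ => by
        rw [hsum]
        exact cEnd_pow_mem_genSum hΦ i (Submodule.sum_mem _ fun j _ => Submodule.smul_mem _ _
          (sh_pow_mem_maxGenEigenspace _ _ hv))) hg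
    rintro ⟨i, j⟩
    have hi := hz i (Finset.mem_univ i)
    rw [hsum] at hi
    exact Fintype.linearIndependent_iff.1 (linearIndependent_nilpotent_chain _ v m h0 h1)
      (fun j => g (i, j)) (cEnd_pow_injective hΦ i (by rw [hi, map_zero])) j
  · exact maxGenEigenspace_le_genSum _ (Set.mem_range_self (Sum.inl ij.1))
      (cEnd_pow_mem_genSum hΦ ij.1 (sh_pow_mem_maxGenEigenspace _ _ hv))

/-- The `K`-span of the translates `Φ ^ i W`, `i < n`, of a `T`-stable space is stable. -/
theorem apply_mem_of_translates {W : Submodule ℂ M} (hW : ∀ x ∈ W, sh (opT Φ t n) lam x ∈ W)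
    {P : Submodule K M} (hP : ∀ i < n, ∀ x ∈ W, (cEnd Φ ^ i) x ∈ P) {i : ℕ} (hi : i < n) {x : M}
    (hx : x ∈ W) : Φ ((cEnd Φ ^ i) x) ∈ P := by
  rw [← cEnd_apply, ← Module.End.mul_apply, ← pow_succ']
  rcases lt_or_eq_of_le (Nat.succ_le_of_lt hi) with h | h
  · exact hP _ h x hx
  · rw [show i + 1 = n from h, cEnd_pow_eq_smul_opT Φ t n]
    have hTx : opT Φ t n x ∈ W := by
      have := W.add_mem (hW x hx) (W.smul_mem lam hx)
      rwa [sh_apply, sub_add_cancel] at this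
    exact P.smul_mem _ (hP 0 (by omega) _ hTx)

/-- A maximal Jordan chain at `lam` splits off: its translates span a difference submodule `X`,
while the translates of a stable complement and all inequivalent eigenspaces span a complementary
one, `Y`. Indecomposability leaves only `X`. -/
theorem exists_isJordanGenerator (hτ : 0 < τ.im) (hM : IsDifferenceModule Φ)
    (hind : IsIndecomposable Φ) (hn : 0 < n) (hcop : IsCoprime t (n : ℤ))
    (htop : ∀ P : Submodule K M,
      (∀ μ : ℂ, μ ≠ 0 → ∀ x ∈ (opT Φ t n).maxGenEigenspace μ, x ∈ P) → P = ⊤)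
    (hlam : lam ≠ 0) {x₀ : M} (hx₀ : x₀ ∈ (opT Φ t n).maxGenEigenspace lam) (hx₀0 : x₀ ≠ 0) :
    ∃ m v, 1 ≤ m ∧ IsJordanGenerator Φ t n lam m v := by
  classical
  have hfin := hM.finite
  have hinj := hM.bijective.1
  have hq : (qpow τ 1 : ℂ) ≠ 0 := Units.ne_zero _
  set T := opT Φ t n with hTdef
  set N := sh T lam with hN
  set V := T.maxGenEigenspace lam with hV
  -- the nilpotency index
  have hbound : ∀ x ∈ V, (N ^ Module.finrank K M) x = 0 := by
    intro x hx
    have hex : ∃ k, (N ^ k) x = 0 := (Module.End.mem_maxGenEigenspace _ _ _).1 hx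
    rcases eq_or_ne x 0 with rfl | hx0
    · rw [map_zero]
    have hpos : Nat.find hex ≠ 0 := fun h => hx0 (by
      have := Nat.find_spec hex
      rwa [h] at this)
    -- A chain of length `k` yields `n k` vectors independent over `K`, hence `k ≤ dim M`: the
    -- nilpotency index is bounded although `V` is not yet known to be finite dimensional.
    have hli := linearIndependent_jordanVec hτ hn hcop hlam hinj hx (Nat.find_spec hex)
      (Nat.find_min hex (by omega))
    have hcard := hli.fintype_card_le_finrank
    rw [Fintype.card_prod, Fintype.card_fin, Fintype.card_fin] at hcard
    have hle : Nat.find hex ≤ Module.finrank K M := le_trans (Nat.le_mul_of_pos_left _ hn) hcard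
    obtain ⟨j, hj⟩ := Nat.exists_eq_add_of_le' hle
    rw [hj, pow_add, Module.End.mul_apply, Nat.find_spec hex, map_zero]
  have hexm : ∃ m, ∀ x ∈ V, (N ^ m) x = 0 := ⟨_, hbound⟩
  set m := Nat.find hexm with hm
  have hmV : ∀ x ∈ V, (N ^ m) x = 0 := Nat.find_spec hexm
  have hm0 : 0 < m := Nat.pos_of_ne_zero fun h => hx₀0 (by
    have := hmV x₀ hx₀
    rwa [h] at this)
  have hmin := Nat.find_min hexm (show m - 1 < m by omega)
  push Not at hmin
  obtain ⟨v, hv, hvne⟩ := hmin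
  have hNV : ∀ x ∈ V, N x ∈ V := fun x hx => sh_mem_maxGenEigenspace T hx
  obtain ⟨W, hWV, hNW, hdisj, hsup⟩ := exists_stable_complement N V hNV hmV hv hm0 hvne
  set C := Submodule.span ℂ (Set.range fun j : Fin m => (N ^ (j : ℕ)) v) with hC
  have hCV : C ≤ V := by
    rw [hC, Submodule.span_le]
    rintro _ ⟨j, rfl⟩
    exact sh_pow_mem_maxGenEigenspace T j hv
  have hNC : ∀ x ∈ C, N x ∈ C := by
    intro x hx
    have hle : C ≤ C.comap N := by
      conv_lhs => rw [hC]
      rw [Submodule.span_le]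
      rintro _ ⟨j, rfl⟩
      change N ((N ^ (j : ℕ)) v) ∈ C
      rw [← Module.End.mul_apply, ← pow_succ']
      rcases lt_or_eq_of_le (Nat.succ_le_of_lt j.2) with h | h
      · exact Submodule.subset_span ⟨⟨j + 1, h⟩, rfl⟩
      · rw [show (j : ℕ) + 1 = m from h, hmV v hv]
        exact C.zero_mem
    exact hle hx
  -- the two summands
  let A : RepIndex τ n lam → Submodule ℂ M :=
    Sum.elim (fun i => C.map (cEnd Φ ^ (i : ℕ))) fun _ => ⊥
  let B : RepIndex τ n lam → Submodule ℂ M :=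
    Sum.elim (fun i => W.map (cEnd Φ ^ (i : ℕ))) fun μ => T.maxGenEigenspace (reps τ t n lam (Sum.inr μ))
  have hA : ∀ a, A a ≤ T.maxGenEigenspace (reps τ t n lam a) := by
    rintro (i | μ)
    · rintro _ ⟨x, hx, rfl⟩
      exact cEnd_pow_mem_genSum hinj i (hCV hx)
    · exact bot_le
  have hB : ∀ a, B a ≤ T.maxGenEigenspace (reps τ t n lam a) := by
    rintro (i | μ)
    · rintro _ ⟨x, hx, rfl⟩
      exact cEnd_pow_mem_genSum hinj i (hWV hx)
    · exact le_rfl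
  have hAB : ∀ a, Disjoint (A a) (B a) := by
    rintro (i | μ)
    · rw [Submodule.disjoint_def]
      rintro _ ⟨x, hx, rfl⟩ ⟨y, hy, hxy⟩
      have : y = x := cEnd_pow_injective hinj i hxy
      subst this
      rw [Submodule.disjoint_def.1 hdisj y hx hy, map_zero]
    · exact disjoint_bot_left
  have hU : Disjoint (⨆ a, A a) (⨆ a, B a) := disjoint_iSup_of_iSupIndep
    (T.independent_maxGenEigenspace.comp (reps_injective hτ hn hcop hlam)) hA hB hAB
  set X := Submodule.span K ((⨆ a, A a : Submodule ℂ M) : Set M) with hX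
  set Y := Submodule.span K ((⨆ a, B a : Submodule ℂ M) : Set M) with hY
  have hXY : Disjoint X Y := disjoint_span_of_disjoint (opT_smul Φ t n)
    (range_reps_inequivalent hτ hn hcop hlam)
    (iSup_le fun a => (hA a).trans (maxGenEigenspace_le_genSum T ⟨a, rfl⟩))
    (iSup_le fun a => (hB a).trans (maxGenEigenspace_le_genSum T ⟨a, rfl⟩)) hU
  have hAX : ∀ a, ∀ x ∈ A a, x ∈ X := fun a x hx =>
    Submodule.subset_span ((le_iSup A a) hx)
  have hBY : ∀ a, ∀ x ∈ B a, x ∈ Y := fun a x hx =>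
    Submodule.subset_span ((le_iSup B a) hx)
  have hCX : ∀ i < n, ∀ x ∈ C, (cEnd Φ ^ i) x ∈ X := fun i hi x hx =>
    hAX (Sum.inl ⟨i, hi⟩) _ ⟨x, hx, rfl⟩
  have hWY : ∀ i < n, ∀ x ∈ W, (cEnd Φ ^ i) x ∈ Y := fun i hi x hx =>
    hBY (Sum.inl ⟨i, hi⟩) _ ⟨x, hx, rfl⟩
  have hp0 : 0 < ‖(qpow τ 1 : ℂ)‖ ^ n := pow_pos (norm_pos_iff.2 hq) n
  have hp1 : ‖(qpow τ 1 : ℂ)‖ ^ n < 1 :=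
    pow_lt_one₀ (norm_nonneg _) (norm_qpow_lt_one hτ) hn.ne'
  -- A power of `z` moves the eigenvalue into the annulus of representatives, and `Y` is stable
  -- under dividing by it again.
  have hother : ∀ μ : ℂ, μ ≠ 0 → (∀ k : ℤ, μ ≠ (qpow τ 1 : ℂ) ^ k * lam) →
      ∀ x ∈ T.maxGenEigenspace μ, x ∈ Y := by
    intro μ hμ hk x hx
    obtain ⟨l, hl1, hl2⟩ := exists_zpow_mul_mem hp0 hp1 (norm_pos_iff.2 hμ)
    have hnorm : ‖(qpow τ 1 : ℂ) ^ (n * l) * μ‖ = (‖(qpow τ 1 : ℂ)‖ ^ n) ^ l * ‖μ‖ := by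
      rw [norm_mul, norm_zpow, zpow_mul, zpow_natCast]
    have h1 := hBY (Sum.inr ⟨(qpow τ 1 : ℂ) ^ (n * l) * μ, by rwa [hnorm], by rwa [hnorm],
      fun k h => hk (k - n * l) (by
        rw [zpow_sub₀ hq, div_mul_eq_mul_div, ← h, mul_div_cancel_left₀ _ (zpow_ne_zero _ hq)])⟩) _
      (monomial_smul_mem Φ t n (l := l) hx)
    have h2 := Y.smul_mem (monomial (-l) (1 : ℂ)) h1
    rwa [smul_smul, monomial_mul_monomial, neg_add_cancel, mul_one, monomial_zero_one, one_smul]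
      at h2
  have hstable : ∀ (F : RepIndex τ n lam → Submodule ℂ M) (P : Submodule K M),
      P = Submodule.span K ((⨆ a, F a : Submodule ℂ M) : Set M) →
      (∀ a, ∀ x ∈ F a, Φ x ∈ P) → IsDifferenceSubmodule Φ P := by
    intro F P hPF hF
    refine comap_eq_of_stable Φ hM.bijective.2 P fun x hx => ?_
    have hle : P ≤ P.comap Φ := by
      conv_lhs => rw [hPF]
      rw [Submodule.span_le]
      have : (⨆ a, F a) ≤ (P.comap Φ).restrictScalars ℂ := iSup_le fun a x hx => hF a x hx
      exact this
    exact hle hx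
  have hXs : IsDifferenceSubmodule Φ X := by
    refine hstable A X hX ?_
    rintro (i | μ) x hx
    · obtain ⟨x, hx, rfl⟩ := hx
      exact apply_mem_of_translates hNC hCX i.2 hx
    · rw [(Submodule.mem_bot ℂ).1 hx, map_zero]
      exact X.zero_mem
  have hYs : IsDifferenceSubmodule Φ Y := by
    refine hstable B Y hY ?_
    rintro (i | μ) x hx
    · obtain ⟨x, hx, rfl⟩ := hx
      exact apply_mem_of_translates hNW hWY i.2 hx
    -- `Φ` may lead out of the annulus, but `q^t μ` is still outside `q^ℤ lam`.
    · have h1 := (cEnd_pow_mem_iff Φ t n hinj 1 (μ : ℂ) x).2 hx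
      rw [pow_one, Nat.cast_one, mul_one] at h1
      have hμ0 : (μ : ℂ) ≠ 0 := norm_pos_iff.1 (hp0.trans μ.2.1)
      refine hother _ (mul_ne_zero (zpow_ne_zero _ hq) hμ0) (fun k h => ?_) _ h1
      refine μ.2.2.2 (k - t) ?_
      rw [zpow_sub₀ hq, div_mul_eq_mul_div, ← h, mul_div_cancel_left₀ _ (zpow_ne_zero _ hq)]
  have hsupXY : X ⊔ Y = ⊤ := by
    refine htop _ fun μ hμ x hx => ?_
    by_cases hk : ∃ k : ℤ, μ = (qpow τ 1 : ℂ) ^ k * lam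
    · obtain ⟨k, rfl⟩ := hk
      obtain ⟨i, l, rfl⟩ := exists_eq_mul_add_mul hn hcop k
      obtain ⟨y, hy, rfl⟩ := exists_of_mem_maxGenEigenspace Φ t n hM.bijective i l hx
      obtain ⟨a, ha, b, hb, rfl⟩ := Submodule.mem_sup.1 (hsup hy)
      refine Submodule.smul_mem _ _ ?_
      rw [map_add]
      exact Submodule.add_mem_sup (hCX i i.2 a ha) (hWY i i.2 b hb)
    · push Not at hk
      exact Submodule.mem_sup_right (hother μ hμ hk x hx)
  have hvX : v ∈ X := by
    have hvC : v ∈ C := Submodule.subset_span ⟨⟨0, hm0⟩, rfl⟩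
    exact hCX 0 hn v hvC
  have hv0 : v ≠ 0 := fun h => hvne (by rw [h, map_zero])
  have hXtop : X = ⊤ := by
    refine (hind.2 X Y hXs hYs ⟨hXY, codisjoint_iff.2 hsupXY⟩).resolve_right fun h => hv0 ?_
    exact Submodule.disjoint_def.1 hXY v hvX (h ▸ Submodule.mem_top)
  refine ⟨m, v, hm0, hmV v hv, linearIndependent_jordanVec hτ hn hcop hlam hinj hv (hmV v hv) hvne,
    ?_⟩
  rw [eq_top_iff, ← hXtop, hX, Submodule.span_le]
  set P := Submodule.span K (Set.range fun ij : Fin n × Fin m => jordanVec Φ t n lam v ij.1 ij.2)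
    with hP
  have hle : (⨆ a, A a) ≤ P.restrictScalars ℂ := by
    refine iSup_le ?_
    rintro (i | μ)
    · change C.map (cEnd Φ ^ (i : ℕ)) ≤ _
      rw [Submodule.map_le_iff_le_comap, hC, Submodule.span_le]
      rintro _ ⟨j, rfl⟩
      exact Submodule.subset_span ⟨(i, j), rfl⟩
    · exact bot_le
  exact hle

end Splitting

/-! ### Classification -/

theorem Admissible.ne_zero {τ : ℂ} {t : ℤ} {n : ℕ+} {c : ℂ} (h : Admissible τ t n c) : c ≠ 0 :=
  norm_pos_iff.1 (lt_of_le_of_lt (by positivity) h.2.1)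

/-- In terms of `c^n` the annulus is a fundamental domain for `q^ℤ`, whatever `n` is. -/
theorem Admissible.norm_lt {τ : ℂ} {t : ℤ} {n : ℕ+} {c : ℂ} (h : Admissible τ t n c) :
    ‖(qpow τ 1 : ℂ)‖ < ‖c ^ (n : ℕ)‖ := by
  have := pow_lt_pow_left₀ h.2.1 (by positivity) n.ne_zero
  rwa [Real.rpow_inv_natCast_pow (norm_nonneg _) n.ne_zero, ← norm_pow] at this

theorem Admissible.norm_le {τ : ℂ} {t : ℤ} {n : ℕ+} {c : ℂ} (h : Admissible τ t n c) :
    ‖c ^ (n : ℕ)‖ ≤ 1 := by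
  rw [norm_pow]
  exact pow_le_one₀ (norm_nonneg _) h.2.2

theorem admissible_of_norm {τ : ℂ} {t : ℤ} {n : ℕ+} {c : ℂ} (hcop : IsCoprime t (n : ℤ))
    (h1 : ‖(qpow τ 1 : ℂ)‖ < ‖c ^ (n : ℕ)‖) (h2 : ‖c ^ (n : ℕ)‖ ≤ 1) : Admissible τ t n c := by
  rw [norm_pow] at h1 h2
  refine ⟨hcop, ?_, (pow_le_one_iff_of_nonneg (norm_nonneg _) n.ne_zero).1 h2⟩
  refine lt_of_pow_lt_pow_left₀ (n : ℕ) (norm_nonneg _) ?_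
  rwa [Real.rpow_inv_natCast_pow (norm_nonneg _) n.ne_zero]

/-- The structure of a complex vector space on a vector space over `K`. -/
abbrev complexModule (M : Type*) [AddCommGroup M] [Module K M] : Module ℂ M :=
  Module.compHom M (algebraMap ℂ K)

theorem complexModule_isScalarTower (M : Type*) [AddCommGroup M] [Module K M] :
    letI := complexModule M
    IsScalarTower ℂ K M :=
  let _ := complexModule M
  ⟨fun c f x => by
    rw [Algebra.smul_def, mul_smul]
    rfl⟩

theorem isIndecomposable_isPure_ΦEU {τ : ℂ} (hτ : 0 < τ.im) {t : ℤ} {n : ℕ+} {c : ℂ} {m : ℕ}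
    (h : Admissible τ t n c) (hm : 1 ≤ m) :
    IsIndecomposable (ΦEU τ t n c m) ∧ IsPure (ΦEU τ t n c m) := by
  let _ := complexModule (Kn n ⊗[K] (Fin m → K))
  have := complexModule_isScalarTower (Kn n ⊗[K] (Fin m → K))
  have hg := isJordanGenerator_ΦEU τ h.1 h.ne_zero hm
  have hlam := chainScalar_ne_zero τ t n h.ne_zero n
  exact ⟨hg.isIndecomposable hτ h.1 hlam n.pos hm, hg.isPure hlam n.pos hm⟩

theorem exists_iso_ΦEU {τ : ℂ} (hτ : 0 < τ.im) {M : Type*} [AddCommGroup M] [Module K M]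
    {Φ : M →ₛₗ[φ τ] M} (hM : IsDifferenceModule Φ) (hind : IsIndecomposable Φ) (hpure : IsPure Φ) :
    ∃ (t : ℤ) (n : ℕ+) (c : ℂ) (m : ℕ), Admissible τ t n c ∧ 1 ≤ m ∧ Iso Φ (ΦEU τ t n c m) := by
  let _ := complexModule M
  have := complexModule_isScalarTower M
  obtain ⟨L, hL, s, -, hs⟩ := hpure
  have hnt := hind.1
  have hd : 0 < L.natDegree := by
    by_contra h0
    obtain ⟨-, -, e, -, hspan, -⟩ := hL
    have h0 : L.natDegree = 0 := by omega
    have hempty : IsEmpty (Fin L.natDegree) := by rw [h0]; exact Fin.isEmpty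
    rw [Set.range_eq_empty, Submodule.span_empty] at hspan
    exact bot_ne_top hspan
  let n : ℕ+ := ⟨s.den, s.den_pos⟩
  let t : ℤ := s.num
  have hcop : IsCoprime t ((n : ℕ) : ℤ) := by
    rw [Int.isCoprime_iff_nat_coprime]
    exact s.reduced
  have htop : ∀ P : Submodule K M,
      (∀ μ : ℂ, μ ≠ 0 → ∀ x ∈ (opT Φ t n).maxGenEigenspace μ, x ∈ P) → P = ⊤ := fun P hP =>
    eq_top_of_isPresentedBy hτ hM.bijective.1 hL hd hs n.ne_zero (Rat.num_div_den s).symm P hP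
  -- Otherwise the spanning property would hold for the zero submodule.
  obtain ⟨μ, hμ, x, hx, hx0⟩ : ∃ μ : ℂ, μ ≠ 0 ∧ ∃ x ∈ (opT Φ t n).maxGenEigenspace μ, x ≠ 0 := by
    by_contra! hne
    refine bot_ne_top (htop ⊥ fun μ hμ x hx => ?_)
    rw [hne μ hμ x hx]
    exact Submodule.zero_mem _
  have hq : (qpow τ 1 : ℂ) ≠ 0 := Units.ne_zero _
  have hκ : chainScalar τ t n 1 n ≠ 0 := chainScalar_ne_zero τ t n one_ne_zero n
  -- The eigenvalue of the model is `c^n κ` with `κ = chainScalar τ t n 1 n`. So `μ/κ` is moved into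
  -- the annulus by `q^k`, and `c` is an `n`-th root; the eigenvector is moved accordingly by `z^l
  -- Φ^i` with `k = t i + n l`.
  obtain ⟨k, hk1, hk2⟩ := exists_zpow_mul_mem (norm_pos_iff.2 hq) (norm_qpow_lt_one hτ)
    (norm_pos_iff.2 (div_ne_zero hμ hκ))
  obtain ⟨c, hc⟩ := IsAlgClosed.exists_pow_nat_eq
    ((qpow τ 1 : ℂ) ^ k * (μ / chainScalar τ t n 1 n)) n.pos
  have hnorm : ‖c ^ (n : ℕ)‖ = ‖(qpow τ 1 : ℂ)‖ ^ k * ‖μ / chainScalar τ t n 1 n‖ := by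
    rw [hc, norm_mul, norm_zpow]
  have hadm : Admissible τ t n c := admissible_of_norm hcop (by rwa [hnorm]) (by rwa [hnorm])
  have hlam : chainScalar τ t n c n = (qpow τ 1 : ℂ) ^ k * μ := by
    have : chainScalar τ t n c n = c ^ (n : ℕ) * chainScalar τ t n 1 n := by
      simp [chainScalar]
    rw [this, hc, mul_assoc, div_mul_cancel₀ _ hκ]
  have hlam0 := chainScalar_ne_zero τ t n hadm.ne_zero n
  obtain ⟨i, l, hil⟩ := exists_eq_mul_add_mul n.pos hcop k
  have hy : monomial l (1 : ℂ) • (cEnd Φ ^ (i : ℕ)) x ∈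
      (opT Φ t n).maxGenEigenspace (chainScalar τ t n c n) := by
    have := monomial_smul_mem Φ t n (l := l) ((cEnd_pow_mem_iff Φ t n hM.bijective.1 i μ x).2 hx)
    rwa [← mul_assoc, ← zpow_add₀ hq, add_comm, ← hil, ← hlam] at this
  have hy0 : monomial l (1 : ℂ) • (cEnd Φ ^ (i : ℕ)) x ≠ 0 :=
    smul_ne_zero (monomial_ne_zero l one_ne_zero) fun h =>
      hx0 (cEnd_pow_injective hM.bijective.1 i (by rw [h, map_zero]))
  obtain ⟨m, v, hm, hv⟩ := exists_isJordanGenerator hτ hM hind n.pos hcop htop hlam0 hy hy0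
  refine ⟨t, n, c, m, hadm, hm, ?_⟩
  let _ := complexModule (Kn n ⊗[K] (Fin m → K))
  have := complexModule_isScalarTower (Kn n ⊗[K] (Fin m → K))
  exact hv.iso (isJordanGenerator_ΦEU τ hcop hadm.ne_zero hm)

theorem data_eq_of_iso {τ : ℂ} (hτ : 0 < τ.im) {t t' : ℤ} {n n' : ℕ+} {c c' : ℂ} {m m' : ℕ}
    (h : Admissible τ t n c) (h' : Admissible τ t' n' c') (hm : 1 ≤ m) (hm' : 1 ≤ m')
    (hiso : Iso (ΦEU τ t n c m) (ΦEU τ t' n' c' m')) :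
    (t : ℚ) / n = (t' : ℚ) / n' ∧ c ^ (n : ℕ) = c' ^ (n' : ℕ) ∧ m = m' := by
  let _ := complexModule (Kn n ⊗[K] (Fin m → K))
  have := complexModule_isScalarTower (Kn n ⊗[K] (Fin m → K))
  let _ := complexModule (Kn n' ⊗[K] (Fin m' → K))
  have := complexModule_isScalarTower (Kn n' ⊗[K] (Fin m' → K))
  obtain ⟨e, he⟩ := hiso
  have hg := (isJordanGenerator_ΦEU τ h.1 h.ne_zero hm).map he
  have hg' := isJordanGenerator_ΦEU τ h'.1 h'.ne_zero hm'
  have hlam := chainScalar_ne_zero τ t n h.ne_zero n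
  have hlam' := chainScalar_ne_zero τ t' n' h'.ne_zero n'
  have hslope := hg.slope_eq hg' hlam hlam' n'.pos hm'
  -- The equal fractions are in lowest terms with positive denominators.
  have hn : n = n' := by
    have h1 : (n : ℤ) ∣ n' := h.1.symm.dvd_of_dvd_mul_left ⟨t', by rw [hslope]; ring⟩
    have h2 : (n' : ℤ) ∣ n := h'.1.symm.dvd_of_dvd_mul_left ⟨t, by rw [← hslope]; ring⟩
    have h3 : (n : ℕ) = n' := Nat.dvd_antisymm (by exact_mod_cast h1) (by exact_mod_cast h2)
    exact PNat.coe_injective h3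
  subst hn
  have ht : t = t' := mul_right_cancel₀ (by exact_mod_cast n.ne_zero) hslope
  subst ht
  have hmm : m = m' := by
    have h1 := hg.finrank_eq
    rw [hg'.finrank_eq] at h1
    exact (Nat.eq_of_mul_eq_mul_left n.pos h1).symm
  refine ⟨rfl, ?_, hmm⟩
  -- The end of the second chain is an eigenvector of the same `T`, so its eigenvalue lies in `q^ℤ`
  -- times the first one. The product of powers of `q` common to both eigenvalues cancels, and the
  -- annulus forces `k = 0`.
  obtain ⟨k, hk⟩ := hg.exists_eigenvalue_eq (μ := chainScalar τ t n c' n)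
    (hg'.pow_pred_ne_zero n.pos hm') (by
      have := sh_succ_apply (lam := chainScalar τ t n c' n)
        (v := constTensor n m' 0 (Pi.single ⟨m' - 1, by omega⟩ 1))
        (opT (ΦEU τ t n c' m') t n) (m' - 1)
      rwa [Nat.sub_add_cancel hm', hg'.pow_eq_zero, zero_add] at this)
  have hprod : ∏ l ∈ Finset.range n, (qpow τ ((n : ℂ)⁻¹) : ℂ) ^ (t * l) ≠ 0 :=
    Finset.prod_ne_zero_iff.2 fun _ _ => zpow_ne_zero _ (Units.ne_zero _)
  have hc : c' ^ (n : ℕ) = (qpow τ 1 : ℂ) ^ k * c ^ (n : ℕ) := by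
    rw [chainScalar, chainScalar, ← mul_assoc] at hk
    exact mul_right_cancel₀ hprod hk
  have hnorm : ‖c' ^ (n : ℕ)‖ = ‖(qpow τ 1 : ℂ)‖ ^ k * ‖c ^ (n : ℕ)‖ := by
    rw [hc, norm_mul, norm_zpow]
  have hk0 : k = 0 := zpow_eq_zero_of_mem (norm_pos_iff.2 (Units.ne_zero _))
    (norm_qpow_lt_one hτ) h.norm_lt h.norm_le (hnorm ▸ h'.norm_lt) (hnorm ▸ h'.norm_le)
  rw [hc, hk0, zpow_zero, one_mul]

end QDiff

end

theorem theorem3p5 (τ : ℂ) (hτ : 0 < τ.im) :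
    -- the modules `E(c z^{t/n}) ⊗ U_m` are indecomposable pure difference modules
    (∀ (t : ℤ) (n : ℕ+) (c : ℂ) (m : ℕ), QDiff.Admissible τ t n c → 1 ≤ m →
      QDiff.IsDifferenceModule (QDiff.ΦEU τ t n c m) ∧
      QDiff.IsIndecomposable (QDiff.ΦEU τ t n c m) ∧
      QDiff.IsPure (QDiff.ΦEU τ t n c m)) ∧
    -- every indecomposable pure difference module is isomorphic to one of them
    (∀ (M : Type*) [AddCommGroup M] [Module QDiff.K M] (Φ : M →ₛₗ[QDiff.φ τ] M),
      QDiff.IsDifferenceModule Φ → QDiff.IsIndecomposable Φ → QDiff.IsPure Φ →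
      ∃ (t : ℤ) (n : ℕ+) (c : ℂ) (m : ℕ), QDiff.Admissible τ t n c ∧ 1 ≤ m ∧
        QDiff.Iso Φ (QDiff.ΦEU τ t n c m)) ∧
    -- the triple `(t/n, c^n, m)` is determined by the module
    (∀ (t t' : ℤ) (n n' : ℕ+) (c c' : ℂ) (m m' : ℕ),
      QDiff.Admissible τ t n c → QDiff.Admissible τ t' n' c' → 1 ≤ m → 1 ≤ m' →
      QDiff.Iso (QDiff.ΦEU τ t n c m) (QDiff.ΦEU τ t' n' c' m') →
      (t : ℚ) / n = (t' : ℚ) / n' ∧ c ^ (n : ℕ) = c' ^ (n' : ℕ) ∧ m = m') := by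
  refine ⟨fun t n c m h hm => ⟨QDiff.isDifferenceModule_ΦEU τ t n h.ne_zero m,
    QDiff.isIndecomposable_isPure_ΦEU hτ h hm⟩, ?_, ?_⟩
  · intro M _ _ Φ hM hind hpure
    exact QDiff.exists_iso_ΦEU hτ hM hind hpure
  · intro t t' n n' c c' m m' h h' hm hm' hiso
    exact QDiff.data_eq_of_iso hτ h h' hm hm' hiso
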